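/- **Setting.** All Lie algebras and modules are over $\mathbb C$; the sign $\pm$ is fixed throughout. *The algebras $\widehat{\mathcal D}_x^{\pm}$.* Let $\mathcal D$ be the Lie algebra of operators $\sum_k t^kf_k(D)$ (finite sums, $k\in\mathbb Z$, $f_k\in\mathbb C[x]$, $D=t\,\frac{d}{dt}$), with 2-cocycle $\Psi(t^rf(D),t^sg(D))=\sum_{-r\le j\le -1}f(j)g(j+r)$ if $r=-s\ge 0$ and $\Psi=0$ if $r+s\ne0$. Let $\mathcal D_x^{\pm}\subset\mathcal D D$ be the Lie subalgebra of all $E$ with $\sigma_\pm(E)=-E$, where $\sigma_\pm(t^kf(D)D)=-(\pm t)^kf(-D-k)D$, and let $\widehat{\mathcal D}_x^{\pm}=\mathcal D_x^{\pm}\oplus\mathbb C\,C$ be its central extension by $\Psi$. *The algebras $\mathfrak g_\pm^{[m]}$.* For $m\ge 0$ put $R_m=\mathbb C[u]/(u^{m+1})$. Let $\mathfrak{gl}_\infty^{[m]}$ be the Lie algebra of matrices $(A_{ij})_{i,j\in\mathbb Z}$ over $R_m$ with finitely many nonzero diagonals, and $\widehat{\mathfrak{gl}}_\infty^{[m]}=\mathfrak{gl}_\infty^{[m]}\oplus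 R_m$ its central extension by the cocycle $\operatorname{tr}([J,A]B)$, $J=\sum_{j\le0}E_{jj}$. Given $s\in\mathbb C$, let $\mathfrak g_\pm^{[m]}$ be * $\widehat{\mathfrak{gl}}_\infty^{[m]}$ if $s\ne 0,\frac12$; * if $s=\frac12$: $\bar{\mathfrak g}\oplus R_m\subset \widehat{\mathfrak{gl}}_\infty^{[m]}$, where $\bar{\mathfrak g}$ consists of the $A$ with $A_{ij}(u)=-(\mp1)^{i+j}A_{1-j,1-i}(-u)$ for all $i,j$; * if $s=0$: $\bar{\mathfrak g}\oplus R_m\subset \widehat{\mathfrak{gl}}_\infty^{[m]}$, where $\bar{\mathfrak g}$ consists of the $A$ with $A_{ij}(u)=-(\mp1)^{i+j}A_{-j,-i}(-u)$ if $ij>0$ or $i=j=0$, $A_{ij}(u)=(\mp1)^{i+j}A_{-j,-i}(-u)$ if $ij<0$, and, for $i>0$, $A_{-i,0}(u)=(\mp1)^iu\,A_{0,i}(-u)$ and $A_{i,0}(u)=-(\mp1)^iu\,A_{0,-i}(-u)$. *The homomorphisms.* Let $\widehat\varphi_s^{[m],\pm}:\widehat{\mathcal D}_x^{\pm}\to\mathfrak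 g_\pm^{[m]}$ be the homomorphism with $C\mapsto 1\in R_m$ and $$t^kf(D)\mapsto \delta_{k,0}\,z(f)+\sum_{j\in\mathbb Z}f(s+u-j)\,\tau_{j-k,j}E_{j-k,j}.$$ Here the central term $z(f)\in R_m$ is determined by $2\sinh(x/2)\,z(\sinh(xD))=\cosh(x/2)-\cosh\big((s+u-\tfrac12)x\big)$, and the units $\tau_{ij}\in R_m$ satisfy $\tau_{ij}\tau_{jk}=\tau_{ik}$ and $\tau_{i,i+1}=u-i$ (replaced by $1$ for $i=0$) if $s=0$, $\tau_{i,i+1}=(u-i-\frac12)^{-1}$ if $s=\frac12$, and $\tau_{i,i+1}=1$ otherwise. For $\overline m=(m_1,\dots,m_N)\in\mathbb Z_{\ge0}^N$ and $\overline s=(s_1,\dots,s_N)\in\mathbb C^N$ let $\mathfrak g_\pm^{[\overline m]}=\bigoplus_{i=1}^N\mathfrak g_\pm^{[m_i]}$ (with $\mathfrak g_\pm^{[m_i]}$ attached to $s_i$) and $\widehat\varphi_{\overline s}^{[\overline m],\pm}=\bigoplus_i\widehat\varphi_{s_i}^{[m_i],\pm}:\widehat{\mathcal D}_x^{\pm}\to\mathfrak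 g_\pm^{[\overline m]}$. Call $\overline s$ *admissible* if $s_i\in\mathbb Z$ implies $s_i=0$, $s_i\in\mathbb Z+\frac12$ implies $s_i=\frac12$, and $s_i\not\equiv\pm s_j$ modulo $\mathbb Z$ for $i\ne j$. *Modules.* The Lie algebras $\mathfrak g_\pm^{[m]}$ and $\mathfrak g_\pm^{[\overline m]}$ carry the principal gradation: $E_{ij}$ has degree $j-i$, the centre $R_m$ has degree $0$. A graded module $V=\bigoplus_{j\in\mathbb Z}V_j$ (so $\mathfrak g_kV_j\subset V_{k+j}$) is *quasifinite* if all $V_j$ are finite-dimensional. For $\lambda\in\mathfrak g_0^*$, $L(\mathfrak g,\lambda)$ denotes the irreducible highest weight module: graded, generated by a nonzero $v\in V_0$ with $hv=\lambda(h)v$ for $h\in\mathfrak g_0$ and $\mathfrak g_kv=0$ for $k>0$, and without graded submodules other than $0$ and itself. **Theorem.** Let $\overline m\in\mathbb Z_{\ge0}^N$ and let $\overline s\in\mathbb C^N$ be admissible. 1. Let $V$ be a quasifinite $\mathfrak g_\pm^{[\overline m]}$-module, regarded as a $\widehat{\mathcal D}_x^{\pm}$-module via $\widehat\varphi_{\overline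 s}^{[\overline m],\pm}$, and let $U\subset V$ be a (not necessarily graded) $\widehat{\mathcal D}_x^{\pm}$-submodule. Then $U$ is invariant under the derived algebra $[\mathfrak g_\pm^{[\overline m]},\mathfrak g_\pm^{[\overline m]}]$. Moreover, if $U$ is invariant under the central elements $u^j\in R_{m_i}\subset\mathfrak g_\pm^{[m_i]}$ with $j\le m_i$ odd and $s_i\in\{0,\frac12\}$ (an empty condition if $m_i=0$ or $s_i\notin\{0,\frac12\}$ for every $i$, and automatic if these elements act on $V$ by scalars), then $U$ is a $\mathfrak g_\pm^{[\overline m]}$-submodule of $V$. 2. For all $\lambda_i\in(\mathfrak g_\pm^{[m_i]})_0^*$ such that $L(\mathfrak g_\pm^{[m_i]},\lambda_i)$ is quasifinite ($i=1,\dots,N$), the $\widehat{\mathcal D}_x^{\pm}$-module $$L_{\overline s}^{[\overline m]}(\overline\lambda)=\bigotimes_{i=1}^NL(\mathfrak g_\pm^{[m_i]},\lambda_i),$$ on which $\widehat{\mathcal D}_x^{\pm}$ acts through $\widehat\varphi_{\overline s}^{[\overline m],\pm}$, is irreducible. -/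

import Mathlib

open Polynomial
open scoped DirectSum TensorProduct

noncomputable section

namespace WInf


/-! ### Central extensions of complex Lie algebras by 2-cocycles -/

section CentralExtension

variable {L M : Type*} [LieRing L] [LieAlgebra ℂ L] [AddCommGroup M] [Module ℂ M]

/-- A bilinear 2-cocycle on `L` with values in the trivial module `M`. -/
structure Cocycle (L M : Type*) [LieRing L] [LieAlgebra ℂ L] [AddCommGroup M] [Module ℂ M] where
  form : L →ₗ[ℂ] L →ₗ[ℂ] M
  alt : ∀ x, form x x = 0
  jacobi : ∀ x y z, form ⁅x, y⁆ z = form x ⁅y, z⁆ - form y ⁅x, z⁆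

theorem Cocycle.skew (c : Cocycle L M) (x y : L) : c.form x y = - c.form y x := by
  have h := c.alt (x + y)
  simp only [map_add, LinearMap.add_apply, c.alt, zero_add, add_zero] at h
  exact eq_neg_of_add_eq_zero_right h

/-- The central extension `L ⊕ M` of `L` by the 2-cocycle `c`. -/
def CentralExt (_ : Cocycle L M) : Type _ := L × M

namespace CentralExt

variable (c : Cocycle L M)

instance : AddCommGroup (CentralExt c) := inferInstanceAs (AddCommGroup (L × M))
instance : Module ℂ (CentralExt c) := inferInstanceAs (Module ℂ (L × M))

instance : LieRing (CentralExt c) where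
  bracket x y := ((⁅x.1, y.1⁆, c.form x.1 y.1) : L × M)
  add_lie x y z := by
    refine Prod.ext (add_lie x.1 y.1 z.1) ?_
    change c.form (x.1 + y.1) z.1 = c.form x.1 z.1 + c.form y.1 z.1
    simp
  lie_add x y z := by
    refine Prod.ext (lie_add x.1 y.1 z.1) ?_
    change c.form x.1 (y.1 + z.1) = c.form x.1 y.1 + c.form x.1 z.1
    simp
  lie_self x := Prod.ext (lie_self x.1) (c.alt x.1)
  leibniz_lie x y z := by
    refine Prod.ext (leibniz_lie x.1 y.1 z.1) ?_
    change c.form x.1 ⁅y.1, z.1⁆ = c.form ⁅x.1, y.1⁆ z.1 + c.form y.1 ⁅x.1, z.1⁆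
    rw [c.jacobi]; abel

instance : LieAlgebra ℂ (CentralExt c) where
  lie_smul t x y := by
    refine Prod.ext (lie_smul t x.1 y.1) ?_
    change c.form x.1 (t • y.1) = t • c.form x.1 y.1
    simp

/-- The projection of the central extension onto `L`. -/
def proj : CentralExt c →ₗ⁅ℂ⁆ L where
  toFun x := x.1
  map_add' _ _ := rfl
  map_smul' _ _ := rfl
  map_lie' := rfl

/-- The element `(x, z)` of the central extension. -/
def mk (x : L) (z : M) : CentralExt c := (x, z)

variable {c}

theorem fst_lie (x y : CentralExt c) : (⁅x, y⁆ : CentralExt c).1 = ⁅x.1, y.1⁆ := rfl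
theorem snd_lie (x y : CentralExt c) : (⁅x, y⁆ : CentralExt c).2 = c.form x.1 y.1 := rfl

end CentralExt

end CentralExtension

/-! ### The Lie algebra of infinite matrices with finitely many nonzero diagonals -/

section Gl

set_option linter.unusedSectionVars false

variable {R : Type*} [CommRing R] [Algebra ℂ R]

variable (R) in
/-- Matrices `(a_{ij})`, `i, j ∈ ℤ`, over `R` with finitely many nonzero diagonals. -/
def glModule : Submodule ℂ (ℤ → ℤ → R) where
  carrier := {A | {k : ℤ | ∃ i, A i (i + k) ≠ 0}.Finite}
  zero_mem' := by simp
  add_mem' {A B} hA hB := by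
    refine (hA.union hB).subset ?_
    rintro k ⟨i, hi⟩
    by_contra h
    simp only [Set.mem_union, Set.mem_ofPred_eq, not_or, not_exists, not_not] at h
    exact hi (by rw [Pi.add_apply, Pi.add_apply, h.1, h.2, add_zero])
  smul_mem' c A hA := by
    refine hA.subset ?_
    rintro k ⟨i, hi⟩
    exact ⟨i, fun h => hi (by rw [Pi.smul_apply, Pi.smul_apply, h, smul_zero])⟩

variable (R) in
/-- The space of matrices `(a_{ij})`, `i, j ∈ ℤ`, over `R` with finitely many nonzero diagonals. -/
def gl : Type _ := glModule R

namespace gl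

instance : AddCommGroup (gl R) := inferInstanceAs (AddCommGroup (glModule R))
instance : Module ℂ (gl R) := inferInstanceAs (Module ℂ (glModule R))

/-- The `(i, j)` entry. -/
def entry (A : gl R) (i j : ℤ) : R := A.1 i j

@[ext] theorem ext {A B : gl R} (h : ∀ i j, A.entry i j = B.entry i j) : A = B :=
  Subtype.ext (funext fun i => funext fun j => h i j)

@[simp] theorem entry_add (A B : gl R) (i j : ℤ) :
    (A + B).entry i j = A.entry i j + B.entry i j := rfl
@[simp] theorem entry_sub (A B : gl R) (i j : ℤ) :
    (A - B).entry i j = A.entry i j - B.entry i j := rfl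
@[simp] theorem entry_neg (A : gl R) (i j : ℤ) : (-A).entry i j = - A.entry i j := rfl
@[simp] theorem entry_zero (i j : ℤ) : (0 : gl R).entry i j = 0 := rfl
@[simp] theorem entry_smul (c : ℂ) (A : gl R) (i j : ℤ) :
    (c • A).entry i j = c • A.entry i j := rfl

theorem exists_band (A : gl R) : ∃ b : ℤ, ∀ i j, A.entry i j ≠ 0 → |j - i| ≤ b := by
  obtain ⟨b, hb⟩ := Set.Finite.bddAbove (Set.Finite.image (fun k : ℤ => |k|) A.2)
  exact ⟨b, fun i j h => hb ⟨j - i, ⟨i, by rw [add_sub_cancel]; exact h⟩, rfl⟩⟩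

theorem row_finite (A : gl R) (i : ℤ) : (Function.support fun k => A.entry i k).Finite := by
  obtain ⟨b, hb⟩ := A.exists_band
  refine (Finset.Icc (i - b) (i + b)).finite_toSet.subset fun k hk => ?_
  have := hb i k hk
  rw [abs_le] at this
  simp only [Finset.coe_Icc, Set.mem_Icc]
  omega

theorem col_finite (A : gl R) (j : ℤ) : (Function.support fun k => A.entry k j).Finite := by
  obtain ⟨b, hb⟩ := A.exists_band
  refine (Finset.Icc (j - b) (j + b)).finite_toSet.subset fun k hk => ?_
  have := hb k j hk
  rw [abs_le] at this
  simp only [Finset.coe_Icc, Set.mem_Icc]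
  omega

theorem mul_support (A B : gl R) (i j : ℤ) :
    (Function.support fun k => A.entry i k * B.entry k j).Finite :=
  (A.row_finite i).subset fun _ hk => left_ne_zero_of_mul hk

theorem exists_of_finsum_ne_zero {f : ℤ → R} (h : ∑ᶠ k, f k ≠ 0) : ∃ k, f k ≠ 0 := by
  by_contra! h'
  exact h (by simp [h'])

/-- Matrix multiplication. -/
instance : Mul (gl R) where
  mul A B := ⟨fun i j => ∑ᶠ k, A.entry i k * B.entry k j, by
    refine (A.2.add B.2).subset ?_
    rintro k ⟨i, hi⟩
    obtain ⟨l, hl⟩ := exists_of_finsum_ne_zero hi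
    refine Set.mem_add.2 ⟨l - i, ⟨i, ?_⟩, k - (l - i), ⟨l, ?_⟩, by ring⟩
    · rw [show i + (l - i) = l by ring]; exact left_ne_zero_of_mul hl
    · rw [show l + (k - (l - i)) = i + k by ring]; exact right_ne_zero_of_mul hl⟩

theorem entry_mul (A B : gl R) (i j : ℤ) :
    (A * B).entry i j = ∑ᶠ k, A.entry i k * B.entry k j := rfl

theorem mul_eq_sum (A B : gl R) (i j : ℤ) (s : Finset ℤ)
    (h : ∀ k, A.entry i k * B.entry k j ≠ 0 → k ∈ s) :
    (A * B).entry i j = ∑ k ∈ s, A.entry i k * B.entry k j :=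
  finsum_eq_sum_of_support_subset _ fun i hi => h i hi

/-- The matrix `∑_j a_j E_{j-k,j}`. -/
def diag (k : ℤ) (a : ℤ → R) : gl R := ⟨fun i j => if j - i = k then a j else 0, by
  refine (Set.finite_singleton k).subset ?_
  rintro l ⟨i, hi⟩
  by_contra h
  exact hi (if_neg (by simpa using h))⟩

theorem entry_diag (k : ℤ) (a : ℤ → R) (i j : ℤ) :
    (diag k a).entry i j = if j - i = k then a j else 0 := rfl

theorem entry_diag_mul (k : ℤ) (a : ℤ → R) (A : gl R) (i j : ℤ) :
    (diag k a * A).entry i j = a (i + k) * A.entry (i + k) j := by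
  rw [mul_eq_sum _ _ _ _ {i + k}]
  · simp [entry_diag]
  · intro l hl
    have := left_ne_zero_of_mul hl
    rw [Finset.mem_singleton]
    by_contra h
    exact this (if_neg (by omega))

theorem entry_mul_diag (k : ℤ) (a : ℤ → R) (A : gl R) (i j : ℤ) :
    (A * diag k a).entry i j = A.entry i (j - k) * a j := by
  rw [mul_eq_sum _ _ _ _ {j - k}]
  · simp [entry_diag]
  · intro l hl
    have := right_ne_zero_of_mul hl
    rw [Finset.mem_singleton]
    by_contra h
    exact this (if_neg (by omega))

theorem diag_mul_diag (k l : ℤ) (a b : ℤ → R) :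
    diag k a * diag l b = diag (k + l) fun j => a (j - l) * b j := by
  ext i j
  rw [entry_diag_mul, entry_diag, entry_diag]
  by_cases h : j - i = k + l
  · rw [if_pos (by omega), if_pos h, show i + k = j - l by omega]
  · rw [if_neg (by omega), if_neg h, mul_zero]

instance : One (gl R) := ⟨diag 0 fun _ => 1⟩

theorem one_def : (1 : gl R) = diag 0 fun _ => 1 := rfl

instance : Ring (gl R) where
  __ := (inferInstance : AddCommGroup (gl R))
  left_distrib A B E := by
    ext i j
    simp only [entry_add, entry_mul, mul_add]
    exact finsum_add_distrib (mul_support A B i j) (mul_support A E i j)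
  right_distrib A B E := by
    ext i j
    simp only [entry_add, entry_mul, add_mul]
    exact finsum_add_distrib (mul_support A E i j) (mul_support B E i j)
  zero_mul A := by ext i j; simp [entry_mul]
  mul_zero A := by ext i j; simp [entry_mul]
  mul_assoc A B E := by
    ext i j
    rw [mul_eq_sum (A * B) E i j (E.col_finite j).toFinset
        fun k hk => by simpa using right_ne_zero_of_mul hk,
      mul_eq_sum A (B * E) i j (A.row_finite i).toFinset
        fun k hk => by simpa using left_ne_zero_of_mul hk]
    have h1 : ∀ k, (A * B).entry i k = ∑ l ∈ (A.row_finite i).toFinset,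
        A.entry i l * B.entry l k := fun k => mul_eq_sum _ _ _ _ _
          fun l hl => by simpa using left_ne_zero_of_mul hl
    have h2 : ∀ l, (B * E).entry l j = ∑ k ∈ (E.col_finite j).toFinset,
        B.entry l k * E.entry k j := fun k => mul_eq_sum _ _ _ _ _
          fun l hl => by simpa using right_ne_zero_of_mul hl
    simp only [h1, h2, Finset.sum_mul, Finset.mul_sum, mul_assoc]
    exact Finset.sum_comm
  one_mul A := by ext i j; rw [one_def, entry_diag_mul]; simp
  mul_one A := by ext i j; rw [one_def, entry_mul_diag]; simp

instance : Algebra ℂ (gl R) :=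
  Algebra.ofModule
    (fun c A B => by ext i j; simp only [entry_mul, entry_smul, smul_mul_assoc, smul_finsum])
    (fun c A B => by ext i j; simp only [entry_mul, entry_smul, mul_smul_comm, smul_finsum])

/-- The commutator bracket. -/
instance : LieRing (gl R) := LieRing.ofAssociativeRing

instance : LieAlgebra ℂ (gl R) := LieAlgebra.ofAssociativeAlgebra

theorem lie_def (A B : gl R) : ⁅A, B⁆ = A * B - B * A := rfl

variable (R) in
/-- The diagonal matrix `J = ∑_{j ≤ 0} E_{jj}`. -/
def matJ : gl R := diag 0 fun j => if j ≤ 0 then 1 else 0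

/-- The sum of the diagonal entries, for matrices with finitely many nonzero ones. -/
def tr (A : gl R) : R := ∑ᶠ i, A.entry i i

/-- Matrices with finitely many nonzero entries. -/
def IsFin (A : gl R) : Prop := (Function.support fun i => A.entry i i).Finite ∧
  ∃ n : ℤ, ∀ i j, A.entry i j ≠ 0 → i ∈ Finset.Icc (-n) n ∧ j ∈ Finset.Icc (-n) n

theorem isFin_of (A : gl R) (n : ℤ)
    (h : ∀ i j, A.entry i j ≠ 0 → i ∈ Finset.Icc (-n) n ∧ j ∈ Finset.Icc (-n) n) : IsFin A :=
  ⟨(Finset.Icc (-n) n).finite_toSet.subset fun i hi => (h i i hi).1, n, h⟩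

theorem tr_eq_sum (A : gl R) (s : Finset ℤ) (h : ∀ i, A.entry i i ≠ 0 → i ∈ s) :
    tr A = ∑ i ∈ s, A.entry i i :=
  finsum_eq_sum_of_support_subset _ fun i hi => h i hi

theorem tr_mul_comm (A B : gl R) (hA : IsFin A) : tr (A * B) = tr (B * A) := by
  obtain ⟨-, n, hn⟩ := hA
  have h1 : ∀ i j k, A.entry i k * B.entry k j ≠ 0 → k ∈ Finset.Icc (-n) n := fun i j k hk =>
    (hn i k (left_ne_zero_of_mul hk)).2
  have h2 : ∀ i j k, B.entry i k * A.entry k j ≠ 0 → k ∈ Finset.Icc (-n) n := fun i j k hk =>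
    (hn k j (right_ne_zero_of_mul hk)).1
  rw [tr_eq_sum (A * B) (Finset.Icc (-n) n), tr_eq_sum (B * A) (Finset.Icc (-n) n)]
  · simp_rw [mul_eq_sum A B _ _ _ (h1 _ _), mul_eq_sum B A _ _ _ (h2 _ _)]
    rw [Finset.sum_comm]
    exact Finset.sum_congr rfl fun i _ => Finset.sum_congr rfl fun j _ => mul_comm _ _
  · intro i hi
    rw [entry_mul] at hi
    obtain ⟨l, hl⟩ := exists_of_finsum_ne_zero hi
    exact (hn l i (right_ne_zero_of_mul hl)).2
  · intro i hi
    rw [entry_mul] at hi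
    obtain ⟨l, hl⟩ := exists_of_finsum_ne_zero hi
    exact (hn i l (left_ne_zero_of_mul hl)).1

theorem entry_J_lie (A : gl R) (i j : ℤ) : (⁅matJ R, A⁆).entry i j
    = ((if i ≤ 0 then 1 else 0) - (if j ≤ 0 then 1 else 0)) * A.entry i j := by
  rw [lie_def, entry_sub, matJ, entry_diag_mul, entry_mul_diag, add_zero, sub_zero]
  ring

theorem isFin_J_lie (A : gl R) : IsFin ⁅matJ R, A⁆ := by
  obtain ⟨b, hb⟩ := A.exists_band
  refine isFin_of _ b fun i j h => ?_
  rw [entry_J_lie] at h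
  have h1 := hb i j (right_ne_zero_of_mul h)
  have h2 := left_ne_zero_of_mul h
  rw [abs_le] at h1
  simp only [Finset.mem_Icc]
  by_cases hi : i ≤ 0 <;> by_cases hj : j ≤ 0 <;> simp [hi, hj] at h2 <;> omega

theorem IsFin.mul_right {A : gl R} (hA : IsFin A) (B : gl R) : IsFin (A * B) := by
  obtain ⟨-, n, hn⟩ := hA
  obtain ⟨b, hb⟩ := B.exists_band
  refine isFin_of _ (n + |b|) fun i j h => ?_
  rw [entry_mul] at h
  obtain ⟨l, hl⟩ := exists_of_finsum_ne_zero h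
  have h0 := hn i l (left_ne_zero_of_mul hl)
  have h1 := hb l j (right_ne_zero_of_mul hl)
  have h2 := le_abs_self b
  rw [abs_le] at h1
  simp only [Finset.mem_Icc] at h0 ⊢
  omega

theorem IsFin.mul_left {A : gl R} (hA : IsFin A) (B : gl R) : IsFin (B * A) := by
  obtain ⟨-, n, hn⟩ := hA
  obtain ⟨b, hb⟩ := B.exists_band
  refine isFin_of _ (n + |b|) fun i j h => ?_
  rw [entry_mul] at h
  obtain ⟨l, hl⟩ := exists_of_finsum_ne_zero h
  have h0 := hn l j (right_ne_zero_of_mul hl)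
  have h1 := hb i l (left_ne_zero_of_mul hl)
  have h2 := le_abs_self b
  rw [abs_le] at h1
  simp only [Finset.mem_Icc] at h0 ⊢
  omega

theorem IsFin.sub {A B : gl R} (hA : IsFin A) (hB : IsFin B) : IsFin (A - B) := by
  obtain ⟨-, n, hn⟩ := hA
  obtain ⟨-, b, hb⟩ := hB
  refine isFin_of _ (max n b) fun i j h => ?_
  have h1 := le_max_left n b
  have h2 := le_max_right n b
  by_cases h0 : A.entry i j = 0
  · have := hb i j fun h' => h (by simp [h0, h'])
    simp only [Finset.mem_Icc] at this ⊢
    omega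
  · have := hn i j h0
    simp only [Finset.mem_Icc] at this ⊢
    omega

theorem tr_add {A B : gl R} (hA : IsFin A) (hB : IsFin B) : tr (A + B) = tr A + tr B :=
  finsum_add_distrib hA.1 hB.1

theorem tr_sub {A B : gl R} (hA : IsFin A) (hB : IsFin B) : tr (A - B) = tr A - tr B :=
  finsum_sub_distrib hA.1 hB.1

theorem tr_smul (c : ℂ) (A : gl R) : tr (c • A) = c • tr A :=
  (smul_finsum c _).symm

theorem tr_J_lie_mul_self (A : gl R) : tr (⁅matJ R, A⁆ * A) = 0 := by
  have h1 : ∀ i, (⁅matJ R, A⁆ * A).entry i i + (A * ⁅matJ R, A⁆).entry i i = 0 := by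
    intro i
    rw [entry_mul, entry_mul, ← finsum_add_distrib (mul_support _ _ _ _) (mul_support _ _ _ _)]
    have : ∀ k, (⁅matJ R, A⁆).entry i k * A.entry k i + A.entry i k * (⁅matJ R, A⁆).entry k i
        = 0 := by
      intro k; rw [entry_J_lie, entry_J_lie]; ring
    simp [this]
  have h2 : tr (⁅matJ R, A⁆ * A) + tr (A * ⁅matJ R, A⁆) = 0 := by
    rw [← tr_add ((isFin_J_lie A).mul_right A) ((isFin_J_lie A).mul_left A)]
    simp only [tr, entry_add, h1, finsum_zero]
  rw [← tr_mul_comm _ _ (isFin_J_lie A), ← two_smul ℂ] at h2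
  exact (smul_eq_zero_iff_right (two_ne_zero' ℂ)).1 h2

variable (R) in
/-- The 2-cocycle `C(A, B) = tr([J, A] B)` on the Lie algebra of matrices with finitely many nonzero
diagonals, with values in `R`. -/
def cocycle : Cocycle (gl R) R where
  form := LinearMap.mk₂ ℂ (fun A B => tr (⁅matJ R, A⁆ * B))
    (fun A A' B => by
      rw [← tr_add ((isFin_J_lie A).mul_right B) ((isFin_J_lie A').mul_right B),
        ← add_mul, ← lie_add])
    (fun c A B => by rw [← tr_smul, ← smul_mul_assoc, ← lie_smul])
    (fun A B B' => by
      rw [← tr_add ((isFin_J_lie A).mul_right B) ((isFin_J_lie A).mul_right B'), ← mul_add])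
    (fun c A B => by rw [← tr_smul, ← mul_smul_comm])
  alt A := tr_J_lie_mul_self A
  jacobi A B E := by
    simp only [LinearMap.mk₂_apply]
    have hA := isFin_J_lie A
    have hB := isFin_J_lie B
    have h0 : ⁅matJ R, ⁅A, B⁆⁆ * E =
        (⁅matJ R, A⁆ * (B * E) - B * (⁅matJ R, A⁆ * E))
          - (⁅matJ R, B⁆ * (A * E) - A * (⁅matJ R, B⁆ * E)) := by
      simp only [lie_def]; noncomm_ring
    have k1 := hA.mul_right (B * E)
    have k2 := (hA.mul_right E).mul_left B
    have k3 := hB.mul_right (A * E)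
    have k4 := (hB.mul_right E).mul_left A
    rw [h0, tr_sub (k1.sub k2) (k3.sub k4), tr_sub k1 k2, tr_sub k3 k4,
      ← tr_mul_comm _ _ (hA.mul_right E), ← tr_mul_comm _ _ (hB.mul_right E), lie_def B E,
      lie_def A E, mul_sub, mul_sub, tr_sub k1 (hA.mul_right (E * B)),
      tr_sub k3 (hB.mul_right (E * A)), mul_assoc, mul_assoc]

theorem cocycle_apply (A B : gl R) : (cocycle R).form A B = tr (⁅matJ R, A⁆ * B) := rfl

end gl

end Gl

/-! ### The Lie algebra of differential operators on the circle -/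

/-- The space of regular differential operators on the circle: finite sums of the operators
`t ^ k f(D)` with `k ∈ ℤ`, `f ∈ ℂ[x]` and `D = t d/dt`, encoded by `k ↦ f`. -/
def DiffOp : Type := ℤ →₀ ℂ[X]

namespace DiffOp

instance : AddCommGroup DiffOp := inferInstanceAs (AddCommGroup (ℤ →₀ ℂ[X]))
instance : Module ℂ DiffOp := inferInstanceAs (Module ℂ (ℤ →₀ ℂ[X]))

/-- The polynomial `f` in the summand `t ^ k f(D)`. -/
def coeff (k : ℤ) : DiffOp →ₗ[ℂ] ℂ[X] := (Finsupp.lapply k : (ℤ →₀ ℂ[X]) →ₗ[ℂ] ℂ[X])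

/-- The operator `t ^ k f(D)`. -/
def tD (k : ℤ) : ℂ[X] →ₗ[ℂ] DiffOp := (Finsupp.lsingle k : ℂ[X] →ₗ[ℂ] (ℤ →₀ ℂ[X]))

/-- The linear map given on the operators `t ^ k f(D)` by `φ k f`. -/
def lift {M : Type*} [AddCommGroup M] [Module ℂ M] (φ : ℤ → ℂ[X] →ₗ[ℂ] M) : DiffOp →ₗ[ℂ] M :=
  (Finsupp.lsum ℂ φ : (ℤ →₀ ℂ[X]) →ₗ[ℂ] M)

@[simp] theorem lift_tD {M : Type*} [AddCommGroup M] [Module ℂ M] (φ : ℤ → ℂ[X] →ₗ[ℂ] M)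
    (k : ℤ) (f : ℂ[X]) : lift φ (tD k f) = φ k f := by
  change (Finsupp.lsum ℂ φ : (ℤ →₀ ℂ[X]) →ₗ[ℂ] M) (Finsupp.single k f) = φ k f
  simp

theorem coeff_tD (k l : ℤ) (f : ℂ[X]) : coeff k (tD l f) = if l = k then f else 0 := by
  change (Finsupp.single l f : ℤ →₀ ℂ[X]) k = _
  rw [Finsupp.single_apply]

theorem ext {A B : DiffOp} (h : ∀ k, coeff k A = coeff k B) : A = B :=
  Finsupp.ext h

theorem induction {p : DiffOp → Prop} (A : DiffOp) (h0 : p 0)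
    (hadd : ∀ A B, p A → p B → p (A + B)) (h : ∀ k f, p (tD k f)) : p A :=
  Finsupp.induction_linear (motive := p) A h0 hadd h

/-- The shift `f(D) ↦ f(D + a)`. -/
def shift (a : ℂ) : ℂ[X] →ₗ[ℂ] ℂ[X] where
  toFun f := f.comp (X + C a)
  map_add' _ _ := add_comp
  map_smul' c f := smul_comp c f _

/-- Composition of operators: `t ^ r f(D) t ^ s g(D) = t ^ (r + s) f(D + s) g(D)`. -/
def mulHom : DiffOp →ₗ[ℂ] DiffOp →ₗ[ℂ] DiffOp :=
  lift fun r => LinearMap.flip (lift fun s =>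
    LinearMap.flip (((LinearMap.mul ℂ ℂ[X]).compr₂ (tD (r + s))).comp (shift s)))

instance : Mul DiffOp := ⟨fun A B => mulHom A B⟩

theorem tD_mul_tD (r s : ℤ) (f g : ℂ[X]) :
    tD r f * tD s g = tD (r + s) (f.comp (X + C (s : ℂ)) * g) := by
  change mulHom _ _ = _
  simp [mulHom, shift]

theorem add_mul' (A B E : DiffOp) : (A + B) * E = A * E + B * E := by
  change mulHom _ _ = mulHom _ _ + mulHom _ _
  simp

theorem mul_add' (A B E : DiffOp) : A * (B + E) = A * B + A * E := by
  change mulHom _ _ = mulHom _ _ + mulHom _ _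
  simp

theorem zero_mul' (A : DiffOp) : 0 * A = 0 := by
  change mulHom _ _ = _
  simp

theorem mul_zero' (A : DiffOp) : A * 0 = 0 := by
  change mulHom _ _ = _
  simp

theorem smul_mul' (c : ℂ) (A B : DiffOp) : (c • A) * B = c • (A * B) := by
  change mulHom _ _ = c • mulHom _ _
  simp

theorem mul_smul' (c : ℂ) (A B : DiffOp) : A * (c • B) = c • (A * B) := by
  change mulHom _ _ = c • mulHom _ _
  simp

theorem mul_assoc' (A B E : DiffOp) : A * B * E = A * (B * E) := by
  induction A using DiffOp.induction with
  | h0 => simp only [zero_mul']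
  | hadd A A' h h' => simp only [add_mul', h, h']
  | h r f =>
  induction B using DiffOp.induction with
  | h0 => simp only [zero_mul', mul_zero']
  | hadd A A' h h' => simp only [add_mul', mul_add', h, h']
  | h s g =>
  induction E using DiffOp.induction with
  | h0 => simp only [mul_zero']
  | hadd A A' h h' => simp only [mul_add', h, h']
  | h t e =>
  simp only [tD_mul_tD, mul_comp, comp_assoc, add_comp, X_comp, C_comp]
  rw [add_assoc r s t, ← mul_assoc, show (X + C (t : ℂ) + C (s : ℂ) : ℂ[X])
    = X + C ((s + t : ℤ) : ℂ) by rw [Int.cast_add, C_add]; ring]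

instance : NonUnitalRing DiffOp where
  __ := (inferInstance : AddCommGroup DiffOp)
  left_distrib := mul_add'
  right_distrib := add_mul'
  zero_mul := zero_mul'
  mul_zero := mul_zero'
  mul_assoc := mul_assoc'

/-- The commutator bracket. -/
instance : LieRing DiffOp where
  bracket A B := A * B - B * A
  add_lie A B E := by change (A + B) * E - E * (A + B) = (A * E - E * A) + (B * E - E * B)
                      simp only [mul_add, add_mul]; abel
  lie_add A B E := by change A * (B + E) - (B + E) * A = (A * B - B * A) + (A * E - E * A)
                      simp only [mul_add, add_mul]; abel
  lie_self A := sub_self _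
  leibniz_lie A B E := by
    change A * (B * E - E * B) - (B * E - E * B) * A
      = ((A * B - B * A) * E - E * (A * B - B * A))
        + (B * (A * E - E * A) - (A * E - E * A) * B)
    simp only [mul_sub, sub_mul, mul_assoc]; abel

instance : LieAlgebra ℂ DiffOp where
  lie_smul c A B := by
    change A * (c • B) - (c • B) * A = c • (A * B - B * A)
    rw [mul_smul', smul_mul', smul_sub]

theorem lie_def (A B : DiffOp) : ⁅A, B⁆ = A * B - B * A := rfl

/-- The bilinear form `Ψ` on differential operators: `Ψ(t^r f(D), t^s g(D))` is
`∑_{-r ≤ m ≤ -1} f(m) g(m + r)` if `r = -s > 0`, minus the same expression with the arguments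
exchanged if `r = -s < 0`, and `0` if `r + s ≠ 0` or `r = s = 0`. -/
def psi : DiffOp →ₗ[ℂ] DiffOp →ₗ[ℂ] ℂ :=
  lift fun r => LinearMap.flip (lift fun s => LinearMap.mk₂ ℂ (fun g f =>
    if r + s = 0 then ∑ k ∈ Finset.Ico (-r) 0, f.eval (k : ℂ) * g.eval ((k + r : ℤ) : ℂ)
      - ∑ k ∈ Finset.Ico (-s) 0, g.eval (k : ℂ) * f.eval ((k + s : ℤ) : ℂ) else 0)
    (fun g g' f => by
      split_ifs <;> simp [mul_add, add_mul, Finset.sum_add_distrib]; ring)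
    (fun c g f => by
      split_ifs <;> simp [mul_sub, Finset.mul_sum, mul_assoc, mul_left_comm])
    (fun g f f' => by
      split_ifs <;> simp [mul_add, add_mul, Finset.sum_add_distrib]; ring)
    (fun c g f => by
      split_ifs <;> simp [mul_sub, Finset.mul_sum, mul_assoc, mul_left_comm]))

theorem psi_tD (r s : ℤ) (f g : ℂ[X]) : psi (tD r f) (tD s g) =
    if r + s = 0 then ∑ k ∈ Finset.Ico (-r) 0, f.eval (k : ℂ) * g.eval ((k + r : ℤ) : ℂ)
      - ∑ k ∈ Finset.Ico (-s) 0, g.eval (k : ℂ) * f.eval ((k + s : ℤ) : ℂ) else 0 := by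
  rw [psi, lift_tD, LinearMap.flip_apply, lift_tD, LinearMap.mk₂_apply]

end DiffOp

/-! ### The homomorphism to the central extension -/

section Phi

set_option linter.unusedSectionVars false

variable {R : Type*} [CommRing R] [Algebra ℂ R]

/-- The linear map `t ^ k f(D) ↦ ∑_j f(-j + y) τ_{j-k,j} E_{j-k,j}`. -/
def phiAux (y : R) (τ : ℤ → ℤ → Rˣ) : DiffOp →ₗ[ℂ] gl R :=
  DiffOp.lift fun k =>
    { toFun := fun f => gl.diag k fun j => aeval (y - j) f * τ (j - k) j
      map_add' := fun f g => by
        ext i j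
        simp only [gl.entry_diag, gl.entry_add]
        split_ifs <;> simp [add_mul]
      map_smul' := fun c f => by
        ext i j
        simp only [gl.entry_diag, gl.entry_smul]
        split_ifs <;> simp }

theorem phiAux_tD (y : R) (τ : ℤ → ℤ → Rˣ) (k : ℤ) (f : ℂ[X]) :
    phiAux y τ (DiffOp.tD k f) = gl.diag k fun j => aeval (y - j) f * τ (j - k) j := by
  rw [phiAux, DiffOp.lift_tD]; rfl

theorem phiAux_lie (y : R) (τ : ℤ → ℤ → Rˣ) (hτ : ∀ i j k, τ i j * τ j k = τ i k)
    (A B : DiffOp) : phiAux y τ ⁅A, B⁆ = ⁅phiAux y τ A, phiAux y τ B⁆ := by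
  have key : ∀ A B : DiffOp, phiAux y τ (A * B) = phiAux y τ A * phiAux y τ B := by
    intro A B
    induction A using DiffOp.induction with
    | h0 => simp
    | hadd A A' h h' => simp only [add_mul, map_add, h, h']
    | h r f =>
    induction B using DiffOp.induction with
    | h0 => simp
    | hadd A A' h h' => simp only [mul_add, map_add, h, h']
    | h s g =>
    rw [DiffOp.tD_mul_tD, phiAux_tD, phiAux_tD, phiAux_tD, gl.diag_mul_diag]
    congr 1
    funext j
    have h1 : (τ (j - (r + s)) j : R) = τ (j - s - r) (j - s) * τ (j - s) j := by
      rw [← Units.val_mul, hτ, sub_sub, add_comm s r]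
    have h2 : aeval (y - (j : R)) (f.comp (X + C (s : ℂ)))
        = aeval (y - ((j - s : ℤ) : R)) f := by
      rw [aeval_comp]; congr 2; simp; ring
    rw [h1, map_mul, h2]; ring
  rw [DiffOp.lie_def, map_sub, key, key]; rfl

theorem tr_phiAux (y : R) (τ : ℤ → ℤ → Rˣ) (hτ : ∀ i j k, τ i j * τ j k = τ i k)
    (r s : ℤ) (f g : ℂ[X]) :
    (gl.cocycle R).form (phiAux y τ (DiffOp.tD r f)) (phiAux y τ (DiffOp.tD s g)) =
      if r + s = 0 then ∑ k ∈ Finset.Ico (-r) 0, aeval (y + k) f * aeval (y + ((k + r : ℤ) : R)) g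
      - ∑ k ∈ Finset.Ico (-s) 0, aeval (y + k) g * aeval (y + ((k + s : ℤ) : R)) f else 0 := by
  have h1 : ∀ i, τ i i = 1 := fun i => by simpa using hτ i i i
  have hent : ∀ i, (⁅gl.matJ R, phiAux y τ (DiffOp.tD r f)⁆ * phiAux y τ (DiffOp.tD s g)).entry i i
      = if r + s = 0 then ((if i ≤ 0 then 1 else 0) - (if i + r ≤ 0 then 1 else 0)) *
        (aeval (y + ((-(i + r) : ℤ) : R)) f * aeval (y + ((-i : ℤ) : R)) g) else 0 := by
    intro i
    rw [phiAux_tD y τ s, gl.entry_mul_diag, gl.entry_J_lie, phiAux_tD, gl.entry_diag]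
    by_cases h : r + s = 0
    · obtain rfl : s = -r := by omega
      have h2 : (τ i (i + r) : R) * τ (i + r) i = 1 := by
        rw [← Units.val_mul, hτ, h1, Units.val_one]
      rw [if_pos h, sub_neg_eq_add, if_pos (show i + r - i = r by ring), add_sub_cancel_right]
      have e1 : y - ((i + r : ℤ) : R) = y + ((-(i + r) : ℤ) : R) := by push_cast; ring
      have e2 : y - (i : R) = y + ((-i : ℤ) : R) := by push_cast; ring
      rw [e1, e2]
      linear_combination ((if i ≤ 0 then 1 else 0) - (if i + r ≤ 0 then 1 else 0)) *
        (aeval (y + ((-(i + r) : ℤ) : R)) f * aeval (y + ((-i : ℤ) : R)) g) * h2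
    · rw [if_neg h, if_neg (show ¬ (i - s - i = r) by omega)]; ring
  rw [gl.cocycle_apply, gl.tr]
  simp only [hent]
  by_cases h : r + s = 0
  swap
  · simp [h]
  obtain rfl : s = -r := by omega
  simp only [h, if_true, neg_neg]
  rw [finsum_eq_sum_of_support_subset (s := Finset.Ioc (-r) 0 ∪ Finset.Ioc 0 (-r))]
  · rw [Finset.sum_union (by
      rw [Finset.disjoint_left]; intro x hx hx'
      simp only [Finset.mem_Ioc] at hx hx'; omega), sub_eq_add_neg, ← Finset.sum_neg_distrib]
    congr 1
    · refine Finset.sum_bij' (fun i _ => -(i + r)) (fun k _ => -(k + r)) ?_ ?_ ?_ ?_ ?_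
      · intro i hi; simp only [Finset.mem_Ioc, Finset.mem_Ico] at hi ⊢; omega
      · intro i hi; simp only [Finset.mem_Ioc, Finset.mem_Ico] at hi ⊢; omega
      · intro i _; ring
      · intro i _; ring
      · intro i hi
        simp only [Finset.mem_Ioc] at hi
        rw [if_pos hi.2, if_neg (by omega), sub_zero, one_mul,
          show -(i + r) + r = -i by ring]
    · refine Finset.sum_bij' (fun i _ => -i) (fun k _ => -k) ?_ ?_ ?_ ?_ ?_
      · intro i hi; simp only [Finset.mem_Ioc, Finset.mem_Ico] at hi ⊢; omega
      · intro i hi; simp only [Finset.mem_Ioc, Finset.mem_Ico] at hi ⊢; omega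
      · intro i _; ring
      · intro i _; ring
      · intro i hi
        simp only [Finset.mem_Ioc] at hi
        rw [if_neg (by omega), if_pos (by omega), show -i + -r = -(i + r) by ring]
        ring
  · intro i hi
    by_contra h'
    refine hi ?_
    simp only [Finset.coe_union, Finset.coe_Ioc, Set.mem_union, Set.mem_Ioc, not_or] at h'
    by_cases h1 : i ≤ 0 <;> by_cases h2 : i + r ≤ 0 <;> simp [h1, h2] <;> omega

end Phi

namespace DiffOp

/-- The 2-cocycle `Ψ` on the Lie algebra of differential operators. -/
def cocycle : Cocycle DiffOp ℂ where
  form := psi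
  alt := by
    have h : ∀ A B, psi A B = (gl.cocycle ℂ).form (phiAux 0 (fun _ _ => 1) A)
        (phiAux 0 (fun _ _ => 1) B) := by
      intro A B
      induction A using DiffOp.induction with
      | h0 => simp
      | hadd A A' h h' => simp only [map_add, LinearMap.add_apply, h, h']
      | h r f =>
      induction B using DiffOp.induction with
      | h0 => simp
      | hadd A A' h h' => simp only [map_add, h, h']
      | h s g =>
      rw [tr_phiAux _ _ (by simp), psi_tD]
      simp only [zero_add, coe_aeval_eq_eval]
    intro x
    rw [h, (gl.cocycle ℂ).alt]
  jacobi := by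
    have h : ∀ A B, psi A B = (gl.cocycle ℂ).form (phiAux 0 (fun _ _ => 1) A)
        (phiAux 0 (fun _ _ => 1) B) := by
      intro A B
      induction A using DiffOp.induction with
      | h0 => simp
      | hadd A A' h h' => simp only [map_add, LinearMap.add_apply, h, h']
      | h r f =>
      induction B using DiffOp.induction with
      | h0 => simp
      | hadd A A' h h' => simp only [map_add, h, h']
      | h s g =>
      rw [tr_phiAux _ _ (by simp), psi_tD]
      simp only [zero_add, coe_aeval_eq_eval]
    intro x y z
    simp only [h, phiAux_lie _ _ (by simp : ∀ i j k : ℤ, (1 : ℂˣ) * 1 = 1)]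
    exact (gl.cocycle ℂ).jacobi _ _ _

end DiffOp

section CentralTerm

set_option linter.unusedSectionVars false

variable {R : Type*} [CommRing R] [Algebra ℂ R]

/-- The linear map `x ^ n ↦ B_{n+1}(x) / (n + 1)`, with `B_n` the Bernoulli polynomials. -/
def bernoulliSum : ℂ[X] →ₗ[ℂ] ℂ[X] :=
  Polynomial.lsum fun n => LinearMap.toSpanSingleton ℂ ℂ[X]
    ((1 / (n + 1) : ℂ) • (Polynomial.bernoulli (n + 1)).map (algebraMap ℚ ℂ))

theorem bernoulliSum_X_pow (n : ℕ) : bernoulliSum (X ^ n)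
    = (1 / (n + 1) : ℂ) • (Polynomial.bernoulli (n + 1)).map (algebraMap ℚ ℂ) := by
  rw [← monomial_one_right_eq_X_pow, bernoulliSum, Polynomial.lsum_apply,
    Polynomial.sum_monomial_index] <;> simp

theorem bernoulliSum_comp (f : ℂ[X]) : (bernoulliSum f).comp (1 + X) = bernoulliSum f + f := by
  induction f using Polynomial.induction_on' with
  | add p q hp hq => rw [map_add, add_comp, hp, hq]; ring
  | monomial n a =>
    rw [← C_mul_X_pow_eq_monomial, ← smul_eq_C_mul, map_smul, smul_comp, ← smul_add,
      bernoulliSum_X_pow, smul_comp]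
    have := congrArg (Polynomial.map (algebraMap ℚ ℂ)) (bernoulli_comp_one_add_X (n + 1))
    rw [Polynomial.map_comp, Polynomial.map_add, Polynomial.map_add, Polynomial.map_one,
      Polynomial.map_X] at this
    rw [this, smul_add]
    congr 2
    have hn : (n + 1 : ℂ) ≠ 0 := Nat.cast_add_one_ne_zero n
    simp only [nsmul_eq_mul, Polynomial.map_mul, Polynomial.map_natCast, Nat.add_sub_cancel,
      Polynomial.map_pow, Polynomial.map_X]
    rw [smul_eq_C_mul, ← mul_assoc, ← C_eq_natCast, ← C_mul]
    push_cast
    rw [one_div_mul_cancel hn, C_1, one_mul]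

/-- The central correction term `z_y`. On odd polynomials it is given by
`2 sinh(x / 2) z_y(sinh(x D)) = cosh(x / 2) - cosh((y - 1 / 2) x)`,
see `centralTerm_generating`. -/
def centralTerm (y : R) : ℂ[X] →ₗ[ℂ] R :=
  ((aeval (0 : R)).toLinearMap - (aeval y).toLinearMap).comp bernoulliSum

theorem centralTerm_apply (y : R) (f : ℂ[X]) :
    centralTerm y f = aeval 0 (bernoulliSum f) - aeval y (bernoulliSum f) := rfl

theorem centralTerm_generating_aux [Algebra ℚ R] (y : R) :
    (PowerSeries.mk fun n => algebraMap ℚ R (1 / n.factorial) * centralTerm y (X ^ n))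
      * (PowerSeries.exp R - 1) = 1 - PowerSeries.rescale y (PowerSeries.exp R) := by
  have hs : IsScalarTower ℚ ℂ R := IsScalarTower.of_algebraMap_eq' (Subsingleton.elim _ _)
  have key : PowerSeries.X * (PowerSeries.mk fun n =>
      algebraMap ℚ R (1 / n.factorial) * centralTerm y (X ^ n))
      = (PowerSeries.mk fun n => aeval (0 : R) ((1 / n.factorial : ℚ) • Polynomial.bernoulli n))
      - PowerSeries.mk fun n => aeval y ((1 / n.factorial : ℚ) • Polynomial.bernoulli n) := by
    ext n
    rw [map_sub, PowerSeries.coeff_mk, PowerSeries.coeff_mk]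
    cases n with
    | zero => simp
    | succ n =>
      rw [PowerSeries.coeff_succ_X_mul, PowerSeries.coeff_mk, centralTerm_apply,
        bernoulliSum_X_pow, map_smul, map_smul, map_smul, map_smul, ← smul_sub, ← smul_sub]
      have e : ∀ a : R, aeval a ((Polynomial.bernoulli (n + 1)).map (algebraMap ℚ ℂ))
          = aeval a (Polynomial.bernoulli (n + 1)) := fun a => aeval_map_algebraMap ℂ a _
      have e2 : (1 / (n + 1) : ℂ) = algebraMap ℚ ℂ (1 / (n + 1)) := by simp
      rw [e, e, e2, algebraMap_smul, Algebra.smul_def, ← mul_assoc, ← map_mul, Algebra.smul_def]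
      congr 2
      rw [Nat.factorial_succ]
      push_cast
      rw [div_mul_div_comm, one_mul, mul_comm]
  have h0 := bernoulli_generating_function (A := R) 0
  have hy := bernoulli_generating_function (A := R) y
  have hX : PowerSeries.X * ((PowerSeries.mk fun n =>
      algebraMap ℚ R (1 / n.factorial) * centralTerm y (X ^ n)) * (PowerSeries.exp R - 1))
      = PowerSeries.X * (1 - PowerSeries.rescale y (PowerSeries.exp R)) := by
    rw [← mul_assoc, key, sub_mul, h0, hy, PowerSeries.rescale_zero]
    simp [mul_sub]
  ext n
  simpa [PowerSeries.coeff_succ_X_mul] using congrArg (PowerSeries.coeff (n + 1)) hX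

/-- `2 sinh(x / 2) z_y(sinh(x D)) = cosh(x / 2) - cosh((y - 1 / 2) x)`, multiplied by `2`. -/
theorem centralTerm_generating [Algebra ℚ R] (y : R) :
    2 * ((PowerSeries.rescale (algebraMap ℚ R (1 / 2)) (PowerSeries.exp R)
        - PowerSeries.rescale (-algebraMap ℚ R (1 / 2)) (PowerSeries.exp R))
      * PowerSeries.mk fun n => if Odd n then
          algebraMap ℚ R (1 / n.factorial) * centralTerm y (X ^ n) else 0)
    = PowerSeries.rescale (algebraMap ℚ R (1 / 2)) (PowerSeries.exp R)
      + PowerSeries.rescale (-algebraMap ℚ R (1 / 2)) (PowerSeries.exp R)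
      - (PowerSeries.rescale (y - algebraMap ℚ R (1 / 2)) (PowerSeries.exp R)
        + PowerSeries.rescale (-(y - algebraMap ℚ R (1 / 2))) (PowerSeries.exp R)) := by
  have h1 := centralTerm_generating_aux y
  set Z : PowerSeries R :=
    PowerSeries.mk fun n => algebraMap ℚ R (1 / n.factorial) * centralTerm y (X ^ n) with hZ
  set h := algebraMap ℚ R (1 / 2) with hh
  have hhh : h + h = 1 := by rw [hh, ← map_add]; norm_num
  have mulE : ∀ a b : R, PowerSeries.rescale a (PowerSeries.exp R)
      * PowerSeries.rescale b (PowerSeries.exp R)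
      = PowerSeries.rescale (a + b) (PowerSeries.exp R) := PowerSeries.exp_mul_exp_eq_exp_add
  have e1 : PowerSeries.rescale (-h) (PowerSeries.exp R) * PowerSeries.exp R
      = PowerSeries.rescale h (PowerSeries.exp R) := by
    have := mulE (-h) 1
    rwa [PowerSeries.rescale_one, RingHom.id_apply,
      show -h + 1 = h by linear_combination -hhh] at this
  have e2 := mulE (-h) y
  rw [show -h + y = y - h by ring] at e2
  have h2 : Z * (PowerSeries.rescale h (PowerSeries.exp R)
      - PowerSeries.rescale (-h) (PowerSeries.exp R))
      = PowerSeries.rescale (-h) (PowerSeries.exp R)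
      - PowerSeries.rescale (y - h) (PowerSeries.exp R) := by
    rw [← e1, ← e2]
    linear_combination (PowerSeries.rescale (-h) (PowerSeries.exp R)) * h1
  have h3 := congrArg (PowerSeries.rescale (-1)) h2
  simp only [map_mul, map_sub, PowerSeries.rescale_rescale, mul_neg, mul_one, neg_neg] at h3
  have h4 : 2 * (PowerSeries.mk fun n => if Odd n then
      algebraMap ℚ R (1 / n.factorial) * centralTerm y (X ^ n) else 0)
      = Z - PowerSeries.rescale (-1) Z := by
    ext n
    rw [two_mul, map_add, map_sub, PowerSeries.coeff_rescale, PowerSeries.coeff_mk,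
      hZ, PowerSeries.coeff_mk]
    split_ifs with hn
    · rw [hn.neg_one_pow]; ring
    · rw [(Nat.not_odd_iff_even.1 hn).neg_one_pow]; ring
  linear_combination (PowerSeries.rescale h (PowerSeries.exp R)
    - PowerSeries.rescale (-h) (PowerSeries.exp R)) * h4 + h2 + h3

theorem eq_const_of_periodic (G : ℂ[X]) (h : G.comp (1 + X) = G) : ∃ c, G = C c := by
  refine ⟨G.eval 0, ?_⟩
  have h1 : ∀ n : ℕ, G.eval (n : ℂ) = G.eval 0 := by
    intro n
    induction n with
    | zero => simp
    | succ n ih => 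
      rw [← ih]
      conv_rhs => rw [← h]
      simp [add_comm]
  refine Polynomial.eq_of_infinite_eval_eq _ _
    ((Set.infinite_range_of_injective (Nat.cast_injective (R := ℂ))).mono ?_)
  rintro _ ⟨n, rfl⟩
  simp [h1]

theorem centralTerm_diff (y : R) (F : ℂ[X]) :
    centralTerm y (F.comp (X - 1) - F) = aeval (y - 1) F - aeval (-1) F := by
  set e := F.comp (X - 1) - F with he
  obtain ⟨c, hc⟩ := eq_const_of_periodic (bernoulliSum e + F.comp (X - 1)) (by
    rw [add_comp, bernoulliSum_comp, comp_assoc, sub_comp, X_comp, one_comp,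
      add_sub_cancel_left, comp_X, he]; ring)
  have h2 : bernoulliSum e = C c - F.comp (X - 1) := by rw [← hc]; ring
  rw [centralTerm_apply, h2]
  simp [aeval_comp]

theorem centralTerm_shift (y : R) (h : ℂ[X]) (r : ℕ) :
    centralTerm y (h.comp (X - C (r : ℂ)) - h) =
      ∑ j ∈ Finset.Ico (-(r : ℤ)) 0, (aeval (y + (j : R)) h - aeval (j : R) h) := by
  induction r with
  | zero => simp
  | succ r ih =>
    have h1 : h.comp (X - C ((r + 1 : ℕ) : ℂ)) - h = 
        ((h.comp (X - C (r : ℂ))).comp (X - 1) - h.comp (X - C (r : ℂ)))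
          + (h.comp (X - C (r : ℂ)) - h) := by
      rw [comp_assoc, sub_comp, X_comp, C_comp, sub_sub (X : ℂ[X]) 1, ← C_1, ← C_add]
      push_cast
      rw [add_comm (1 : ℂ)]; ring
    rw [h1, map_add, ih, centralTerm_diff]
    have h2 : Finset.Ico (-((r + 1 : ℕ) : ℤ)) 0
        = insert (-((r : ℤ) + 1)) (Finset.Ico (-(r : ℤ)) 0) := by
      ext j; simp only [Finset.mem_Ico, Finset.mem_insert]; push_cast; omega
    rw [h2, Finset.sum_insert (by simp), aeval_comp, aeval_comp]
    congr 3 <;> · congr 1; simp; ring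

end CentralTerm

section Units

variable {R : Type*} [CommRing R]

/-- `∏_{k=i}^{j-1} w_k` if `i ≤ j` and `∏_{k=j}^{i-1} w_k⁻¹` if `j ≤ i`. -/
def prodUnit (w : ℤ → Rˣ) (i j : ℤ) : Rˣ :=
  if i ≤ j then ∏ k ∈ Finset.Ico i j, w k else ∏ k ∈ Finset.Ico j i, (w k)⁻¹

theorem prodUnit_self (w : ℤ → Rˣ) (i : ℤ) : prodUnit w i i = 1 := by simp [prodUnit]

theorem prodUnit_succ (w : ℤ → Rˣ) (i j : ℤ) : prodUnit w i (j + 1) = prodUnit w i j * w j := by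
  unfold prodUnit
  by_cases h : i ≤ j
  · rw [if_pos (by omega), if_pos h, mul_comm]
    have : Finset.Ico i (j + 1) = insert j (Finset.Ico i j) := by
      ext k; simp only [Finset.mem_Ico, Finset.mem_insert]; omega
    rw [this, Finset.prod_insert (by simp)]
  · have : Finset.Ico j i = insert j (Finset.Ico (j + 1) i) := by
      ext k; simp only [Finset.mem_Ico, Finset.mem_insert]; omega
    rw [if_neg h, this, Finset.prod_insert (by simp), mul_comm _ (w j), mul_inv_cancel_left]
    split_ifs with h1
    · obtain rfl : i = j + 1 := by omega
      simp
    · rfl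

theorem prodUnit_unique (w : ℤ → Rˣ) (τ : ℤ → ℤ → Rˣ) (h1 : ∀ i, τ i i = 1)
    (h : ∀ i j, τ i (j + 1) = τ i j * w j) (i j : ℤ) : τ i j = prodUnit w i j := by
  induction j using Int.inductionOn' (b := i) with
  | zero => rw [h1, prodUnit_self]
  | succ k _ ih => rw [h, prodUnit_succ, ih]
  | pred k _ ih =>
    have e1 := h i (k - 1)
    have e2 := prodUnit_succ w i (k - 1)
    rw [sub_add_cancel] at e1 e2
    rw [ih, e2] at e1
    exact (mul_right_cancel e1).symm

theorem prodUnit_mul (w : ℤ → Rˣ) (i j k : ℤ) :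
    prodUnit w i j * prodUnit w j k = prodUnit w i k := by
  have := prodUnit_unique w (fun j' k' => (prodUnit w i j')⁻¹ * prodUnit w i k')
    (fun _ => inv_mul_cancel _) (fun a b => by rw [prodUnit_succ, mul_assoc]) j k
  rw [← this, mul_inv_cancel_left]

end Units

/-! ### The homomorphism of central extensions -/

section PhiHat

set_option linter.unusedSectionVars false

variable {R : Type*} [CommRing R] [Algebra ℂ R]

theorem phiHat_key_nat (y : R) (τ : ℤ → ℤ → Rˣ) (hτ : ∀ i j k, τ i j * τ j k = τ i k)
    (r : ℕ) (f g : ℂ[X]) :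
    algebraMap ℂ R (DiffOp.cocycle.form (DiffOp.tD r f) (DiffOp.tD (-r) g))
      + centralTerm y (DiffOp.coeff 0 ⁅DiffOp.tD r f, DiffOp.tD (-r) g⁆)
      = (gl.cocycle R).form (phiAux y τ (DiffOp.tD r f)) (phiAux y τ (DiffOp.tD (-r) g)) := by
  have h1 : DiffOp.coeff 0 ⁅DiffOp.tD r f, DiffOp.tD (-r) g⁆
      = (f * g.comp (X + C (r : ℂ))).comp (X - C (r : ℂ)) - f * g.comp (X + C (r : ℂ)) := by
    rw [DiffOp.lie_def, DiffOp.tD_mul_tD, DiffOp.tD_mul_tD, map_sub, DiffOp.coeff_tD,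
      DiffOp.coeff_tD, if_pos (by simp), if_pos (by simp), mul_comp, comp_assoc]
    simp only [Int.cast_neg, Int.cast_natCast, C_neg, ← sub_eq_add_neg, add_comp, X_comp, C_comp,
      sub_add_cancel, comp_X, mul_comm f]
  rw [h1, centralTerm_shift, tr_phiAux _ _ hτ]
  change algebraMap ℂ R (DiffOp.psi _ _) + _ = _
  rw [DiffOp.psi_tD, if_pos (by simp), if_pos (by simp), neg_neg]
  rw [show Finset.Ico (r : ℤ) 0 = ∅ by rw [Finset.Ico_eq_empty]; omega, Finset.sum_empty,
    Finset.sum_empty, sub_zero, sub_zero, map_sum, ← Finset.sum_add_distrib]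
  refine Finset.sum_congr rfl fun k _ => ?_
  simp only [map_mul, aeval_comp]
  have e1 : ∀ (p : ℂ[X]) (k : ℤ), aeval (k : R) p = algebraMap ℂ R (p.eval (k : ℂ)) := by
    intro p k
    rw [← aeval_algebraMap_apply_eq_algebraMap_eval, map_intCast]
  have e2 : aeval (k : R) (X + C (r : ℂ)) = ((k + r : ℤ) : R) := by simp
  have e3 : aeval (y + (k : R)) (X + C (r : ℂ)) = y + ((k + r : ℤ) : R) := by simp [add_assoc]
  rw [e2, e3, e1, e1]
  ring

theorem phiHat_key (y : R) (τ : ℤ → ℤ → Rˣ) (hτ : ∀ i j k, τ i j * τ j k = τ i k)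
    (A B : DiffOp) :
    algebraMap ℂ R (DiffOp.cocycle.form A B) + centralTerm y (DiffOp.coeff 0 ⁅A, B⁆)
      = (gl.cocycle R).form (phiAux y τ A) (phiAux y τ B) := by
  induction A using DiffOp.induction with
  | h0 => simp
  | hadd A A' h h' => simp only [add_lie, map_add, LinearMap.add_apply, ← h, ← h']; ring
  | h r f =>
  induction B using DiffOp.induction with
  | h0 => simp
  | hadd A A' h h' => simp only [lie_add, map_add, ← h, ← h']; ring
  | h s g =>
  by_cases hrs : r + s = 0
  · obtain rfl : s = -r := by omega
    obtain ⟨n, rfl | rfl⟩ := r.eq_nat_or_neg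
    · exact phiHat_key_nat y τ hτ n f g
    · have := phiHat_key_nat y τ hτ n g f
      rw [neg_neg, DiffOp.cocycle.skew, (gl.cocycle R).skew, ← lie_skew, map_neg, map_neg, map_neg,
        ← this]
      ring
  · rw [tr_phiAux _ _ hτ, if_neg hrs]
    change algebraMap ℂ R (DiffOp.psi _ _) + _ = _
    rw [DiffOp.psi_tD, if_neg hrs, DiffOp.lie_def, DiffOp.tD_mul_tD, DiffOp.tD_mul_tD, map_sub,
      DiffOp.coeff_tD, DiffOp.coeff_tD, if_neg hrs, if_neg (by omega)]
    simp

/-- The homomorphism of central extensions which is `t ^ k f(D) ↦ ∑_j f(-j + y) τ_{j-k,j} E_{j-k,j}`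
in degrees `k ≠ 0`, has the additional central term `centralTerm y f` in degree `0`, and maps the
central element `C` to the central element `1`. -/
def phiHat (y : R) (τ : ℤ → ℤ → Rˣ) (hτ : ∀ i j k, τ i j * τ j k = τ i k) :
    CentralExt DiffOp.cocycle →ₗ⁅ℂ⁆ CentralExt (gl.cocycle R) where
  toFun x := CentralExt.mk _ (phiAux y τ x.1)
    (algebraMap ℂ R x.2 + centralTerm y (DiffOp.coeff 0 x.1))
  map_add' x x' := by
    refine Prod.ext (map_add (phiAux y τ) x.1 x'.1) ?_
    change algebraMap ℂ R (x.2 + x'.2) + centralTerm y (DiffOp.coeff 0 (x.1 + x'.1))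
      = (algebraMap ℂ R x.2 + centralTerm y (DiffOp.coeff 0 x.1))
      + (algebraMap ℂ R x'.2 + centralTerm y (DiffOp.coeff 0 x'.1))
    simp only [map_add]; ring
  map_smul' c x := by
    refine Prod.ext (map_smul (phiAux y τ) c x.1) ?_
    change algebraMap ℂ R (c * x.2) + centralTerm y (DiffOp.coeff 0 (c • x.1))
      = c • (algebraMap ℂ R x.2 + centralTerm y (DiffOp.coeff 0 x.1))
    rw [map_smul, map_smul, map_mul, smul_add, Algebra.smul_def c (algebraMap ℂ R x.2)]
  map_lie' {x x'} := by
    refine Prod.ext (phiAux_lie y τ hτ x.1 x'.1) ?_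
    exact phiHat_key y τ hτ x.1 x'.1

theorem phiHat_fst (y : R) (τ : ℤ → ℤ → Rˣ) (hτ : ∀ i j k, τ i j * τ j k = τ i k)
    (x : CentralExt DiffOp.cocycle) : (phiHat y τ hτ x).1 = phiAux y τ x.1 := rfl

end PhiHat

/-! ### The Lie algebras fixed by minus an anti-involution -/

namespace DiffOp

/-- The linear map `σ` with `σ(t ^ k f(D) D) = -(ε t) ^ k f(-D - k) D` on the operators that are
multiples of `D` (for `ε = ±1`). -/
def sigma (ε : ℤˣ) : DiffOp →ₗ[ℂ] DiffOp :=
  lift fun k => (tD k).comp (show ℂ[X] →ₗ[ℂ] ℂ[X] from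
    { toFun := fun e => -((((ε ^ k : ℤˣ) : ℤ) : ℂ[X]) * (divX e).comp (-X - C (k : ℂ)) * X)
      map_add' := fun e e' => by rw [divX_add, add_comp]; ring
      map_smul' := fun c e => by
        have : divX (c • e) = c • divX e := by
          ext n; simp [coeff_divX]
        rw [this, smul_comp]; simp })

/-- Right multiplication by `D`. -/
def mulD : DiffOp →ₗ[ℂ] DiffOp :=
  lift fun k => (tD k).comp (LinearMap.mulRight ℂ X)

theorem mulD_tD (k : ℤ) (f : ℂ[X]) : mulD (tD k f) = tD k (f * X) := by simp [mulD]

theorem divX_mul_X' (f : ℂ[X]) : divX (f * X) = f := by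
  ext n; simp [coeff_divX]

theorem sigma_tD (ε : ℤˣ) (k : ℤ) (f : ℂ[X]) : sigma ε (tD k (f * X))
    = tD k (-((((ε ^ k : ℤˣ) : ℤ) : ℂ[X]) * f.comp (-X - C (k : ℂ)) * X)) := by
  simp [sigma, divX_mul_X']

theorem coeff_sigma (ε : ℤˣ) (A : DiffOp) (k : ℤ) : coeff k (sigma ε A) =
    -((((ε ^ k : ℤˣ) : ℤ) : ℂ[X]) * (divX (coeff k A)).comp (-X - C (k : ℂ)) * X) := by
  induction A using DiffOp.induction with
  | h0 => simp
  | hadd A A' h h' => rw [map_add, map_add, h, h', map_add, divX_add, add_comp]; ring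
  | h l f =>
    simp only [sigma, lift_tD, LinearMap.comp_apply, coeff_tD]
    split_ifs with h
    · subst h; rfl
    · simp

theorem eq_mulD {A : DiffOp} (h : ∀ k, X ∣ coeff k A) : ∃ B, A = mulD B := by
  have hsurj : ∀ A : DiffOp, ∃ B, ∀ k, coeff k B = divX (coeff k A) := by
    intro A
    refine ⟨(Finsupp.mapRange divX (by simp) (A : ℤ →₀ ℂ[X]) : ℤ →₀ ℂ[X]), fun k => rfl⟩
  obtain ⟨B, hB⟩ := hsurj A
  have hc : ∀ (B : DiffOp) k, coeff k (mulD B) = coeff k B * X := by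
    intro B k
    induction B using DiffOp.induction with
    | h0 => simp
    | hadd A A' h h' => simp only [map_add, h, h', add_mul]
    | h l f => rw [mulD_tD, coeff_tD, coeff_tD]; split_ifs <;> simp
  refine ⟨B, ext fun k => ?_⟩
  obtain ⟨q, hq⟩ := h k
  rw [hc, hB, hq, mul_comm X q, divX_mul_X']

theorem dvd_coeff_mulD_mul (A B : DiffOp) (k : ℤ) : X ∣ coeff k (A * mulD B) := by
  induction A using DiffOp.induction with
  | h0 => simp
  | hadd A A' h h' => rw [add_mul, map_add]; exact dvd_add h h'
  | h r f =>
  induction B using DiffOp.induction with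
  | h0 => simp
  | hadd A A' h h' => rw [map_add, mul_add, map_add]; exact dvd_add h h'
  | h s g =>
    rw [mulD_tD, tD_mul_tD, coeff_tD]
    split_ifs
    · exact ⟨f.comp (X + C (s : ℂ)) * g, by ring⟩
    · exact dvd_zero _

/-- `σ` is an anti-homomorphism on multiples of `D`. -/
theorem sigma_mul (ε : ℤˣ) (A B : DiffOp) :
    sigma ε (mulD A * mulD B) = sigma ε (mulD B) * sigma ε (mulD A) := by
  induction A using DiffOp.induction with
  | h0 => simp
  | hadd A A' h h' => simp only [map_add, add_mul, mul_add, h, h']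
  | h r f =>
  induction B using DiffOp.induction with
  | h0 => simp
  | hadd A A' h h' => simp only [map_add, add_mul, mul_add, h, h']
  | h s g =>
    rw [mulD_tD, mulD_tD, tD_mul_tD, ← mul_assoc, sigma_tD, sigma_tD, sigma_tD, tD_mul_tD,
      add_comm s r]
    congr 1
    have e1 : (((ε ^ (r + s) : ℤˣ) : ℤ) : ℂ[X])
        = (((ε ^ r : ℤˣ) : ℤ) : ℂ[X]) * (((ε ^ s : ℤˣ) : ℤ) : ℂ[X]) := by
      rw [zpow_add]; push_cast; rfl
    simp only [neg_comp, mul_comp, comp_assoc, add_comp, sub_comp, X_comp, C_comp, intCast_comp, e1]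
    have e2 : (-X - C ((r + s : ℤ) : ℂ) + C (s : ℂ) : ℂ[X]) = -X - C (r : ℂ) := by
      rw [Int.cast_add, C_add]; ring
    have e3 : (-(X + C (r : ℂ)) - C (s : ℂ) : ℂ[X]) = -X - C ((r + s : ℤ) : ℂ) := by
      rw [Int.cast_add, C_add]; ring
    rw [e2, e3]
    ring

end DiffOp

/-- The Lie algebra `𝒟_x^±` (with `± = ε`): the multiples `E` of `D` with `σ(E) = -E`. -/
def Dx (ε : ℤˣ) : LieSubalgebra ℂ DiffOp where
  carrier := {E | (∀ k, X ∣ DiffOp.coeff k E) ∧ DiffOp.sigma ε E = -E}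
  zero_mem' := by simp
  add_mem' {A B} hA hB := by
    refine ⟨fun k => ?_, ?_⟩
    · rw [map_add]; exact dvd_add (hA.1 k) (hB.1 k)
    · rw [map_add, hA.2, hB.2, neg_add]
  smul_mem' c A hA := by
    refine ⟨fun k => ?_, ?_⟩
    · rw [map_smul]; rw [smul_eq_C_mul]; exact (hA.1 k).mul_left _
    · rw [map_smul, hA.2, smul_neg]
  lie_mem' {A B} hA hB := by
    obtain ⟨A', rfl⟩ := DiffOp.eq_mulD hA.1
    obtain ⟨B', rfl⟩ := DiffOp.eq_mulD hB.1
    refine ⟨fun k => ?_, ?_⟩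
    · rw [DiffOp.lie_def, map_sub]
      exact dvd_sub (DiffOp.dvd_coeff_mulD_mul _ _ k) (DiffOp.dvd_coeff_mulD_mul _ _ k)
    · rw [DiffOp.lie_def, map_sub, DiffOp.sigma_mul, DiffOp.sigma_mul, hA.2, hB.2]
      simp only [neg_mul_neg, neg_sub]

/-- The central extension `𝒟̂_x^±` of `𝒟_x^±` by `ℂ C`, given by the restriction of `Ψ`. -/
abbrev DxHat (ε : ℤˣ) : LieSubalgebra ℂ (CentralExt DiffOp.cocycle) :=
  (Dx ε).comap (CentralExt.proj DiffOp.cocycle)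

theorem Dx_coeff {ε : ℤˣ} {E : DiffOp} (h : E ∈ Dx ε) (k : ℤ) : ∃ f : ℂ[X],
    DiffOp.coeff k E = f * X ∧ (((ε ^ k : ℤˣ) : ℤ) : ℂ[X]) * f.comp (-X - C (k : ℂ)) = f := by
  obtain ⟨f, hf⟩ := h.1 k
  rw [mul_comm] at hf
  refine ⟨f, hf, ?_⟩
  have h1 := congrArg (DiffOp.coeff k) h.2
  rw [DiffOp.coeff_sigma, map_neg, hf, DiffOp.divX_mul_X', neg_inj] at h1
  exact mul_right_cancel₀ X_ne_zero h1

/-! ### The algebra `ℂ[u]/(u^{m+1})` and the Lie algebras of infinite matrices over it -/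

/-- The algebra `R_m = ℂ[u]/(u^{m+1})`. -/
abbrev Rm (m : ℕ) : Type := AdjoinRoot (X ^ (m + 1) : ℂ[X])

/-- The class of `u` in `R_m`. -/
def uu (m : ℕ) : Rm m := AdjoinRoot.root _

theorem uu_pow (m : ℕ) : uu m ^ (m + 1) = 0 := by
  have := AdjoinRoot.eval₂_root (X ^ (m + 1) : ℂ[X])
  rwa [eval₂_X_pow] at this

/-- The involution `f(u) ↦ f(-u)` of `R_m`. -/
def conj (m : ℕ) : Rm m →ₐ[ℂ] Rm m :=
  AdjoinRoot.liftAlgHom _ (Algebra.ofId ℂ _) (-uu m) (by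
    rw [eval₂_X_pow, neg_pow, uu_pow, mul_zero])

@[simp] theorem conj_uu (m : ℕ) : conj m (uu m) = -uu m :=
  AdjoinRoot.liftAlgHom_root _ _ _ _

theorem conj_conj (m : ℕ) (a : Rm m) : conj m (conj m a) = a := by
  have : (conj m).comp (conj m) = AlgHom.id ℂ _ := AdjoinRoot.algHom_ext (by
    change conj m (conj m (uu m)) = uu m
    simp)
  exact DFunLike.congr_fun this a

/-- The Lie algebra `𝔤𝔩_∞^{[m]}` of matrices over `R_m` with finitely many nonzero diagonals. -/
abbrev Glm (m : ℕ) : Type := gl (Rm m)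

/-- The central extension of `𝔤𝔩_∞^{[m]}` by `R_m`. -/
abbrev GlmHat (m : ℕ) : Type := CentralExt (gl.cocycle (Rm m))

/-- The sign `(∓ 1) ^ n`, where `± 1 = ε`. -/
def sgn (m : ℕ) (ε : ℤˣ) (n : ℤ) : Rm m := ((((-ε) ^ n : ℤˣ) : ℤ) : Rm m)

theorem sgn_add (m : ℕ) (ε : ℤˣ) (a b : ℤ) : sgn m ε (a + b) = sgn m ε a * sgn m ε b := by
  simp only [sgn, zpow_add]; push_cast; rfl

theorem sgn_neg (m : ℕ) (ε : ℤˣ) (a : ℤ) : sgn m ε (-a) = sgn m ε a := by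
  rw [sgn, sgn, zpow_neg, Int.units_inv_eq_self]

theorem sgn_sq (m : ℕ) (ε : ℤˣ) (a : ℤ) : sgn m ε a * sgn m ε a = 1 := by
  rw [← sgn_add, sgn, ← two_mul, zpow_mul, zpow_ofNat, Int.units_sq, one_zpow]; simp

@[simp] theorem conj_sgn (m : ℕ) (ε : ℤˣ) (a : ℤ) : conj m (sgn m ε a) = sgn m ε a := by
  simp [sgn]

theorem lie_entry_of {m : ℕ} (A B : Glm m) (c : Rm m) (p : ℤ → ℤ) (hp : ∀ i, p (p i) = i)
    (i j : ℤ)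
    (h1 : ∀ k, A.entry i k * B.entry k j = c * conj m (B.entry (p j) (p k) * A.entry (p k) (p i)))
    (h2 : ∀ k, B.entry i k * A.entry k j = c * conj m (A.entry (p j) (p k) * B.entry (p k) (p i))) :
    (⁅A, B⁆).entry i j = -(c * conj m ((⁅A, B⁆).entry (p j) (p i))) := by
  have key : ∀ A B : Glm m, (∀ k, A.entry i k * B.entry k j
      = c * conj m (B.entry (p j) (p k) * A.entry (p k) (p i))) →
      (A * B).entry i j = c * conj m ((B * A).entry (p j) (p i)) := by
    intro A B h
    rw [gl.entry_mul, gl.entry_mul]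
    simp only [h]
    have e := finsum_comp_equiv (Function.Involutive.toPerm p (show Function.Involutive p from hp))
      (f := fun k => B.entry (p j) k * A.entry k (p i))
    have e' : ∑ᶠ k, B.entry (p j) (p k) * A.entry (p k) (p i)
        = ∑ᶠ k, B.entry (p j) k * A.entry k (p i) := e
    have hf : (Function.support fun k => B.entry (p j) (p k) * A.entry (p k) (p i)).Finite :=
      (gl.mul_support B A (p j) (p i)).preimage
        (Function.Involutive.injective (show Function.Involutive p from hp)).injOn
    have hm := (conj m).toAddMonoidHom.map_finsum hf
    rw [← e']
    refine Eq.trans ?_ (congrArg (c * ·) hm).symm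
    exact (mul_finsum' _ c (hf.subset fun k hk h0 =>
      hk ((congrArg (conj m) h0).trans (map_zero _)))).symm
  rw [gl.lie_def, gl.entry_sub, gl.entry_sub, key A B h1, key B A h2, map_sub]
  ring

/-- The Lie algebras `c̄_∞^{[m]}` (for `ε = 1`) and `d̄_∞^{[m]}` (for `ε = -1`) of all matrices `A`
over `R_m` with `A_{i,j}(u) = -(-1)^{i+j} A_{1-j,1-i}(-u)`, respectively
`A_{i,j}(u) = -A_{1-j,1-i}(-u)`. -/
def glHalf (ε : ℤˣ) (m : ℕ) : LieSubalgebra ℂ (Glm m) where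
  carrier := {A | ∀ i j, A.entry i j = -(sgn m ε (i + j) * conj m (A.entry (1 - j) (1 - i)))}
  zero_mem' := by simp
  add_mem' {A B} hA hB i j := by
    rw [gl.entry_add, gl.entry_add, hA, hB, map_add]; ring
  smul_mem' c A hA i j := by
    rw [gl.entry_smul, gl.entry_smul, hA, map_smul, mul_smul_comm, smul_neg]
  lie_mem' {A B} hA hB i j := by
    refine lie_entry_of A B _ (fun k => 1 - k) (fun k => by ring) i j ?_ ?_ <;>
    · intro k
      rw [hA, hB, map_mul]
      simp only [sgn_add]
      rw [neg_mul_neg]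
      generalize conj m _ = a, conj m _ = b
      linear_combination (sgn m ε i * sgn m ε j * a * b) * sgn_sq m ε k

/-- `(∓1)^i` times the sign of `i ≠ 0`. -/
def sg (m : ℕ) (ε : ℤˣ) (i : ℤ) : Rm m := (if 0 < i then 1 else -1) * sgn m ε i

@[simp] theorem conj_sg (m : ℕ) (ε : ℤˣ) (i : ℤ) : conj m (sg m ε i) = sg m ε i := by
  unfold sg; split_ifs <;> simp

theorem sg_sq (m : ℕ) (ε : ℤˣ) (i : ℤ) : sg m ε i * sg m ε i = 1 := by
  unfold sg; have := sgn_sq m ε i; split_ifs <;> linear_combination this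

theorem sg_neg (m : ℕ) (ε : ℤˣ) {i : ℤ} (hi : i ≠ 0) : sg m ε (-i) = -sg m ε i := by
  unfold sg; rw [sgn_neg]
  by_cases h : 0 < i
  · rw [if_pos h, if_neg (by omega)]; ring
  · rw [if_neg h, if_pos (by omega)]; ring

/-- The conditions defining `ℒ̄_±^{[m]}`. -/
def ZeroCond (ε : ℤˣ) (m : ℕ) (A : Glm m) : Prop :=
  (∀ i j, 0 < i * j ∨ (i = 0 ∧ j = 0) →
    A.entry i j = -(sgn m ε (i + j) * conj m (A.entry (-j) (-i)))) ∧
  (∀ i j, i * j < 0 → A.entry i j = sgn m ε (i + j) * conj m (A.entry (-j) (-i))) ∧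
  (∀ i, 0 < i → A.entry (-i) 0 = sgn m ε i * uu m * conj m (A.entry 0 i)) ∧
  (∀ i, 0 < i → A.entry i 0 = -(sgn m ε i * uu m * conj m (A.entry 0 (-i))))

theorem zeroCond_iff (ε : ℤˣ) (m : ℕ) (A : Glm m) : ZeroCond ε m A ↔
    (∀ i j, i ≠ 0 → j ≠ 0 →
      A.entry i j = -(sg m ε i * sg m ε j * conj m (A.entry (-j) (-i)))) ∧
    (∀ i, i ≠ 0 → A.entry i 0 = -(sg m ε i * uu m * conj m (A.entry 0 (-i)))) ∧
    A.entry 0 0 = -conj m (A.entry 0 0) := by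
  have hs : sgn m ε 0 = 1 := by simp [sgn]
  constructor
  · rintro ⟨h1, h2, h3, h4⟩
    refine ⟨fun i j hi hj => ?_, fun i hi => ?_, ?_⟩
    · rcases lt_or_gt_of_ne (mul_ne_zero hi hj) with h | h
      · rw [h2 i j h, sgn_add]
        rcases mul_neg_iff.1 h with ⟨a, b⟩ | ⟨a, b⟩
        · rw [sg, sg, if_pos a, if_neg (by omega)]; ring
        · rw [sg, sg, if_neg (by omega), if_pos b]; ring
      · rw [h1 i j (Or.inl h), sgn_add]
        rcases mul_pos_iff.1 h with ⟨a, b⟩ | ⟨a, b⟩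
        · rw [sg, sg, if_pos a, if_pos b]; ring
        · rw [sg, sg, if_neg (by omega), if_neg (by omega)]; ring
    · rcases lt_or_gt_of_ne hi with h | h
      · have := h3 (-i) (by omega)
        rw [neg_neg, sgn_neg] at this
        rw [this, sg, if_neg (by omega)]; ring
      · rw [h4 i h, sg, if_pos h]; ring
    · have := h1 0 0 (Or.inr ⟨rfl, rfl⟩)
      rwa [add_zero, neg_zero, hs, one_mul] at this
  · rintro ⟨h1, h2, h3⟩
    refine ⟨fun i j h => ?_, fun i j h => ?_, fun i h => ?_, fun i h => ?_⟩
    · rcases h with h | ⟨rfl, rfl⟩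
      · rw [h1 i j (by rintro rfl; simp at h) (by rintro rfl; simp at h), sgn_add]
        rcases mul_pos_iff.1 h with ⟨a, b⟩ | ⟨a, b⟩
        · rw [sg, sg, if_pos a, if_pos b]; ring
        · rw [sg, sg, if_neg (by omega), if_neg (by omega)]; ring
      · rw [add_zero, neg_zero, hs, one_mul]; exact h3
    · rw [h1 i j (by rintro rfl; simp at h) (by rintro rfl; simp at h), sgn_add]
      rcases mul_neg_iff.1 h with ⟨a, b⟩ | ⟨a, b⟩
      · rw [sg, sg, if_pos a, if_neg (by omega)]; ring
      · rw [sg, sg, if_neg (by omega), if_pos b]; ring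
    · rw [h2 (-i) (by omega), neg_neg, sg, sgn_neg, if_neg (by omega)]; ring
    · rw [h2 i (by omega), sg, if_pos h]; ring

theorem zeroCond_lie (ε : ℤˣ) (m : ℕ) {A B : Glm m} (hA : ZeroCond ε m A) (hB : ZeroCond ε m B) :
    ZeroCond ε m ⁅A, B⁆ := by
  rw [zeroCond_iff] at hA hB ⊢
  have hcz : ∀ {A : Glm m}, (∀ i, i ≠ 0 → A.entry i 0 =
      -(sg m ε i * uu m * conj m (A.entry 0 (-i)))) → ∀ i, i ≠ 0 →
      conj m (A.entry (-i) 0) = -(sg m ε i * uu m * A.entry 0 i) := by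
    intro A h i hi
    rw [h (-i) (by omega), neg_neg, sg_neg m ε hi]
    simp only [map_neg, map_mul, conj_sg, conj_uu, conj_conj]; ring
  have e1 : ∀ {A B : Glm m}, (∀ i j, i ≠ 0 → j ≠ 0 →
      A.entry i j = -(sg m ε i * sg m ε j * conj m (A.entry (-j) (-i)))) →
      (∀ i, i ≠ 0 → A.entry i 0 = -(sg m ε i * uu m * conj m (A.entry 0 (-i)))) →
      A.entry 0 0 = -conj m (A.entry 0 0) →
      (∀ i j, i ≠ 0 → j ≠ 0 →
      B.entry i j = -(sg m ε i * sg m ε j * conj m (B.entry (-j) (-i)))) →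
      (∀ i, i ≠ 0 → B.entry i 0 = -(sg m ε i * uu m * conj m (B.entry 0 (-i)))) →
      B.entry 0 0 = -conj m (B.entry 0 0) →
      (∀ i j, i ≠ 0 → j ≠ 0 → ∀ k, A.entry i k * B.entry k j =
        (sg m ε i * sg m ε j) * conj m (B.entry (-j) (-k) * A.entry (-k) (-i))) ∧
      (∀ i, i ≠ 0 → ∀ k, A.entry i k * B.entry k 0 =
        (sg m ε i * uu m) * conj m (B.entry (-0) (-k) * A.entry (-k) (-i))) ∧
      (∀ k, A.entry 0 k * B.entry k 0 =
        1 * conj m (B.entry (-0) (-k) * A.entry (-k) (-0))) := by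
    intro A B a1 a2 a3 b1 b2 b3
    refine ⟨fun i j hi hj k => ?_, fun i hi k => ?_, fun k => ?_⟩
    · by_cases hk : k = 0
      · subst hk
        rw [a2 i hi, neg_zero, map_mul, hcz b2 j hj]
        linear_combination (sg m ε i * uu m * conj m (A.entry 0 (-i)) * B.entry 0 j) * sg_sq m ε j
      · rw [a1 i k hi hk, b1 k j hk hj, map_mul]
        generalize conj m _ = a, conj m _ = b
        linear_combination (sg m ε i * sg m ε j * a * b) * sg_sq m ε k
    · by_cases hk : k = 0
      · subst hk
        rw [a2 i hi, b3, neg_zero, map_mul]; ring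
      · rw [a1 i k hi hk, b2 k hk, map_mul, neg_zero]
        generalize conj m _ = a, conj m _ = b
        linear_combination (sg m ε i * uu m * a * b) * sg_sq m ε k
    · by_cases hk : k = 0
      · subst hk
        rw [neg_zero, map_mul]
        nth_rw 1 [a3, b3]; ring
      · rw [b2 k hk, map_mul, neg_zero, hcz a2 k hk]; ring
  obtain ⟨a1, a2, a3⟩ := hA
  obtain ⟨b1, b2, b3⟩ := hB
  obtain ⟨p1, p2, p3⟩ := e1 a1 a2 a3 b1 b2 b3
  obtain ⟨q1, q2, q3⟩ := e1 b1 b2 b3 a1 a2 a3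
  refine ⟨fun i j hi hj => ?_, fun i hi => ?_, ?_⟩
  · exact lie_entry_of A B _ (fun k => -k) (fun k => neg_neg k) i j (p1 i j hi hj) (q1 i j hi hj)
  · have := lie_entry_of A B _ (fun k => -k) (fun k => neg_neg k) i 0 (p2 i hi) (q2 i hi)
    rwa [neg_zero] at this
  · have := lie_entry_of A B _ (fun k => -k) (fun k => neg_neg k) 0 0 p3 q3
    rwa [neg_zero, one_mul] at this

/-- The Lie algebra `ℒ̄_±^{[m]}` (with `± = ε`). -/
def glZero (ε : ℤˣ) (m : ℕ) : LieSubalgebra ℂ (Glm m) where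
  carrier := {A | ZeroCond ε m A}
  zero_mem' := by simp [ZeroCond]
  add_mem' {A B} hA hB := by
    refine ⟨fun i j h => ?_, fun i j h => ?_, fun i h => ?_, fun i h => ?_⟩
    · rw [gl.entry_add, gl.entry_add, hA.1 i j h, hB.1 i j h, map_add]; ring
    · rw [gl.entry_add, gl.entry_add, hA.2.1 i j h, hB.2.1 i j h, map_add]; ring
    · rw [gl.entry_add, gl.entry_add, hA.2.2.1 i h, hB.2.2.1 i h, map_add]; ring
    · rw [gl.entry_add, gl.entry_add, hA.2.2.2 i h, hB.2.2.2 i h, map_add]; ring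
  smul_mem' c A hA := by
    refine ⟨fun i j h => ?_, fun i j h => ?_, fun i h => ?_, fun i h => ?_⟩
    · rw [gl.entry_smul, gl.entry_smul, hA.1 i j h, map_smul, mul_smul_comm, smul_neg]
    · rw [gl.entry_smul, gl.entry_smul, hA.2.1 i j h, map_smul, mul_smul_comm]
    · rw [gl.entry_smul, gl.entry_smul, hA.2.2.1 i h, map_smul, mul_smul_comm]
    · rw [gl.entry_smul, gl.entry_smul, hA.2.2.2 i h, map_smul, mul_smul_comm, smul_neg]
  lie_mem' hA hB := zeroCond_lie ε m hA hB

/-! ### The target Lie algebras and the homomorphisms onto them -/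

open Classical in
/-- The unit `u - c` of `R_m`, for `c ≠ 0` (and `1` for `c = 0`). -/
def uSub (m : ℕ) (c : ℂ) : (Rm m)ˣ :=
  if h : IsUnit (uu m - algebraMap ℂ (Rm m) c) then h.unit else 1

theorem isUnit_uSub (m : ℕ) {c : ℂ} (hc : c ≠ 0) : IsUnit (uu m - algebraMap ℂ (Rm m) c) := by
  have h1 : IsNilpotent (uu m) := ⟨m + 1, uu_pow m⟩
  have h2 : IsUnit (-algebraMap ℂ (Rm m) c) :=
    ((isUnit_iff_ne_zero.2 hc).map (algebraMap ℂ (Rm m))).neg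
  rw [sub_eq_add_neg, add_comm (uu m)]
  exact h1.isUnit_add_left_of_commute h2 (Commute.all _ _)

theorem coe_uSub (m : ℕ) {c : ℂ} (hc : c ≠ 0) :
    (uSub m c : Rm m) = uu m - algebraMap ℂ (Rm m) c := by
  rw [uSub, dif_pos (isUnit_uSub m hc)]; rfl

theorem uSub_zero (m : ℕ) : uSub m 0 = 1 := by
  rw [uSub, dif_neg]
  rw [map_zero, sub_zero]
  intro h
  have h2 : IsUnit (uu m ^ (m + 1)) := h.pow _
  rw [uu_pow] at h2
  have : Nontrivial (Rm m) := by
    refine AdjoinRoot.nontrivial _ ?_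
    rw [degree_X_pow]
    exact_mod_cast Nat.succ_ne_zero m
  exact not_isUnit_zero h2

open Classical in
/-- The units `τ_{ij}` such that `E_{ij} ↦ τ_{ij} E_{ij}` is the automorphism `T` if `s = 0`, the
automorphism `T⁻¹` if `s = 1/2`, and the identity otherwise. Here, for `i < j`,
`T(E_{ij}) = ∏_{i ≤ k < j, k ≠ 0} (u - k) E_{ij}` if `s = 0` and
`T(E_{ij}) = ∏_{i ≤ k < j} (u - (k + 1/2)) E_{ij}` if `s = 1/2`. -/
def twist (m : ℕ) (s : ℂ) : ℤ → ℤ → (Rm m)ˣ :=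
  if s = 0 then prodUnit fun k => uSub m k
  else if s = 1 / 2 then prodUnit fun k => (uSub m (k + 1 / 2))⁻¹
  else fun _ _ => 1

theorem twist_mul (m : ℕ) (s : ℂ) (i j k : ℤ) : twist m s i j * twist m s j k = twist m s i k := by
  unfold twist
  split_ifs
  · exact prodUnit_mul _ i j k
  · exact prodUnit_mul _ i j k
  · exact mul_one 1

/-- The lift `φ̂_s^{[m]}`, composed with `T` (`s = 0`) or `T⁻¹` (`s = 1/2`). -/
def phiFull (m : ℕ) (s : ℂ) : CentralExt DiffOp.cocycle →ₗ⁅ℂ⁆ GlmHat m :=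
  phiHat (algebraMap ℂ (Rm m) s + uu m) (twist m s) (twist_mul m s)

open Classical in
/-- The Lie algebra `𝔤_±^{[m]}` attached to `s` (with `± = ε`), as a subalgebra of the central
extension of `𝔤𝔩_∞^{[m]}` by `R_m`. It is the central extension by `R_m` of `ℒ̄_±^{[m]}` if `s = 0`, of
`c̄_∞^{[m]}` or `d̄_∞^{[m]}` if `s = 1/2`, and of `𝔤𝔩_∞^{[m]}` itself otherwise. -/
def gPM (ε : ℤˣ) (m : ℕ) (s : ℂ) : LieSubalgebra ℂ (GlmHat m) :=
  if s = 0 then (glZero ε m).comap (CentralExt.proj _)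
  else if s = 1 / 2 then (glHalf ε m).comap (CentralExt.proj _)
  else ⊤

theorem entry_phiAux {R : Type*} [CommRing R] [Algebra ℂ R] (y : R) (τ : ℤ → ℤ → Rˣ) (E : DiffOp)
    (i j : ℤ) :
    (phiAux y τ E).entry i j = aeval (y - j) (DiffOp.coeff (j - i) E) * τ i j := by
  induction E using DiffOp.induction with
  | h0 => simp
  | hadd A A' h h' => simp only [map_add, gl.entry_add, h, h', add_mul]
  | h k f =>
    rw [phiAux_tD, gl.entry_diag, DiffOp.coeff_tD]
    by_cases h : j - i = k
    · rw [if_pos h, if_pos h.symm, show j - k = i by omega]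
    · rw [if_neg h, if_neg (Ne.symm h)]; simp

theorem sgn_eq (m : ℕ) (ε : ℤˣ) (i j : ℤ) :
    sgn m ε (i + j) = ((((-1) ^ (j - i) : ℤˣ) : ℤ) : Rm m) * (((ε ^ (j - i) : ℤˣ) : ℤ) : Rm m) := by
  have h : (-ε) ^ (i + j) = (-1) ^ (j - i) * ε ^ (j - i) := by
    rw [← mul_zpow, neg_one_mul, show i + j = (j - i) + 2 * i by ring, zpow_add, zpow_mul (-ε) 2,
      zpow_ofNat, Int.units_sq, one_zpow, mul_one]
  rw [sgn, h]; push_cast; rfl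

/-- The symmetry of the polynomial factor. -/
theorem conj_aeval (m : ℕ) (ε : ℤˣ) (f : ℂ[X]) (k : ℤ) (a b : Rm m) (hab : conj m b = -a - k)
    (hf : (((ε ^ k : ℤˣ) : ℤ) : ℂ[X]) * f.comp (-X - C (k : ℂ)) = f) :
    aeval a f = (((ε ^ k : ℤˣ) : ℤ) : Rm m) * conj m (aeval b f) := by
  conv_lhs => rw [← hf]
  rw [map_mul, aeval_comp, ← aeval_algHom_apply, hab]
  simp

theorem map_prodUnit {R : Type*} [CommRing R] (g : Rˣ →* Rˣ) (w : ℤ → Rˣ) (i j : ℤ) :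
    g (prodUnit w i j) = prodUnit (fun k => g (w k)) i j := by
  refine prodUnit_unique _ (fun i j => g (prodUnit w i j)) (fun i => ?_) (fun i j => ?_) i j
  · rw [prodUnit_self, map_one]
  · rw [prodUnit_succ, map_mul]

theorem prodUnit_step {R : Type*} [CommRing R] (w : ℤ → Rˣ) (i : ℤ) :
    prodUnit w i (i + 1) = w i := by rw [prodUnit_succ, prodUnit_self, one_mul]

theorem zpow_sub_succ {R : Type*} [CommRing R] (i j : ℤ) :
    ((-1 : Rˣ)) ^ (j + 1 - i) = (-1) ^ (j - i) * (-1) := by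
  rw [show j + 1 - i = (j - i) + 1 by ring, zpow_add, zpow_one]

theorem twist_half (m : ℕ) : twist m (1 / 2) = prodUnit fun k => (uSub m (k + 1 / 2))⁻¹ := by
  rw [twist, if_neg (by norm_num), if_pos rfl]

theorem half_ne (k : ℤ) : (k + 1 / 2 : ℂ) ≠ 0 := by
  intro h
  have h2 : ((2 * k + 1 : ℤ) : ℂ) = 0 := by push_cast; linear_combination 2 * h
  have := Int.cast_eq_zero.1 h2
  omega

theorem conj_uSub (m : ℕ) {c : ℂ} (hc : c ≠ 0) :
    Units.map (conj m : Rm m →* Rm m) (uSub m c) = -uSub m (-c) := by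
  ext
  rw [Units.coe_map, Units.val_neg, coe_uSub m hc, coe_uSub m (neg_ne_zero.2 hc)]
  change conj m _ = _
  rw [map_sub, conj_uu, AlgHom.commutes, map_neg]; ring

/-- The reflection of the twisting factors for `s = 1/2`. -/
theorem twist_half_refl (m : ℕ) (i j : ℤ) :
    Units.map (conj m : Rm m →* Rm m) (twist m (1 / 2) (1 - j) (1 - i))
      = (-1) ^ (j - i) * twist m (1 / 2) (i - 1) (j - 1) := by
  rw [twist_half]
  set w : ℤ → (Rm m)ˣ := fun k => (uSub m (k + 1 / 2))⁻¹ with hw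
  have h1 := prodUnit_unique (fun j => -w (j - 1))
    (fun i j => Units.map (conj m : Rm m →* Rm m) (prodUnit w (1 - j) (1 - i)))
    (fun i => by rw [prodUnit_self, map_one]) (fun i j => by
      have e : prodUnit w (1 - (j + 1)) (1 - i) = w (-j) * prodUnit w (1 - j) (1 - i) := by
        rw [← prodUnit_mul w _ (1 - j) _, show 1 - (j + 1) = -j by ring,
          show (1 : ℤ) - j = -j + 1 by ring, prodUnit_step]
      rw [e, map_mul, mul_comm]
      congr 1
      rw [hw]
      simp only
      rw [map_inv, conj_uSub m (half_ne _), inv_neg]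
      congr 3; push_cast; ring) i j
  have h2 := prodUnit_unique (fun j => -w (j - 1))
    (fun i j => (-1) ^ (j - i) * prodUnit w (i - 1) (j - 1))
    (fun i => by rw [prodUnit_self, sub_self, zpow_zero, one_mul]) (fun i j => by
      have e : prodUnit w (i - 1) (j + 1 - 1) = prodUnit w (i - 1) (j - 1) * w (j - 1) := by
        rw [← prodUnit_succ]; congr 1; ring
      rw [e, zpow_sub_succ, mul_assoc, mul_assoc, neg_one_mul, mul_neg, mul_neg, mul_neg]) i j
  exact h1.trans h2.symm

theorem twist_zero (m : ℕ) : twist m 0 = prodUnit fun k => uSub m k := by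
  rw [twist, if_pos rfl]

/-- The reflection of the twisting factors for `s = 0`. -/
theorem twist_zero_refl (m : ℕ) (i j : ℤ) :
    Units.map (conj m : Rm m →* Rm m) (twist m 0 (-j) (-i))
      = (-1) ^ (j - i) * (if 0 ≤ i then -1 else 1) * (if 0 ≤ j then -1 else 1)
        * twist m 0 (i + 1) (j + 1) := by
  rw [twist_zero]
  set w : ℤ → (Rm m)ˣ := fun k => uSub m k with hw
  have h1 := prodUnit_unique (fun j => if j + 1 = 0 then w (j + 1) else -w (j + 1))
    (fun i j => Units.map (conj m : Rm m →* Rm m) (prodUnit w (-j) (-i)))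
    (fun i => by rw [prodUnit_self, map_one]) (fun i j => by
      have e : prodUnit w (-(j + 1)) (-i) = w (-(j + 1)) * prodUnit w (-j) (-i) := by
        rw [← prodUnit_mul w _ (-j) _]
        congr 1
        conv_lhs => rw [show -j = -(j + 1) + 1 by ring]
        rw [prodUnit_step]
      rw [e, map_mul, mul_comm]
      congr 1
      rw [hw]
      by_cases hj : j + 1 = 0
      · rw [if_pos hj, hj]; simp [uSub_zero]
      · rw [if_neg hj]
        simp only
        rw [conj_uSub m (by exact_mod_cast neg_ne_zero.2 hj)]
        congr 2; push_cast; ring) i j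
  have h2 := prodUnit_unique (fun j => if j + 1 = 0 then w (j + 1) else -w (j + 1))
    (fun i j => (-1) ^ (j - i) * (if 0 ≤ i then -1 else 1) * (if 0 ≤ j then -1 else 1)
        * prodUnit w (i + 1) (j + 1))
    (fun i => by rw [prodUnit_self, sub_self, zpow_zero]; split_ifs <;> simp) (fun i j => by
      rw [prodUnit_succ, zpow_sub_succ]
      by_cases hj : j + 1 = 0
      · rw [if_pos hj, if_pos (show 0 ≤ j + 1 by omega), if_neg (show ¬ 0 ≤ j by omega)]
        simp only [mul_neg, neg_mul, mul_one, neg_neg, mul_assoc]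
      · have : (0 ≤ j + 1) ↔ 0 ≤ j := by omega
        simp only [this, if_neg hj]
        simp only [mul_neg, neg_mul, mul_one, mul_assoc, mul_left_comm]) i j
  exact h1.trans h2.symm

theorem sign_mul_self (m : ℕ) (k : ℤ) :
    ((((-1) ^ k : ℤˣ) : ℤ) : Rm m) * ((((-1) ^ k : ℤˣ) : ℤ) : Rm m) = 1 := by
  rw [← Int.cast_mul, ← Units.val_mul, ← sq, Int.units_sq]; simp

theorem coe_neg_one_zpow (m : ℕ) (k : ℤ) :
    (((-1) ^ k : (Rm m)ˣ) : Rm m) = ((((-1) ^ k : ℤˣ) : ℤ) : Rm m) := by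
  rcases Int.even_or_odd k with h | h
  · rw [h.neg_one_zpow, h.neg_one_zpow]; simp
  · rw [h.neg_one_zpow, h.neg_one_zpow]; simp

theorem phiAux_mem_glHalf (ε : ℤˣ) (m : ℕ) {E : DiffOp} (hE : E ∈ Dx ε) :
    phiAux (algebraMap ℂ (Rm m) (1 / 2) + uu m) (twist m (1 / 2)) E ∈ glHalf ε m := by
  intro i j
  obtain ⟨f, hf, hs⟩ := Dx_coeff hE (j - i)
  rw [entry_phiAux, entry_phiAux, show 1 - i - (1 - j) = j - i by ring, hf, map_mul, aeval_X,
    map_mul, map_mul, aeval_X, map_mul, sgn_eq]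
  have hone : algebraMap ℂ (Rm m) (1 / 2) + algebraMap ℂ (Rm m) (1 / 2) = 1 := by
    rw [← map_add]; norm_num
  have h1 : conj m (algebraMap ℂ (Rm m) (1 / 2) + uu m - ((1 - i : ℤ) : Rm m))
      = -(algebraMap ℂ (Rm m) (1 / 2) + uu m - (i : Rm m)) := by
    rw [map_sub, map_add, AlgHom.commutes, conj_uu, map_intCast]
    push_cast
    linear_combination hone
  have h2 := conj_aeval m ε f (j - i) (algebraMap ℂ (Rm m) (1 / 2) + uu m - (j : Rm m))
    (algebraMap ℂ (Rm m) (1 / 2) + uu m - ((1 - i : ℤ) : Rm m)) (by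
      rw [h1]; push_cast; ring) hs
  have h3 := congrArg Units.val (twist_half_refl m i j)
  rw [Units.coe_map, Units.val_mul, coe_neg_one_zpow] at h3
  change conj m _ = _ at h3
  have h4 : twist m (1 / 2) (i - 1) (j - 1) * (uSub m ((j - 1 : ℤ) + 1 / 2))⁻¹
      = (uSub m ((i - 1 : ℤ) + 1 / 2))⁻¹ * twist m (1 / 2) i j := by
    have e1 := prodUnit_succ (fun k : ℤ => (uSub m (k + 1 / 2))⁻¹) (i - 1) (j - 1)
    have e2 := prodUnit_mul (fun k : ℤ => (uSub m (k + 1 / 2))⁻¹) (i - 1) (i - 1 + 1) j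
    rw [prodUnit_step, sub_add_cancel] at e2
    rw [sub_add_cancel] at e1
    rw [twist_half, ← e1, ← e2]
  have h5 : (uSub m ((i - 1 : ℤ) + 1 / 2)) * twist m (1 / 2) (i - 1) (j - 1)
      = uSub m ((j - 1 : ℤ) + 1 / 2) * twist m (1 / 2) i j := by
    rw [eq_comm, ← inv_mul_eq_iff_eq_mul, ← mul_assoc, mul_comm (_)⁻¹ (uSub m _), mul_assoc, ← h4,
      mul_comm (twist m (1 / 2) (i - 1) (j - 1)), mul_inv_cancel_left]
  have h6 := congrArg Units.val h5
  rw [Units.val_mul, Units.val_mul, coe_uSub m (half_ne _), coe_uSub m (half_ne _)] at h6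
  have h7 : ∀ i : ℤ, uu m - algebraMap ℂ (Rm m) ((i - 1 : ℤ) + 1 / 2)
      = algebraMap ℂ (Rm m) (1 / 2) + uu m - (i : Rm m) := by
    intro i
    rw [map_add, map_intCast]; push_cast
    linear_combination -hone
  rw [h7, h7] at h6
  rw [h1, h2, h3]
  linear_combination (-((((ε ^ (j - i) : ℤˣ) : ℤ) : Rm m) * conj m (aeval
    (algebraMap ℂ (Rm m) (1 / 2) + uu m - ((1 - i : ℤ) : Rm m)) f))) * h6
    - ((((ε ^ (j - i) : ℤˣ) : ℤ) : Rm m) * conj m (aeval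
    (algebraMap ℂ (Rm m) (1 / 2) + uu m - ((1 - i : ℤ) : Rm m)) f)
    * (algebraMap ℂ (Rm m) (1 / 2) + uu m - (i : Rm m))
    * (twist m (1 / 2) (i - 1) (j - 1) : Rm m)) * sign_mul_self m (j - i)

theorem phiAux_mem_glZero (ε : ℤˣ) (m : ℕ) {E : DiffOp} (hE : E ∈ Dx ε) :
    phiAux (algebraMap ℂ (Rm m) 0 + uu m) (twist m 0) E ∈ glZero ε m := by
  rw [map_zero, zero_add]
  refine (zeroCond_iff ε m _).2 ?_
  have h1 : ∀ i : ℤ, conj m (uu m - ((-i : ℤ) : Rm m)) = -(uu m - (i : Rm m)) := by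
    intro i
    rw [map_sub, conj_uu, map_intCast]; push_cast; ring
  have h3 : ∀ i j, conj m (twist m 0 (-j) (-i)) = ((((-1) ^ (j - i) : ℤˣ) : ℤ) : Rm m)
      * (if 0 ≤ i then -1 else 1) * (if 0 ≤ j then -1 else 1) * twist m 0 (i + 1) (j + 1) := by
    intro i j
    have h3 := congrArg Units.val (twist_zero_refl m i j)
    rw [Units.coe_map, Units.val_mul, Units.val_mul, Units.val_mul, coe_neg_one_zpow] at h3
    refine Eq.trans h3 ?_
    split_ifs <;> simp
  have h4 : ∀ i j : ℤ, (uSub m i : Rm m) * twist m 0 (i + 1) (j + 1)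
      = twist m 0 i j * uSub m j := by
    intro i j
    have e1 := prodUnit_succ (fun k : ℤ => uSub m k) i j
    have e2 := prodUnit_mul (fun k : ℤ => uSub m k) i (i + 1) (j + 1)
    rw [prodUnit_step] at e2
    rw [twist_zero, ← Units.val_mul, ← Units.val_mul, e2, e1]
  have h5 : ∀ i : ℤ, i ≠ 0 → (uSub m i : Rm m) = uu m - (i : Rm m) := by
    intro i hi
    rw [coe_uSub m (by exact_mod_cast hi), map_intCast]
  have hE' : ∀ i j : ℤ, ∃ F : Rm m,
      (phiAux (uu m) (twist m 0) E).entry i j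
        = (((ε ^ (j - i) : ℤˣ) : ℤ) : Rm m) * F * (uu m - (j : Rm m)) * twist m 0 i j ∧
      conj m ((phiAux (uu m) (twist m 0) E).entry (-j) (-i))
        = -(F * (uu m - (i : Rm m)) * (((((-1) ^ (j - i) : ℤˣ) : ℤ) : Rm m)
      * (if 0 ≤ i then -1 else 1) * (if 0 ≤ j then -1 else 1) * twist m 0 (i + 1) (j + 1))) := by
    intro i j
    obtain ⟨f, hf, hs⟩ := Dx_coeff hE (j - i)
    refine ⟨conj m (aeval (uu m - ((-i : ℤ) : Rm m)) f), ?_, ?_⟩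
    · rw [entry_phiAux, hf, map_mul, aeval_X, conj_aeval m ε f (j - i) (uu m - (j : Rm m))
        (uu m - ((-i : ℤ) : Rm m)) (by rw [h1]; push_cast; ring) hs]
    · rw [entry_phiAux, show -i - -j = j - i by ring, hf, map_mul, map_mul, aeval_X, map_mul, h1,
        h3]
      ring
  refine ⟨fun i j hi hj => ?_, fun i hi => ?_, ?_⟩
  · obtain ⟨F, e1, e2⟩ := hE' i j
    have h6 := h4 i j
    rw [h5 i hi, h5 j hj] at h6
    have h7 : sg m ε i * sg m ε j * (if 0 ≤ i then -1 else 1) * (if 0 ≤ j then -1 else 1)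
        = ((((-1) ^ (j - i) : ℤˣ) : ℤ) : Rm m) * (((ε ^ (j - i) : ℤˣ) : ℤ) : Rm m) := by
      rw [← sgn_eq, sgn_add, sg, sg]
      split_ifs <;> first | omega | ring
    rw [e1, e2]
    linear_combination (-((((ε ^ (j - i) : ℤˣ) : ℤ) : Rm m) * F)) * h6
      - (F * (uu m - (i : Rm m)) * (twist m 0 (i + 1) (j + 1) : Rm m)
        * ((((-1) ^ (j - i) : ℤˣ) : ℤ) : Rm m)) * h7
      - ((((ε ^ (j - i) : ℤˣ) : ℤ) : Rm m) * F * (uu m - (i : Rm m))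
        * (twist m 0 (i + 1) (j + 1) : Rm m)) * sign_mul_self m (j - i)
  · obtain ⟨F, e1, e2⟩ := hE' i 0
    have h6 := h4 i 0
    rw [h5 i hi, Int.cast_zero, uSub_zero, Units.val_one, mul_one] at h6
    have h7 : -(sg m ε i * (if 0 ≤ i then -1 else 1))
        = ((((-1) ^ (0 - i) : ℤˣ) : ℤ) : Rm m) * (((ε ^ (0 - i) : ℤˣ) : ℤ) : Rm m) := by
      rw [← sgn_eq, add_zero, sg]
      split_ifs <;> first | omega | ring
    rw [neg_zero] at e2
    rw [e1, e2, if_pos le_rfl, Int.cast_zero, sub_zero]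
    linear_combination (-((((ε ^ (0 - i) : ℤˣ) : ℤ) : Rm m) * F * uu m)) * h6
      - (F * uu m * (uu m - (i : Rm m)) * (twist m 0 (i + 1) (0 + 1) : Rm m)
        * ((((-1) ^ (0 - i) : ℤˣ) : ℤ) : Rm m)) * h7
      - ((((ε ^ (0 - i) : ℤˣ) : ℤ) : Rm m) * F * uu m * (uu m - (i : Rm m))
        * (twist m 0 (i + 1) (0 + 1) : Rm m)) * sign_mul_self m (0 - i)
  · obtain ⟨f, hf, hs⟩ := Dx_coeff hE 0
    have h8 := conj_aeval m ε f 0 (uu m) (uu m) (by simp) hs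
    have h9 : twist m 0 0 0 = 1 := by rw [twist_zero, prodUnit_self]
    rw [entry_phiAux, sub_zero, hf, h9, map_mul, aeval_X, Int.cast_zero, sub_zero, Units.val_one,
      mul_one, map_mul, conj_uu, mul_neg, neg_neg]
    rw [zpow_zero] at h8
    simp only [Units.val_one, Int.cast_one, one_mul] at h8
    rw [← h8]

/-- The homomorphism `φ̂_s^{[m],±}` (with `± = ε`). -/
def phi (ε : ℤˣ) (m : ℕ) (s : ℂ) : DxHat ε →ₗ⁅ℂ⁆ gPM ε m s where
  toFun x := ⟨phiFull m s x.1, by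
    have hx : x.1.1 ∈ Dx ε := x.2
    unfold gPM
    split_ifs with h1 h2
    · subst h1; exact phiAux_mem_glZero ε m hx
    · subst h2; exact phiAux_mem_glHalf ε m hx
    · trivial⟩
  map_add' x y := Subtype.ext (map_add (phiFull m s) x.1 y.1)
  map_smul' c x := Subtype.ext (map_smul (phiFull m s) c x.1)
  map_lie' {x y} := Subtype.ext ((phiFull m s).map_lie x.1 y.1)

/-! ### Direct sums, gradings and modules -/

section Sum

variable {N : ℕ} (ε : ℤˣ) (m : Fin N → ℕ) (s : Fin N → ℂ)

/-- The Lie algebra `𝔤_±^{[m̄]} = ⨁_i 𝔤_±^{[m_i]}` attached to `s̄`. -/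
abbrev gSum : Type := ⨁ i, gPM ε (m i) (s i)

/-- The homomorphism `φ̂_s̄^{[m̄],±} = ⨁_i φ̂_{s_i}^{[m_i],±}`. -/
def phiSum : DxHat ε →ₗ⁅ℂ⁆ gSum ε m s where
  toFun x := DFinsupp.equivFunOnFintype.symm fun i => phi ε (m i) (s i) x
  map_add' x y := DFinsupp.ext fun i => map_add (phi ε (m i) (s i)) x y
  map_smul' c x := DFinsupp.ext fun i => map_smul (phi ε (m i) (s i)) c x
  map_lie' {x y} := DFinsupp.ext fun i => by
    refine ((phi ε (m i) (s i)).map_lie x y).trans ?_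
    rw [DirectSum.bracket_apply]
    rfl

theorem phiSum_apply (x : DxHat ε) (i : Fin N) : phiSum ε m s x i = phi ε (m i) (s i) x := rfl

/-- The principal gradation of `𝔤_±^{[m]}`, in which `E_{ij}` has degree `j - i` and the elements of
the centre `R_m` have degree `0`. -/
def grading (ε : ℤˣ) (m : ℕ) (s : ℂ) (k : ℤ) : Submodule ℂ (gPM ε m s) where
  carrier := {x | (∀ i j, j - i ≠ k → gl.entry x.1.1 i j = 0) ∧ (k ≠ 0 → x.1.2 = 0)}
  zero_mem' := ⟨fun _ _ _ => rfl, fun _ => rfl⟩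
  add_mem' {x y} hx hy := ⟨fun i j h => by
      change gl.entry (x.1.1 + y.1.1) i j = 0
      rw [gl.entry_add, hx.1 i j h, hy.1 i j h, add_zero], fun h => by
      change x.1.2 + y.1.2 = 0
      rw [hx.2 h, hy.2 h, add_zero]⟩
  smul_mem' c x hx := ⟨fun i j h => by
      change gl.entry (c • x.1.1) i j = 0
      rw [gl.entry_smul, hx.1 i j h, smul_zero], fun h => by
      change c • x.1.2 = 0
      rw [hx.2 h, smul_zero]⟩

/-- The principal gradation of `𝔤_±^{[m̄]}`. -/
def gradingSum (k : ℤ) : Submodule ℂ (gSum ε m s) :=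
  ⨅ i, (grading ε (m i) (s i) k).comap (DirectSum.component ℂ (Fin N) _ i)

theorem mem_gradingSum (k : ℤ) (x : gSum ε m s) :
    x ∈ gradingSum ε m s k ↔ ∀ i, x i ∈ grading ε (m i) (s i) k := by
  simp only [gradingSum, Submodule.mem_iInf, Submodule.mem_comap]; rfl

/-- The element `a` of the centre `R_m` of `𝔤_±^{[m]}`. -/
def central (ε : ℤˣ) (m : ℕ) (s : ℂ) (a : Rm m) : gPM ε m s :=
  ⟨CentralExt.mk _ 0 a, by
    unfold gPM
    split_ifs
    · exact (glZero ε m).zero_mem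
    · exact (glHalf ε m).zero_mem
    · trivial⟩

/-- The central elements `u ^ j`, `j` odd, of those summands `𝔤_±^{[m_i]}` for which `s_i = 0` or
`s_i = 1/2`. -/
def oddCentral : Set (gSum ε m s) :=
  {z | ∃ (i : Fin N) (j : ℕ), (s i = 0 ∨ s i = 1 / 2) ∧ Odd j ∧ j ≤ m i ∧
    z = DirectSum.lof ℂ (Fin N) (fun i => gPM ε (m i) (s i)) i
      (central ε (m i) (s i) (uu (m i) ^ j))}

/-- `s_i ∈ ℤ` implies `s_i = 0`, `s_i ∈ ℤ + 1/2` implies `s_i = 1/2`, and `s_i ≠ ± s_j` modulo `ℤ` for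
`i ≠ j`. -/
structure Admissible (s : Fin N → ℂ) : Prop where
  int : ∀ i, (∃ n : ℤ, s i = n) → s i = 0
  half : ∀ i, (∃ n : ℤ, s i = n + 1 / 2) → s i = 1 / 2
  ne : ∀ i j, i ≠ j → ∀ n : ℤ, s i ≠ s j + n ∧ s i ≠ -s j + n

end Sum

section Modules

set_option linter.unusedSectionVars false

variable {L L' : Type*} [LieRing L] [LieAlgebra ℂ L] [LieRing L'] [LieAlgebra ℂ L']

/-- `V = ⨁_j V_j` is a `ℤ`-graded module over `L` with the gradation `𝔤`. -/
structure IsGradedModule (𝔤 : ℤ → Submodule ℂ L) {V : Type*} [AddCommGroup V] [Module ℂ V]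
    [LieRingModule L V] [LieModule ℂ L V] (𝒱 : ℤ → Submodule ℂ V) : Prop where
  isInternal : DirectSum.IsInternal 𝒱
  lie_mem : ∀ i j x v, x ∈ 𝔤 i → v ∈ 𝒱 j → ⁅x, v⁆ ∈ 𝒱 (i + j)

/-- A `ℤ`-graded module is quasifinite if its graded pieces are finite-dimensional. -/
structure IsQuasifinite (𝔤 : ℤ → Submodule ℂ L) {V : Type*} [AddCommGroup V] [Module ℂ V]
    [LieRingModule L V] [LieModule ℂ L V] (𝒱 : ℤ → Submodule ℂ V) : Prop
    extends IsGradedModule 𝔤 𝒱 where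
  finite : ∀ j, Module.Finite ℂ (𝒱 j)

/-- `V` is the irreducible highest weight module `L(𝔤, lam)`: a graded module generated by a nonzero
`v ∈ V_0` with `h v = lam(h) v` for `h ∈ 𝔤_0` and `𝔤_k v = 0` for `k > 0`, whose only graded
submodules are `0` and `V`. -/
structure IsIrreducibleHighestWeight (𝔤 : ℤ → Submodule ℂ L) (lam : Module.Dual ℂ (𝔤 0))
    {V : Type*} [AddCommGroup V] [Module ℂ V] [LieRingModule L V] [LieModule ℂ L V]
    (𝒱 : ℤ → Submodule ℂ V) : Prop extends IsGradedModule 𝔤 𝒱 where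
  exists_vector : ∃ v ∈ 𝒱 0, v ≠ 0 ∧ (∀ h : 𝔤 0, ⁅(h : L), v⁆ = lam h • v) ∧
    (∀ k > 0, ∀ x ∈ 𝔤 k, ⁅x, v⁆ = 0) ∧ LieSubmodule.lieSpan ℂ L {v} = ⊤
  irreducible : ∀ W : LieSubmodule ℂ L V,
    (W : Submodule ℂ V) = ⨆ j, (W : Submodule ℂ V) ⊓ 𝒱 j → W = ⊥ ∨ W = ⊤

/-- The `L`-module `V`, regarded as an `L'`-module via the homomorphism `φ : L' → L`. -/
def Restrict (_φ : L' →ₗ⁅ℂ⁆ L) (V : Type*) : Type _ := V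

variable (φ : L' →ₗ⁅ℂ⁆ L) (V : Type*) [AddCommGroup V] [Module ℂ V] [LieRingModule L V]
  [LieModule ℂ L V]

instance : AddCommGroup (Restrict φ V) := inferInstanceAs (AddCommGroup V)
instance : Module ℂ (Restrict φ V) := inferInstanceAs (Module ℂ V)
instance : LieRingModule L' (Restrict φ V) := LieRingModule.compLieHom V φ
instance : LieModule ℂ L' (Restrict φ V) := LieModule.compLieHom V φ

/-- The identity map from `V` to `V`, regarded as an `L'`-module via `φ`. -/
def Restrict.of : V ≃ₗ[ℂ] Restrict φ V := LinearEquiv.refl ℂ V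

theorem Restrict.lie_of (x : L') (v : V) :
    ⁅x, Restrict.of φ V v⁆ = Restrict.of φ V ⁅φ x, v⁆ := rfl

end Modules

section Tensor

variable {N : ℕ} {A : Fin N → Type*} [∀ i, LieRing (A i)] [∀ i, LieAlgebra ℂ (A i)]
  (V : Fin N → Type*) [∀ i, AddCommGroup (V i)] [∀ i, Module ℂ (V i)]
  [∀ i, LieRingModule (A i) (V i)] [∀ i, LieModule ℂ (A i) (V i)]

/-- The tensor product `⨂_i V_i` over `ℂ`. -/
def TensorModule : Type _ := ⨂[ℂ] i, V i

instance : AddCommGroup (TensorModule V) := inferInstanceAs (AddCommGroup (⨂[ℂ] i, V i))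
instance : Module ℂ (TensorModule V) := inferInstanceAs (Module ℂ (⨂[ℂ] i, V i))

/-- The pure tensor `⨂_i v_i`. -/
def TensorModule.tprod (v : ∀ i, V i) : TensorModule V := PiTensorProduct.tprod ℂ v

theorem TensorModule.hom_ext {f g : Module.End ℂ (TensorModule V)}
    (h : ∀ v, f (tprod V v) = g (tprod V v)) : f = g :=
  PiTensorProduct.ext (MultilinearMap.ext h)

/-- The operator `1 ⊗ ⋯ ⊗ f ⊗ ⋯ ⊗ 1`, with `f` in the `i`-th position. -/
def tensorOp (i : Fin N) : Module.End ℂ (V i) →ₗ[ℂ] Module.End ℂ (TensorModule V) :=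
  (PiTensorProduct.mapMultilinear ℂ V V).toLinearMap (fun _ => LinearMap.id) i

theorem tensorOp_tprod (i : Fin N) (f : Module.End ℂ (V i)) (v : ∀ i, V i) :
    tensorOp V i f (TensorModule.tprod V v)
      = TensorModule.tprod V (Function.update v i (f (v i))) := by
  change PiTensorProduct.map (Function.update (fun _ => LinearMap.id) i f)
    (PiTensorProduct.tprod ℂ v) = PiTensorProduct.tprod ℂ _
  rw [PiTensorProduct.map_tprod]
  congr 1
  ext j
  by_cases h : j = i
  · subst h; simp
  · simp [Function.update_of_ne h]

theorem tensorOp_mul (i : Fin N) (f g : Module.End ℂ (V i)) :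
    tensorOp V i (f * g) = tensorOp V i f * tensorOp V i g :=
  TensorModule.hom_ext V fun v => by simp [tensorOp_tprod]

theorem tensorOp_commute {i j : Fin N} (hij : i ≠ j) (f : Module.End ℂ (V i))
    (g : Module.End ℂ (V j)) : tensorOp V i f * tensorOp V j g = tensorOp V j g * tensorOp V i f := by
  refine TensorModule.hom_ext V fun v => ?_
  simp [tensorOp_tprod, Function.update_of_ne hij, Function.update_of_ne hij.symm,
    Function.update_comm hij]

/-- The operator by which an element `x` of `⨁_i A_i` acts on the tensor product of `A_i`-modules
`V_i`, namely `∑_i 1 ⊗ ⋯ ⊗ x_i ⊗ ⋯ ⊗ 1`. -/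
def tensorAct : (⨁ i, A i) →ₗ[ℂ] Module.End ℂ (TensorModule V) where
  toFun x := ∑ i, tensorOp V i (LieModule.toEnd ℂ (A i) (V i) (x i))
  map_add' x y := by
    rw [← Finset.sum_add_distrib]
    refine Finset.sum_congr rfl fun i _ => ?_
    rw [DirectSum.add_apply, map_add, map_add]
  map_smul' c x := by
    rw [RingHom.id_apply, Finset.smul_sum]
    refine Finset.sum_congr rfl fun i _ => ?_
    rw [DirectSum.smul_apply, map_smul, map_smul]

theorem tensorAct_lie (x y : ⨁ i, A i) :
    tensorAct V ⁅x, y⁆ = tensorAct V x * tensorAct V y - tensorAct V y * tensorAct V x := by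
  have h : ∀ i, LieModule.toEnd ℂ (A i) (V i) ⁅x i, y i⁆
      = LieModule.toEnd ℂ (A i) (V i) (x i) * LieModule.toEnd ℂ (A i) (V i) (y i)
      - LieModule.toEnd ℂ (A i) (V i) (y i) * LieModule.toEnd ℂ (A i) (V i) (x i) :=
    fun i => LinearMap.ext fun v => lie_lie (x i) (y i) v
  change (∑ i, tensorOp V i (LieModule.toEnd ℂ (A i) (V i) (⁅x, y⁆ i)))
    = (∑ i, tensorOp V i (LieModule.toEnd ℂ (A i) (V i) (x i)))
      * (∑ i, tensorOp V i (LieModule.toEnd ℂ (A i) (V i) (y i)))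
      - (∑ i, tensorOp V i (LieModule.toEnd ℂ (A i) (V i) (y i)))
      * (∑ i, tensorOp V i (LieModule.toEnd ℂ (A i) (V i) (x i)))
  rw [Finset.sum_mul_sum, Finset.sum_mul_sum, Finset.sum_comm (s := Finset.univ) (t := Finset.univ)
    (f := fun i j => tensorOp V i (LieModule.toEnd ℂ (A i) (V i) (y i))
      * tensorOp V j (LieModule.toEnd ℂ (A j) (V j) (x j))), ← Finset.sum_sub_distrib]
  refine Finset.sum_congr rfl fun i _ => ?_
  rw [← Finset.sum_sub_distrib, Finset.sum_eq_single i]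
  · rw [DirectSum.bracket_apply, h, map_sub, tensorOp_mul, tensorOp_mul]
  · exact fun j _ hj => by rw [tensorOp_commute V hj.symm, sub_self]
  · simp

instance : LieRingModule (⨁ i, A i) (TensorModule V) where
  bracket x t := tensorAct V x t
  add_lie x y t := by
    change tensorAct V (x + y) t = tensorAct V x t + tensorAct V y t
    rw [map_add]; rfl
  lie_add x t t' := map_add (tensorAct V x) t t'
  leibniz_lie x y t := by
    change tensorAct V x (tensorAct V y t)
      = tensorAct V ⁅x, y⁆ t + tensorAct V y (tensorAct V x t)
    rw [tensorAct_lie]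
    exact (sub_add_cancel _ _).symm

theorem TensorModule.lie_def (x : ⨁ i, A i) (t : TensorModule V) : ⁅x, t⁆ = tensorAct V x t := rfl

instance : LieModule ℂ (⨁ i, A i) (TensorModule V) where
  smul_lie c x t := by
    rw [TensorModule.lie_def, TensorModule.lie_def, map_smul]; rfl
  lie_smul c x t := map_smul (tensorAct V x) c t

end Tensor

end WInf

end

/-!
The proof is elementary and avoids completions of `𝒟_x^±`. Three facts carry it.

*Finitely many entries matter.* A quasifinite module is filtered by the finite-dimensional sums `F n` of
its graded pieces of degrees `-n, …, n`. Elements of degree `k` of `𝔤 = 𝔤_±^{[m̄]}` map `F n` to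
`F (n + |k|)`, so they induce a linear map from `𝔤_k` to a finite-dimensional space of operators, which
intertwines `ad h` with an endomorphism, for every diagonal element `h`. For the `h` with entries
`(s_i - j) ^ 3` some nonzero polynomial in `ad h` therefore maps `𝔤_k` to elements acting as zero on
`F n`; but `ad h` multiplies the entry in position `(j - k, j)` by `(s_i - j + k) ^ 3 - (s_i - j) ^ 3`,
which takes each value finitely often if `k ≠ 0`. Hence an element of `𝔤_k`, `k ≠ 0`, whose entries in
finitely many positions vanish acts as zero on `F n` (`IsFiltered.exists_finset`). The exponent `3` is
chosen because it is odd, as the symmetry defining `𝔤` requires, and greater than `1`, since the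
exponent `1` gives the degree operator.

*Interpolation.* Finitely many entries of an element of `𝔤_k` can be prescribed by an operator
`t ^ k g(D) D` (`exists_opEl`): by the Chinese remainder theorem the jets of `g` at the points
`s_i - j` and at their mirror images `-(s_i - j) - k` can be chosen at will, admissibility says that
jets belonging to different `i` do not interfere, and symmetrizing `g` is compatible with the symmetry
of `𝔤`. Together with the first fact, a `𝒟̂_x^±`-submodule of a filtered module is invariant under
`𝔤_k` for all `k ≠ 0`.

*Degree zero.* `𝔤_0` is abelian, so the derived algebra lies in the Lie subalgebra generated by the
`𝔤_k`, `k ≠ 0`. Brackets of elements of degrees `1` and `-1` produce all diagonal matrices, with a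
central component which can be taken odd under `u ↦ -u` in the symmetric cases; brackets of degrees
`2` and `-2` then produce the even central elements, so that only the odd ones are missing
(`mem_of_grading_le`).

For the tensor product, the products of the `F n` form a filtration, and the odd central elements act
by scalars. So a nonzero `𝒟̂_x^±`-submodule `U` is invariant under every factor of `𝔤`. The diagonal
matrix with entries `s_i - j` makes the degree operator of the `i`-th factor inner; therefore
submodules of that factor are automatically graded, and the projection to the highest weight vector
agrees on each step of the filtration with a polynomial in an element of `𝔤`
(`IsIrreducibleHighestWeight.exists_projection`). Moving a nonzero vector of `U` to a vector with
nonzero projection, one factor at a time, shows that `U` contains the tensor product of the highest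
weight vectors, which generates everything.
-/

noncomputable section

namespace WInf

/-! ### Entrywise scaling and brackets of diagonals -/

section Matrices

variable {R : Type*} [CommRing R] [Algebra ℂ R]

namespace gl

/-- The matrix `(Q_{ij} A_{ij})`, for complex numbers `Q_{ij}`. -/
def scale (Q : ℤ → ℤ → ℂ) (A : gl R) : gl R := ⟨fun i j => Q i j • A.entry i j, by
  refine A.2.subset ?_
  rintro k ⟨i, hi⟩
  refine ⟨i, fun h => hi ?_⟩
  change Q i (i + k) • A.entry i (i + k) = 0
  rw [show A.entry i (i + k) = 0 from h, smul_zero]⟩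

@[simp] theorem entry_scale (Q : ℤ → ℤ → ℂ) (A : gl R) (i j : ℤ) :
    (scale Q A).entry i j = Q i j • A.entry i j := rfl

theorem diag_lie_diag (k l : ℤ) (a b : ℤ → R) :
    ⁅diag k a, diag l b⁆ = diag (k + l) fun j => a (j - l) * b j - b (j - k) * a j := by
  ext i j
  rw [lie_def, diag_mul_diag, diag_mul_diag, entry_sub]
  simp only [entry_diag, add_comm l k]
  split_ifs <;> simp

theorem cocycle_diag_of_ne {k l : ℤ} (h : k + l ≠ 0) (a b : ℤ → R) :
    (cocycle R).form (diag k a) (diag l b) = 0 := by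
  rw [cocycle_apply, tr]
  refine (finsum_congr fun i => ?_).trans finsum_zero
  rw [entry_mul_diag, entry_J_lie, entry_diag]
  by_cases hi : i - l - i = k
  · omega
  · rw [if_neg hi, mul_zero, zero_mul]

theorem cocycle_diag_zero (a b : ℤ → R) :
    (cocycle R).form (diag 0 a) (diag 0 b) = 0 := by
  rw [cocycle_apply, tr]
  refine (finsum_congr fun i => ?_).trans finsum_zero
  rw [entry_mul_diag, entry_J_lie]; simp

theorem cocycle_diag_one (a b : ℤ → R) :
    (cocycle R).form (diag 1 a) (diag (-1) b) = a 1 * b 0 := by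
  rw [cocycle_apply, tr_eq_sum _ {0}]
  · rw [Finset.sum_singleton, entry_mul_diag, entry_J_lie, entry_diag]; simp
  · intro i hi
    rw [entry_mul_diag, entry_J_lie, entry_diag] at hi
    by_contra h
    rw [Finset.mem_singleton] at h
    refine hi ?_
    by_cases h0 : i ≤ 0
    · rw [if_pos h0, if_pos (show i - -1 ≤ 0 by omega)]; simp
    · rw [if_neg h0, if_neg (show ¬ i - -1 ≤ 0 by omega)]; simp

theorem cocycle_diag_two (a b : ℤ → R) :
    (cocycle R).form (diag 2 a) (diag (-2) b) = a 1 * b (-1) + a 2 * b 0 := by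
  rw [cocycle_apply, tr_eq_sum _ {-1, 0}]
  · rw [Finset.sum_pair (by decide)]
    simp only [entry_mul_diag, entry_J_lie, entry_diag]; norm_num
  · intro i hi
    rw [entry_mul_diag, entry_J_lie, entry_diag] at hi
    by_contra h
    rw [Finset.mem_insert, Finset.mem_singleton] at h
    refine hi ?_
    by_cases h0 : i ≤ 0
    · rw [if_pos h0, if_pos (show i - -2 ≤ 0 by omega)]; simp
    · rw [if_neg h0, if_neg (show ¬ i - -2 ≤ 0 by omega)]; simp

end gl

end Matrices

/-! ### Homogeneous elements of the target algebras -/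

section Target

variable {ε : ℤˣ} {m : ℕ} {s : ℂ}

/-- The symmetry which a matrix must have to lie in the image of `𝔤_±^{[m]}` in `𝔤𝔩_∞^{[m]}`; there is
no condition if `s ≠ 0, 1/2`. -/
def IsSym (ε : ℤˣ) (m : ℕ) (s : ℂ) (A : Glm m) : Prop :=
  (s = 0 → A ∈ glZero ε m) ∧ (s = 1 / 2 → A ∈ glHalf ε m)

theorem mem_gPM_iff (x : GlmHat m) : x ∈ gPM ε m s ↔ IsSym ε m s x.1 := by
  unfold gPM IsSym
  split_ifs with h1 h2
  · subst h1
    simp only [forall_const, (by norm_num : ¬ (0 : ℂ) = 1 / 2), false_imp_iff, and_true]; rfl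
  · exact ⟨fun h => ⟨fun h' => absurd h' h1, fun _ => h⟩, fun h => h.2 h2⟩
  · exact ⟨fun _ => ⟨fun h => absurd h h1, fun h => absurd h h2⟩, fun _ => trivial⟩

theorem mem_glZero {A : Glm m} : A ∈ glZero ε m ↔
    (∀ i j, i ≠ 0 → j ≠ 0 →
      A.entry i j = -(sg m ε i * sg m ε j * conj m (A.entry (-j) (-i)))) ∧
    (∀ i, i ≠ 0 → A.entry i 0 = -(sg m ε i * uu m * conj m (A.entry 0 (-i)))) ∧
    A.entry 0 0 = -conj m (A.entry 0 0) := zeroCond_iff ε m A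

/-- The element of `𝔤_±^{[m]}` with matrix `A` and central component `c`. -/
def ofMatrix (A : Glm m) (hA : IsSym ε m s A) (c : Rm m) : gPM ε m s :=
  ⟨CentralExt.mk _ A c, (mem_gPM_iff _).2 hA⟩

/-- The matrix of an element of `𝔤_±^{[m]}`. -/
def mat (x : gPM ε m s) : Glm m := x.1.1

/-- The central component of an element of `𝔤_±^{[m]}`. -/
def cen (x : gPM ε m s) : Rm m := x.1.2

@[simp] theorem mat_ofMatrix (A : Glm m) (hA : IsSym ε m s A) (c : Rm m) :
    mat (ofMatrix A hA c) = A := rfl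
@[simp] theorem cen_ofMatrix (A : Glm m) (hA : IsSym ε m s A) (c : Rm m) :
    cen (ofMatrix A hA c) = c := rfl
@[simp] theorem mat_add (x y : gPM ε m s) : mat (x + y) = mat x + mat y := rfl
@[simp] theorem cen_add (x y : gPM ε m s) : cen (x + y) = cen x + cen y := rfl
@[simp] theorem mat_sub (x y : gPM ε m s) : mat (x - y) = mat x - mat y := rfl
@[simp] theorem cen_sub (x y : gPM ε m s) : cen (x - y) = cen x - cen y := rfl
@[simp] theorem mat_smul (c : ℂ) (x : gPM ε m s) : mat (c • x) = c • mat x := rfl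
@[simp] theorem cen_smul (c : ℂ) (x : gPM ε m s) : cen (c • x) = c • cen x := rfl
@[simp] theorem mat_zero : mat (0 : gPM ε m s) = 0 := rfl
@[simp] theorem mat_central (c : Rm m) : mat (central ε m s c) = 0 := rfl
@[simp] theorem cen_central (c : Rm m) : cen (central ε m s c) = c := rfl
theorem mat_lie (x y : gPM ε m s) : mat ⁅x, y⁆ = ⁅mat x, mat y⁆ := rfl
theorem cen_lie (x y : gPM ε m s) :
    cen ⁅x, y⁆ = (gl.cocycle (Rm m)).form (mat x) (mat y) := rfl

theorem isSym_mat (x : gPM ε m s) : IsSym ε m s (mat x) := (mem_gPM_iff _).1 x.2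

theorem gPM_ext {x y : gPM ε m s} (h1 : mat x = mat y) (h2 : cen x = cen y) : x = y :=
  Subtype.ext (Prod.ext h1 h2)

theorem central_lie (c : Rm m) (x : gPM ε m s) : ⁅central ε m s c, x⁆ = 0 := by
  refine gPM_ext ?_ ?_
  · rw [mat_lie, mat_central, zero_lie]; rfl
  · rw [cen_lie, mat_central, map_zero]; rfl

theorem mem_grading {k : ℤ} {x : gPM ε m s} : x ∈ grading ε m s k ↔
    (∀ i j, j - i ≠ k → (mat x).entry i j = 0) ∧ (k ≠ 0 → cen x = 0) := Iff.rfl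

theorem mat_eq_diag {k : ℤ} {x : gPM ε m s} (hx : x ∈ grading ε m s k) :
    mat x = gl.diag k fun j => (mat x).entry (j - k) j := by
  ext i j
  rw [gl.entry_diag]
  split_ifs with h
  · rw [show j - k = i by omega]
  · exact hx.1 i j h

theorem ofMatrix_diag_mem (k : ℤ) (a : ℤ → Rm m) (h : IsSym ε m s (gl.diag k a)) (c : Rm m)
    (hc : k ≠ 0 → c = 0) : ofMatrix (gl.diag k a) h c ∈ grading ε m s k :=
  ⟨fun i j hij => (gl.entry_diag k a i j).trans (if_neg hij), hc⟩

theorem central_mem (c : Rm m) : central ε m s c ∈ grading ε m s 0 :=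
  ⟨fun _ _ _ => rfl, fun h => absurd rfl h⟩

theorem lie_mem_grading {k l : ℤ} {x y : gPM ε m s} (hx : x ∈ grading ε m s k)
    (hy : y ∈ grading ε m s l) : ⁅x, y⁆ ∈ grading ε m s (k + l) := by
  refine mem_grading.2 ⟨fun i j h => ?_, fun h => ?_⟩
  · rw [mat_lie, mat_eq_diag hx, mat_eq_diag hy, gl.diag_lie_diag, gl.entry_diag, if_neg h]
  · rw [cen_lie, mat_eq_diag hx, mat_eq_diag hy, gl.cocycle_diag_of_ne h]

theorem lie_eq_zero_of_mem_grading_zero {x y : gPM ε m s} (hx : x ∈ grading ε m s 0)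
    (hy : y ∈ grading ε m s 0) : ⁅x, y⁆ = 0 := by
  refine gPM_ext ?_ ?_
  · rw [mat_lie, mat_eq_diag hx, mat_eq_diag hy, gl.diag_lie_diag]
    ext i j
    rw [gl.entry_diag]
    split_ifs
    · simp only [sub_zero, mat_zero, gl.entry_zero]; ring
    · rfl
  · rw [cen_lie, mat_eq_diag hx, mat_eq_diag hy, gl.cocycle_diag_zero]; rfl

/-- Scaling the entries by complex numbers which are invariant under the reflection of the matrix
preserves the symmetry. -/
theorem IsSym.scale {A : Glm m} (hA : IsSym ε m s A) {Q : ℤ → ℤ → ℂ}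
    (h0 : s = 0 → ∀ i j, Q (-j) (-i) = Q i j)
    (h1 : s = 1 / 2 → ∀ i j, Q (1 - j) (1 - i) = Q i j) : IsSym ε m s (gl.scale Q A) := by
  refine ⟨fun h => ?_, fun h => ?_⟩
  · have hQ := h0 h
    obtain ⟨a1, a2, a3⟩ := mem_glZero.1 (hA.1 h)
    refine mem_glZero.2 ⟨fun i j hi hj => ?_, fun i hi => ?_, ?_⟩
    · rw [gl.entry_scale, gl.entry_scale, hQ, map_smul, mul_smul_comm, ← smul_neg, ← a1 i j hi hj]
    · have := hQ i 0
      rw [neg_zero] at this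
      rw [gl.entry_scale, gl.entry_scale, this, map_smul, mul_smul_comm, ← smul_neg, ← a2 i hi]
    · rw [gl.entry_scale, map_smul, ← smul_neg, ← a3]
  · intro i j
    rw [gl.entry_scale, gl.entry_scale, h1 h, map_smul, mul_smul_comm, ← smul_neg, ← hA.2 h i j]

/-- A diagonal matrix whose entries form an odd sequence under the reflection of the index
combined with `u ↦ -u` satisfies the symmetry. -/
theorem isSym_diag_zero {d : ℤ → Rm m} (h0 : s = 0 → ∀ j, conj m (d (-j)) = -d j)
    (h1 : s = 1 / 2 → ∀ j, conj m (d (1 - j)) = -d j) : IsSym ε m s (gl.diag 0 d) := by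
  refine ⟨fun h => mem_glZero.2 ⟨fun i j hi hj => ?_, fun i hi => ?_, ?_⟩, fun h i j => ?_⟩
  · rw [gl.entry_diag, gl.entry_diag]
    by_cases hij : i = j
    · subst hij
      rw [sub_self, sub_self, if_pos rfl, if_pos rfl, sg_sq, h0 h]; ring
    · rw [if_neg (by omega), if_neg (by omega)]; simp
  · rw [gl.entry_diag, gl.entry_diag, if_neg (by omega), if_neg (by omega)]; simp
  · have := h0 h 0
    rw [neg_zero] at this
    rw [gl.entry_diag, sub_self, if_pos rfl, this, neg_neg]
  · rw [gl.entry_diag, gl.entry_diag]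
    by_cases hij : i = j
    · subst hij
      rw [sub_self, sub_self, if_pos rfl, if_pos rfl, h1 h, sgn_add, sgn_sq]; ring
    · rw [if_neg (by omega), if_neg (by omega)]; simp

theorem conj_algebraMap (c : ℂ) : conj m (algebraMap ℂ (Rm m) c) = algebraMap ℂ (Rm m) c :=
  AlgHom.commutes _ c

/-- The diagonal matrix with entries `(s - j) ^ r`. -/
def powDiag (m : ℕ) (s : ℂ) (r : ℕ) : Glm m :=
  gl.diag 0 fun j => algebraMap ℂ (Rm m) ((s - j) ^ r)

theorem isSym_powDiag {r : ℕ} (hr : Odd r) : IsSym ε m s (powDiag m s r) := by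
  refine isSym_diag_zero (fun h j => ?_) (fun h j => ?_)
  · rw [conj_algebraMap, ← map_neg, ← hr.neg_pow, h]; congr 2; push_cast; ring
  · rw [conj_algebraMap, ← map_neg, ← hr.neg_pow, h]; congr 2; push_cast; ring

/-- The diagonal element of `𝔤_±^{[m]}` with entries `(s - j) ^ r`, for odd `r`. -/
def powEl (ε : ℤˣ) (m : ℕ) (s : ℂ) (r : ℕ) (hr : Odd r) : gPM ε m s :=
  ofMatrix (powDiag m s r) (isSym_powDiag hr) 0

theorem powEl_mem (r : ℕ) (hr : Odd r) : powEl ε m s r hr ∈ grading ε m s 0 :=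
  ofMatrix_diag_mem _ _ _ _ fun _ => rfl

theorem mat_powEl_lie (r : ℕ) (hr : Odd r) (x : gPM ε m s) :
    mat ⁅powEl ε m s r hr, x⁆ = gl.scale (fun i j => (s - i) ^ r - (s - j) ^ r) (mat x) := by
  ext i j
  rw [mat_lie, gl.lie_def, gl.entry_sub, powEl, mat_ofMatrix, powDiag, gl.entry_diag_mul,
    gl.entry_mul_diag, gl.entry_scale, sub_smul, Algebra.smul_def, Algebra.smul_def]
  simp only [add_zero, sub_zero]
  ring

theorem cen_powEl_lie (r : ℕ) (hr : Odd r) {k : ℤ} {x : gPM ε m s} (hx : x ∈ grading ε m s k) :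
    cen ⁅powEl ε m s r hr, x⁆ = 0 := by
  rw [cen_lie, mat_eq_diag hx]
  by_cases hk : k = 0
  · subst hk; exact gl.cocycle_diag_zero _ _
  · exact gl.cocycle_diag_of_ne (by omega) _ _

/-- `ad` of the diagonal matrix with entries `s - j` is the degree operator. -/
theorem powEl_one_lie {k : ℤ} {x : gPM ε m s} (hx : x ∈ grading ε m s k) :
    ⁅powEl ε m s 1 odd_one, x⁆ = (k : ℂ) • x := by
  refine gPM_ext ?_ ?_
  · ext i j
    rw [mat_powEl_lie, gl.entry_scale, mat_smul, gl.entry_smul]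
    by_cases h : j - i = k
    · congr 1; rw [← h]; push_cast; ring
    · rw [(mem_grading.1 hx).1 i j h, smul_zero, smul_zero]
  · rw [cen_powEl_lie _ _ hx, cen_smul]
    by_cases hk : k = 0
    · simp [hk]
    · rw [(mem_grading.1 hx).2 hk, smul_zero]

/-- Elements of `𝔤_±^{[m]}` are finite sums of homogeneous ones. -/
theorem iSup_grading : ⨆ k, grading ε m s k = ⊤ := by
  refine eq_top_iff.2 fun x _ => ?_
  have hQ : ∀ k : ℤ, IsSym ε m s (gl.scale (fun i j => if j - i = k then 1 else 0) (mat x)) := by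
    intro k
    refine (isSym_mat x).scale (fun _ i j => ?_) (fun _ i j => ?_)
    · rw [show -i - -j = j - i by ring]
    · rw [show 1 - i - (1 - j) = j - i by ring]
  obtain ⟨b, hb⟩ := (mat x).exists_band
  have hx : x = central ε m s (cen x) + ∑ k ∈ Finset.Icc (-b) b, ofMatrix _ (hQ k) 0 := by
    have h1 : ∀ S : Finset ℤ, mat (∑ k ∈ S, ofMatrix _ (hQ k) 0) = ∑ k ∈ S, gl.scale
        (fun i j => if j - i = k then 1 else 0) (mat x) := by
      intro S
      induction S using Finset.cons_induction with
      | empty => rfl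
      | cons a S ha ih => rw [Finset.sum_cons, Finset.sum_cons, mat_add, ih, mat_ofMatrix]
    have h2 : ∀ S : Finset ℤ, cen (∑ k ∈ S, ofMatrix _ (hQ k) 0) = 0 := by
      intro S
      induction S using Finset.cons_induction with
      | empty => rfl
      | cons a S ha ih => rw [Finset.sum_cons, cen_add, ih, cen_ofMatrix, zero_add]
    have h3 : ∀ (S : Finset ℤ) (i j : ℤ), (∑ k ∈ S, gl.scale
        (fun i j => if j - i = k then 1 else 0) (mat x)).entry i j
        = ∑ k ∈ S, if j - i = k then (mat x).entry i j else 0 := by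
      intro S i j
      induction S using Finset.cons_induction with
      | empty => rfl
      | cons a S ha ih =>
        rw [Finset.sum_cons, Finset.sum_cons, gl.entry_add, ih, gl.entry_scale]
        split_ifs <;> simp
    refine gPM_ext ?_ ?_
    · rw [mat_add, mat_central, zero_add, h1]
      ext i j
      rw [h3, Finset.sum_ite_eq]
      split_ifs with h
      · rfl
      · by_contra h'
        exact h (Finset.mem_Icc.2 (abs_le.1 (hb i j h')))
    · rw [cen_add, cen_central, h2, add_zero]
  rw [hx]
  refine add_mem (Submodule.mem_iSup_of_mem 0 (central_mem _)) (sum_mem fun k _ =>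
    Submodule.mem_iSup_of_mem k ⟨fun i j h => ?_, fun _ => rfl⟩)
  change (gl.scale _ _).entry i j = 0
  rw [gl.entry_scale, if_neg h, zero_smul]

end Target

/-! ### Lie subalgebras containing all elements of nonzero degree -/

section Generation

variable {ε : ℤˣ} {m : ℕ} {s : ℂ}

/-- Elements of degree `0` commute, so every bracket is a combination of elements of nonzero degree
and of brackets of such elements. -/
theorem lie_mem_of_grading_le (S : LieSubalgebra ℂ (gPM ε m s))
    (hS : ∀ k ≠ 0, ∀ x ∈ grading ε m s k, x ∈ S) (x y : gPM ε m s) : ⁅x, y⁆ ∈ S := by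
  have hx : x ∈ ⨆ k, grading ε m s k := by rw [iSup_grading]; trivial
  have hy : y ∈ ⨆ k, grading ε m s k := by rw [iSup_grading]; trivial
  induction hx using Submodule.iSup_induction' with
  | zero => rw [zero_lie]; exact S.zero_mem
  | add x x' _ _ h h' => rw [add_lie]; exact S.add_mem h h'
  | mem k x hx =>
  induction hy using Submodule.iSup_induction' with
  | zero => rw [lie_zero]; exact S.zero_mem
  | add x x' _ _ h h' => rw [lie_add]; exact S.add_mem h h'
  | mem l y hy =>
  by_cases hkl : k + l = 0
  · by_cases hk : k = 0
    · subst hk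
      obtain rfl : l = 0 := by omega
      rw [lie_eq_zero_of_mem_grading_zero hx hy]; exact S.zero_mem
    · exact S.lie_mem (hS k hk x hx) (hS l (by omega) y hy)
  · exact hS _ hkl _ (lie_mem_grading hx hy)

theorem aeval_uu_surjective (m : ℕ) (c : Rm m) : ∃ f : ℂ[X], aeval (uu m) f = c := by
  obtain ⟨f, rfl⟩ := AdjoinRoot.mk_surjective c
  exact ⟨f, AdjoinRoot.aeval_eq f⟩

/-- The odd elements of `R_m` are the linear combinations of the odd powers of `u`. -/
theorem mem_of_conj_eq_neg {S : Submodule ℂ (Rm m)}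
    (hS : ∀ j, Odd j → j ≤ m → uu m ^ j ∈ S) {c : Rm m} (hc : conj m c = -c) : c ∈ S := by
  obtain ⟨f, rfl⟩ := aeval_uu_surjective m c
  have key : ∀ f : ℂ[X], aeval (uu m) f - conj m (aeval (uu m) f) ∈ S := by
    intro f
    induction f using Polynomial.induction_on' with
    | add p q hp hq =>
      rw [map_add, map_add, add_sub_add_comm]; exact S.add_mem hp hq
    | monomial n a =>
      rw [aeval_monomial, map_mul, conj_algebraMap, map_pow, conj_uu, ← mul_sub,
        ← Algebra.smul_def]
      refine S.smul_mem _ ?_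
      rcases Nat.even_or_odd n with h | h
      · rw [h.neg_pow, sub_self]; exact S.zero_mem
      · rw [h.neg_pow, sub_neg_eq_add]
        by_cases hn : n ≤ m
        · exact S.add_mem (hS n h hn) (hS n h hn)
        · rw [pow_eq_zero_of_le (by omega : m + 1 ≤ n) (uu_pow m), add_zero]; exact S.zero_mem
  have := S.smul_mem (1 / 2 : ℂ) (key f)
  rwa [hc, sub_neg_eq_add, ← two_smul ℂ, smul_smul, one_div_mul_cancel two_ne_zero,
    one_smul] at this

/-- Odd elements of `R_m` are divisible by `u`. -/
theorem exists_eq_uu_mul {c : Rm m} (hc : conj m c = -c) : ∃ e, c = uu m * e := by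
  have : c ∈ ((Ideal.span {uu m}).restrictScalars ℂ : Submodule ℂ (Rm m)) := by
    refine mem_of_conj_eq_neg (fun j hj _ => ?_) hc
    exact Ideal.pow_mem_of_mem _ (Ideal.mem_span_singleton_self _) _ hj.pos
  exact Ideal.mem_span_singleton.1 this

/-- A sequence indexed by `ℤ` with given differences and a given value. -/
theorem exists_antidifference {M : Type*} [AddCommGroup M] (d : ℤ → M) (c : M) :
    ∃ p : ℤ → M, p 1 = c ∧ ∀ j, p (j + 1) = p j + d j := by
  refine ⟨fun j => c + ∑ i ∈ Finset.Ico 1 j, d i - ∑ i ∈ Finset.Ico j 1, d i, by simp,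
    fun j => ?_⟩
  by_cases h : 1 ≤ j
  · have : Finset.Ico 1 (j + 1) = insert j (Finset.Ico 1 j) := by
      ext k; simp only [Finset.mem_Ico, Finset.mem_insert]; omega
    simp only [this, Finset.Ico_eq_empty (show ¬ j + 1 < 1 by omega),
      Finset.Ico_eq_empty (show ¬ j < 1 by omega), Finset.sum_empty]
    rw [Finset.sum_insert (by simp)]; abel
  · have : Finset.Ico j 1 = insert j (Finset.Ico (j + 1) 1) := by
      ext k; simp only [Finset.mem_Ico, Finset.mem_insert]; omega
    simp only [this, Finset.Ico_eq_empty (show ¬ 1 < j + 1 by omega),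
      Finset.Ico_eq_empty (show ¬ 1 < j by omega), Finset.sum_empty]
    rw [Finset.sum_insert (by simp)]; abel

theorem eq_of_antidifference {M : Type*} [AddCommGroup M] {d p q : ℤ → M} (h1 : p 1 = q 1)
    (hp : ∀ j, p (j + 1) = p j + d j) (hq : ∀ j, q (j + 1) = q j + d j) (j : ℤ) : p j = q j := by
  induction j using Int.inductionOn' (b := 1) with
  | zero => exact h1
  | succ k _ ih => rw [hp, hq, ih]
  | pred k _ ih =>
    have e1 := hp (k - 1)
    have e2 := hq (k - 1)
    rw [sub_add_cancel] at e1 e2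
    rw [e1, e2] at ih
    exact add_right_cancel ih

theorem sgn_even (m : ℕ) (ε : ℤˣ) (j : ℤ) : sgn m ε (2 * j) = 1 := by
  rw [two_mul, sgn_add, sgn_sq]

theorem sgn_odd (m : ℕ) (ε : ℤˣ) (j : ℤ) : sgn m ε (2 * j + 1) = -((ε : ℤ) : Rm m) := by
  rw [sgn_add, sgn_even, one_mul, sgn, zpow_one]; simp

theorem cast_unit_mul_self (m : ℕ) (ε : ℤˣ) : ((ε : ℤ) : Rm m) * ((ε : ℤ) : Rm m) = 1 := by
  rw [← Int.cast_mul, ← Units.val_mul, ← sq, Int.units_sq]; simp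

theorem diag_mem_glHalf {k : ℤ} {a : ℤ → Rm m}
    (h : ∀ j, a j = -(sgn m ε (2 * j - k) * conj m (a (k + 1 - j)))) :
    gl.diag k a ∈ glHalf ε m := by
  intro i j
  rw [gl.entry_diag, gl.entry_diag]
  by_cases hij : j - i = k
  · rw [if_pos hij, if_pos (by omega), h j, show 2 * j - k = i + j by omega,
      show k + 1 - j = 1 - i by omega]
  · rw [if_neg hij, if_neg (by omega)]; simp

theorem diag_mem_glZero {k : ℤ} (hk : k ≠ 0) {a : ℤ → Rm m}
    (h : ∀ j, j ≠ 0 → j ≠ k → a j = -(sg m ε (j - k) * sg m ε j * conj m (a (k - j))))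
    (h0 : a 0 = -(sg m ε (-k) * uu m * conj m (a k))) :
    gl.diag k a ∈ glZero ε m := by
  refine mem_glZero.2 ⟨fun i j hi hj => ?_, fun i hi => ?_, ?_⟩
  · rw [gl.entry_diag, gl.entry_diag]
    by_cases hij : j - i = k
    · rw [if_pos hij, if_pos (by omega), h j hj (by omega), show j - k = i by omega,
        show k - j = -i by omega]
    · rw [if_neg hij, if_neg (by omega)]; simp
  · rw [gl.entry_diag, gl.entry_diag]
    by_cases hij : 0 - i = k
    · rw [if_pos hij, if_pos (by omega), h0, show -k = i by omega, show k = -i by omega]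
    · rw [if_neg hij, if_neg (by omega)]; simp
  · rw [gl.entry_diag, if_neg (by omega)]; simp

theorem sg_mul_sg_of_pos {i j : ℤ} (h : 0 < i ∧ 0 < j ∨ i < 0 ∧ j < 0) :
    sg m ε i * sg m ε j = sgn m ε (i + j) := by
  rw [sg, sg, sgn_add]
  rcases h with ⟨h1, h2⟩ | ⟨h1, h2⟩
  · rw [if_pos h1, if_pos h2]; ring
  · rw [if_neg (by omega), if_neg (by omega)]; ring

theorem isSym_of_half (hs : s = 1 / 2) {A : Glm m} (h : A ∈ glHalf ε m) : IsSym ε m s A :=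
  ⟨fun h' => absurd (h'.symm.trans hs) (by norm_num), fun _ => h⟩

theorem isSym_of_zero (hs : s = 0) {A : Glm m} (h : A ∈ glZero ε m) : IsSym ε m s A :=
  ⟨fun _ => h, fun h' => absurd (hs.symm.trans h') (by norm_num)⟩

/-- The bracket of elements of degrees `1` and `-1`. -/
theorem lie_mem_one (S : LieSubalgebra ℂ (gPM ε m s))
    (hS : ∀ k ≠ 0, ∀ x ∈ grading ε m s k, x ∈ S) {a b : ℤ → Rm m}
    (ha : IsSym ε m s (gl.diag 1 a)) (hb : IsSym ε m s (gl.diag (-1) b)) :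
    ∃ z ∈ S, mat z = gl.diag 0 (fun j => a (j + 1) * b j - a j * b (j - 1)) ∧
      cen z = a 1 * b 0 := by
  refine ⟨⁅ofMatrix _ ha 0, ofMatrix _ hb 0⁆, S.lie_mem
    (hS 1 one_ne_zero _ (ofMatrix_diag_mem _ _ _ _ fun _ => rfl))
    (hS (-1) (by norm_num) _ (ofMatrix_diag_mem _ _ _ _ fun _ => rfl)), ?_, ?_⟩
  · rw [mat_lie, mat_ofMatrix, mat_ofMatrix, gl.diag_lie_diag]
    congr 1; funext j; rw [sub_neg_eq_add, mul_comm (b _)]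
  · rw [cen_lie, mat_ofMatrix, mat_ofMatrix, gl.cocycle_diag_one]

/-- The bracket of elements of degrees `2` and `-2`. -/
theorem lie_mem_two (S : LieSubalgebra ℂ (gPM ε m s))
    (hS : ∀ k ≠ 0, ∀ x ∈ grading ε m s k, x ∈ S) {a b : ℤ → Rm m}
    (ha : IsSym ε m s (gl.diag 2 a)) (hb : IsSym ε m s (gl.diag (-2) b)) :
    ∃ z ∈ S, z ∈ grading ε m s 0 ∧ cen z = a 1 * b (-1) + a 2 * b 0 := by
  have h1 : ofMatrix _ ha 0 ∈ grading ε m s 2 := ofMatrix_diag_mem _ _ _ _ fun _ => rfl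
  have h2 : ofMatrix _ hb 0 ∈ grading ε m s (-2) := ofMatrix_diag_mem _ _ _ _ fun _ => rfl
  refine ⟨⁅ofMatrix _ ha 0, ofMatrix _ hb 0⁆, S.lie_mem (hS 2 two_ne_zero _ h1)
    (hS (-2) (by norm_num) _ h2), lie_mem_grading h1 h2, ?_⟩
  rw [cen_lie, mat_ofMatrix, mat_ofMatrix, gl.cocycle_diag_two]

/-- If every diagonal of degree `0` occurs in `S` with an odd central component, and every even
central value occurs in degree `0`, then `S` contains everything of degree `0`. -/
theorem mem_of_mem_grading_zero (S : LieSubalgebra ℂ (gPM ε m s))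
    (hodd : ∀ c, conj m c = -c → central ε m s c ∈ S)
    (hdiag : ∀ x ∈ grading ε m s 0, ∃ z ∈ S, mat z = mat x ∧ conj m (cen z) = -cen z)
    (heven : ∀ c, conj m c = c → ∃ z ∈ S, z ∈ grading ε m s 0 ∧ cen z = c)
    {x : gPM ε m s} (hx : x ∈ grading ε m s 0) : x ∈ S := by
  have hev : ∀ c, conj m c = c → central ε m s c ∈ S := by
    intro c hc
    obtain ⟨z, hz, hz0, hzc⟩ := heven c hc
    obtain ⟨y, hy, hy1, hy2⟩ := hdiag z hz0
    have : central ε m s c = z - y + central ε m s (cen y) := by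
      refine gPM_ext ?_ ?_
      · simp [hy1]
      · simp [hzc]
    rw [this]
    exact S.add_mem (S.sub_mem hz hy) (hodd _ hy2)
  have hcen : ∀ c, central ε m s c ∈ S := by
    intro c
    have : central ε m s c = (1 / 2 : ℂ) • central ε m s (c + conj m c)
        + (1 / 2 : ℂ) • central ε m s (c - conj m c) := by
      refine gPM_ext (by simp) ?_
      simp only [cen_central, cen_add, cen_smul]
      rw [← smul_add, add_add_sub_cancel, ← two_smul ℂ c, smul_smul,
        one_div_mul_cancel two_ne_zero, one_smul]
    rw [this]
    refine S.add_mem (S.smul_mem _ (hev _ ?_)) (S.smul_mem _ (hodd _ ?_))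
    · rw [map_add, conj_conj, add_comm]
    · rw [map_sub, conj_conj, neg_sub]
  obtain ⟨z, hz, hz1, -⟩ := hdiag x hx
  have : x = z + central ε m s (cen x - cen z) :=
    gPM_ext (by simp [hz1]) (by simp)
  rw [this]
  exact S.add_mem hz (hcen _)

/-- For `s = 1/2` the diagonal matrix with entries `d_j` is the bracket of a superdiagonal matrix made of
an antidifference `p` of `d` and a subdiagonal matrix of signs. The symmetry of `d` makes `p` symmetric
under `j ↦ 2 - j`, if it is normalized by `p 1 = 0`. -/
theorem mem_of_grading_le_half (hs : s = 1 / 2) (S : LieSubalgebra ℂ (gPM ε m s))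
    (hS : ∀ k ≠ 0, ∀ x ∈ grading ε m s k, x ∈ S)
    (hodd : ∀ c, conj m c = -c → central ε m s c ∈ S)
    {x : gPM ε m s} (hx : x ∈ grading ε m s 0) : x ∈ S := by
  have hee := cast_unit_mul_self m ε
  refine mem_of_mem_grading_zero S hodd (fun x hx => ?_) (fun c hc => ?_) hx
  · have hd : ∀ j, conj m ((mat x).entry (1 - j) (1 - j)) = -(mat x).entry j j := by
      intro j
      have := (isSym_mat x).2 hs j j
      rw [← two_mul, sgn_even, one_mul] at this
      rw [this, neg_neg]
    obtain ⟨p, hp1, hp⟩ := exists_antidifference (fun j => (mat x).entry j j) 0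
    have hpc : ∀ j, conj m (p (2 - j)) = p j := by
      refine eq_of_antidifference (d := fun j => (mat x).entry j j) ?_ (fun j => ?_) hp
      · rw [show (2 : ℤ) - 1 = 1 by norm_num, hp1, map_zero]
      · have h := hp (1 - j)
        rw [show 1 - j + 1 = 2 - j by ring] at h
        rw [h, map_add, hd, show 2 - (j + 1) = 1 - j by ring, neg_add_cancel_right]
    -- The factors `ε` compensate the signs in the symmetry; the product of the `j + 1`-st entry of the
    -- first diagonal and the `j`-th entry of the second one is `p (j + 1)` for all `j`.
    refine Exists.elim (lie_mem_one S hS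
      (a := fun j => if 1 < j then p j else ((ε : ℤ) : Rm m) * p j)
      (b := fun j => if 0 < j then 1 else if j = 0 then 0 else ((ε : ℤ) : Rm m))
      (isSym_of_half hs (diag_mem_glHalf fun j => ?_))
      (isSym_of_half hs (diag_mem_glHalf fun j => ?_))) ?_
    rotate_right
    · rintro z ⟨hz, hz1, hz2⟩
      refine ⟨z, hz, ?_, ?_⟩
      · rw [hz1, mat_eq_diag hx]
        congr 1
        funext j
        rw [sub_zero]
        have h0 : ∀ j, (if 1 < j + 1 then p (j + 1) else ((ε : ℤ) : Rm m) * p (j + 1)) *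
            (if 0 < j then 1 else if j = 0 then 0 else ((ε : ℤ) : Rm m)) = p (j + 1) := by
          intro j
          split_ifs with h1 h2 h3 h4 h5
          · rw [mul_one]
          · omega
          · omega
          · omega
          · rw [h5, zero_add, hp1, mul_zero]
          · linear_combination (p (j + 1)) * hee
        have h1 := h0 (j - 1)
        rw [sub_add_cancel] at h1
        rw [h0, h1, hp, add_sub_cancel_left]
      · rw [hz2]; simp
    · rw [show 2 * j - 1 = 2 * (j - 1) + 1 by ring, sgn_odd, ← hpc j,
        show (1 : ℤ) + 1 - j = 2 - j by ring]
      rcases lt_trichotomy 1 j with h | h | h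
      · rw [if_pos h, if_neg (by omega), map_mul, map_intCast]
        linear_combination (-conj m (p (2 - j))) * hee
      · subst h; norm_num [hp1]
      · rw [if_neg (by omega), if_pos (by omega)]; ring
    · rw [show 2 * j - -1 = 2 * j + 1 by ring, sgn_odd, show (-1 : ℤ) + 1 - j = -j by ring]
      rcases lt_trichotomy 0 j with h | h | h
      · rw [if_pos h, if_neg (by omega), if_neg (by omega), map_intCast]
        linear_combination -hee
      · subst h; simp
      · rw [if_neg (by omega), if_neg (by omega), if_pos (by omega)]; simp
  · refine Exists.elim (lie_mem_two S hS
      (a := fun j => if j = 1 then 1 else if j = 2 then -1 else 0)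
      (b := fun j => if j = -1 then (1 / 2 : ℂ) • c else if j = 0 then -((1 / 2 : ℂ) • c) else 0)
      (isSym_of_half hs (diag_mem_glHalf fun j => ?_))
      (isSym_of_half hs (diag_mem_glHalf fun j => ?_))) ?_
    rotate_right
    · rintro z ⟨hz, hz0, hzc⟩
      refine ⟨z, hz, hz0, ?_⟩
      rw [hzc]
      norm_num
      rw [← two_smul ℂ, smul_smul]; norm_num
    · rw [show 2 * j - 2 = 2 * (j - 1) by ring, sgn_even, one_mul]
      by_cases h1 : j = 1
      · subst h1; norm_num
      by_cases h2 : j = 2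
      · subst h2; norm_num
      rw [if_neg h1, if_neg h2, if_neg (by omega), if_neg (by omega), map_zero, neg_zero]
    · rw [show 2 * j - -2 = 2 * (j + 1) by ring, sgn_even, one_mul]
      by_cases h1 : j = -1
      · subst h1; norm_num [hc]
      by_cases h2 : j = 0
      · subst h2; norm_num [hc]
      rw [if_neg h1, if_neg h2, if_neg (by omega), if_neg (by omega), map_zero, neg_zero]

/-- For `s = 0` the argument for `s = 1/2` is repeated with the reflection `j ↦ 1 - j` of `p`, normalized by
`p 1 = d_0 / 2`. The defining condition involves a factor `u` in row and column `0`, which is provided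
by the divisibility of the odd element `d_0` by `u`. -/
theorem mem_of_grading_le_zero (hs : s = 0) (S : LieSubalgebra ℂ (gPM ε m s))
    (hS : ∀ k ≠ 0, ∀ x ∈ grading ε m s k, x ∈ S)
    (hodd : ∀ c, conj m c = -c → central ε m s c ∈ S)
    {x : gPM ε m s} (hx : x ∈ grading ε m s 0) : x ∈ S := by
  have hee := cast_unit_mul_self m ε
  have hsg1 : sg m ε (-1) = ((ε : ℤ) : Rm m) := by
    have := sgn_odd m ε (-1)
    norm_num at this
    rw [sg, if_neg (by norm_num), this]; ring
  have hsg2 : sg m ε 1 = -((ε : ℤ) : Rm m) := by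
    have := sgn_odd m ε 0
    norm_num at this
    rw [sg, if_pos (by norm_num), this]; ring
  refine mem_of_mem_grading_zero S hodd (fun x hx => ?_) (fun c hc => ?_) hx
  · have hd : ∀ j, conj m ((mat x).entry (-j) (-j)) = -(mat x).entry j j := by
      intro j
      obtain ⟨h1, -, h3⟩ := mem_glZero.1 ((isSym_mat x).1 hs)
      by_cases hj : j = 0
      · subst hj; rw [neg_zero, h3, neg_neg, ← h3]
      · rw [h1 j j hj hj, sg_sq, one_mul, neg_neg]
    have hd0 := hd 0
    rw [neg_zero] at hd0
    have hhalf : conj m ((1 / 2 : ℂ) • (mat x).entry 0 0) = -((1 / 2 : ℂ) • (mat x).entry 0 0) := by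
      rw [map_smul, hd0, smul_neg]
    obtain ⟨e, he⟩ := exists_eq_uu_mul hhalf
    obtain ⟨p, hp1, hp⟩ := exists_antidifference (fun j => (mat x).entry j j)
      ((1 / 2 : ℂ) • (mat x).entry 0 0)
    have hp0 : p 0 = -((1 / 2 : ℂ) • (mat x).entry 0 0) := by
      have h := hp 0
      rw [zero_add, hp1] at h
      have hh : (1 / 2 : ℂ) • (mat x).entry 0 0 + (1 / 2 : ℂ) • (mat x).entry 0 0
          = (mat x).entry 0 0 := by
        rw [← add_smul]; norm_num
      linear_combination hh - h
    have hpc : ∀ j, conj m (p (1 - j)) = p j := by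
      refine eq_of_antidifference (d := fun j => (mat x).entry j j) ?_ (fun j => ?_) hp
      · rw [sub_self, hp0, map_neg, hhalf, neg_neg, hp1]
      · have h := hp (-j)
        rw [show -j + 1 = 1 - j by ring] at h
        rw [h, map_add, hd, show 1 - (j + 1) = - j by ring, neg_add_cancel_right]
    refine Exists.elim (lie_mem_one S hS
      (a := fun j => if 1 < j then p j else if j = 1 then ((ε : ℤ) : Rm m) * e
        else if j = 0 then p 0 else ((ε : ℤ) : Rm m) * p j)
      (b := fun j => if 0 < j then 1 else if j = 0 then ((ε : ℤ) : Rm m) * uu m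
        else if j = -1 then 1 else ((ε : ℤ) : Rm m))
      (isSym_of_zero hs (diag_mem_glZero one_ne_zero (fun j h0 h1 => ?_) ?_))
      (isSym_of_zero hs (diag_mem_glZero (by norm_num) (fun j h0 h1 => ?_) ?_))) ?_
    rotate_right
    · rintro z ⟨hz, hz1, hz2⟩
      refine ⟨z, hz, ?_, ?_⟩
      · rw [hz1, mat_eq_diag hx]
        congr 1
        funext j
        rw [sub_zero]
        have h0 : ∀ j, (if 1 < j + 1 then p (j + 1) else if j + 1 = 1 then ((ε : ℤ) : Rm m) * e
            else if j + 1 = 0 then p 0 else ((ε : ℤ) : Rm m) * p (j + 1)) *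
            (if 0 < j then 1 else if j = 0 then ((ε : ℤ) : Rm m) * uu m
              else if j = -1 then 1 else ((ε : ℤ) : Rm m)) = p (j + 1) := by
          intro j
          by_cases h1 : 0 < j
          · rw [if_pos (by omega), if_pos h1, mul_one]
          by_cases h2 : j = 0
          · subst h2
            norm_num
            rw [hp1, he]
            linear_combination (uu m * e) * hee
          by_cases h3 : j = -1
          · subst h3; norm_num
          rw [if_neg (by omega), if_neg (by omega), if_neg (by omega), if_neg h1, if_neg h2,
            if_neg h3]
          linear_combination (p (j + 1)) * hee
        have h1 := h0 (j - 1)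
        rw [sub_add_cancel] at h1
        rw [h0, h1, hp, add_sub_cancel_left]
      · have : cen z = (1 / 2 : ℂ) • (mat x).entry 0 0 := by
          rw [hz2, he]
          norm_num
          linear_combination (uu m * e) * hee
        rw [this, hhalf]
    · rw [sg_mul_sg_of_pos (by omega), show j - 1 + j = 2 * (j - 1) + 1 by ring, sgn_odd,
        ← hpc j]
      by_cases h : 1 < j
      · rw [if_pos h, if_neg (by omega), if_neg (by omega), if_neg (by omega), map_mul,
          map_intCast]
        linear_combination (-conj m (p (1 - j))) * hee
      · rw [if_neg (by omega), if_neg (by omega), if_neg (by omega), if_pos (by omega)]; ring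
    · rw [hsg1]
      norm_num
      have h2 : conj m (uu m * e) = -(uu m * e) := by rw [← he, hhalf]
      rw [map_mul, conj_uu] at h2
      rw [hp0, he]
      linear_combination (uu m * conj m e) * hee - h2
    · rw [sg_mul_sg_of_pos (by omega), show j - -1 + j = 2 * j + 1 by ring, sgn_odd]
      by_cases h : 0 < j
      · rw [if_pos h, if_neg (by omega), if_neg (by omega), if_neg (by omega), map_intCast]
        linear_combination -hee
      · rw [if_neg (by omega), if_neg (by omega), if_neg (by omega), if_pos (by omega)]; simp
    · rw [neg_neg, hsg2]; norm_num
  · refine Exists.elim (lie_mem_two S hS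
      (a := fun j => if j = 1 then 1 else 0)
      (b := fun j => if j = -1 then c else 0)
      (isSym_of_zero hs (diag_mem_glZero (by norm_num) (fun j h0 h2 => ?_) (by norm_num)))
      (isSym_of_zero hs (diag_mem_glZero (by norm_num) (fun j h0 h2 => ?_) (by norm_num)))) ?_
    rotate_right
    · rintro z ⟨hz, hz0, hzc⟩
      refine ⟨z, hz, hz0, ?_⟩
      rw [hzc]
      norm_num
    · by_cases h1 : j = 1
      · subst h1; norm_num [hsg1, hsg2, hee]
      rw [if_neg h1, if_neg (by omega), map_zero, mul_zero, neg_zero]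
    · by_cases h1 : j = -1
      · subst h1; norm_num [hsg1, hsg2, hee, hc]
      rw [if_neg h1, if_neg (by omega), map_zero, mul_zero, neg_zero]

/-- Without symmetry the value `p 1` of the antidifference is free and produces the central component. -/
theorem mem_of_grading_le_generic (h0 : s ≠ 0) (h1 : s ≠ 1 / 2) (S : LieSubalgebra ℂ (gPM ε m s))
    (hS : ∀ k ≠ 0, ∀ x ∈ grading ε m s k, x ∈ S)
    {x : gPM ε m s} (hx : x ∈ grading ε m s 0) : x ∈ S := by
  have hsym : ∀ A, IsSym ε m s A := fun A => ⟨fun h => absurd h h0, fun h => absurd h h1⟩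
  obtain ⟨p, hp1, hp⟩ := exists_antidifference (fun j => (mat x).entry j j) (cen x)
  obtain ⟨z, hz, hz1, hz2⟩ := lie_mem_one S hS (hsym (gl.diag 1 p)) (hsym (gl.diag (-1) fun _ => 1))
  have : x = z := by
    refine gPM_ext ?_ (by rw [hz2, hp1, mul_one])
    rw [hz1, mat_eq_diag hx]
    congr 1; funext j
    rw [mul_one, mul_one, hp, add_sub_cancel_left, sub_zero]
  rw [this]; exact hz

/-- A Lie subalgebra of `𝔤_±^{[m]}` which contains all elements of nonzero degree and the odd central
elements is everything. -/
theorem mem_of_grading_le (S : LieSubalgebra ℂ (gPM ε m s))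
    (hS : ∀ k ≠ 0, ∀ x ∈ grading ε m s k, x ∈ S)
    (hodd : s = 0 ∨ s = 1 / 2 → ∀ j, Odd j → j ≤ m → central ε m s (uu m ^ j) ∈ S)
    (x : gPM ε m s) : x ∈ S := by
  have hc : s = 0 ∨ s = 1 / 2 → ∀ c, conj m c = -c → central ε m s c ∈ S := by
    intro hs c
    let T : Submodule ℂ (Rm m) :=
      { carrier := {c | central ε m s c ∈ S}
        zero_mem' := S.zero_mem
        add_mem' := fun {a b} ha hb => by
          have : central ε m s (a + b) = central ε m s a + central ε m s b :=
            gPM_ext (by simp) (by simp)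
          rw [Set.mem_ofPred_eq, this]; exact S.add_mem ha hb
        smul_mem' := fun t a ha => by
          have : central ε m s (t • a) = t • central ε m s a := gPM_ext (by simp) (by simp)
          rw [Set.mem_ofPred_eq, this]; exact S.smul_mem t ha }
    exact fun h => mem_of_conj_eq_neg (S := T) (hodd hs) h
  have h0 : ∀ x ∈ grading ε m s 0, x ∈ S := by
    intro x hx
    by_cases h0 : s = 0
    · exact mem_of_grading_le_zero h0 S hS (hc (Or.inl h0)) hx
    by_cases h1 : s = 1 / 2
    · exact mem_of_grading_le_half h1 S hS (hc (Or.inr h1)) hx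
    exact mem_of_grading_le_generic h0 h1 S hS hx
  have hx : x ∈ ⨆ k, grading ε m s k := by rw [iSup_grading]; trivial
  have hle : ⨆ k, grading ε m s k ≤ S.toSubmodule := by
    refine iSup_le fun k x hx => ?_
    by_cases hk : k = 0
    · subst hk; exact h0 x hx
    · exact hS k hk x hx
  exact hle hx

end Generation

/-! ### Interpolation by operators in `𝒟_x^±` -/

section Operators

/-- The operator `t ^ k g(D) D`, as an element of `𝒟̂_x^±`. -/
def opEl (ε : ℤˣ) (k : ℤ) (g : ℂ[X])
    (hg : (((ε ^ k : ℤˣ) : ℤ) : ℂ[X]) * g.comp (-X - C (k : ℂ)) = g) : DxHat ε :=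
  ⟨CentralExt.mk _ (DiffOp.tD k (g * X)) 0, by
    change DiffOp.tD k (g * X) ∈ Dx ε
    refine ⟨fun l => ?_, ?_⟩
    · rw [DiffOp.coeff_tD]
      split_ifs
      · exact dvd_mul_left _ _
      · exact dvd_zero _
    · rw [DiffOp.sigma_tD, hg, map_neg]⟩

/-- The factor `(s + u - j) τ_{ij}` by which the `(i, j)` entry of the image of `t ^ (j - i) g(D) D`
differs from `g(s + u - j)`. -/
def entryFactor (m : ℕ) (s : ℂ) (i j : ℤ) : Rm m :=
  (algebraMap ℂ (Rm m) s + uu m - (j : Rm m)) * twist m s i j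

variable {ε : ℤˣ} {m : ℕ} {s : ℂ} {k : ℤ}

theorem entry_phiAux_tD (g : ℂ[X]) (i j : ℤ) (h : j - i = k) :
    (phiAux (algebraMap ℂ (Rm m) s + uu m) (twist m s) (DiffOp.tD k (g * X))).entry i j
      = aeval (algebraMap ℂ (Rm m) s + uu m - (j : Rm m)) g * entryFactor m s i j := by
  rw [entry_phiAux, DiffOp.coeff_tD, if_pos h.symm, map_mul, aeval_X, mul_assoc, entryFactor]

theorem entry_phi_opEl (g : ℂ[X]) (hg) (i j : ℤ) (h : j - i = k) :
    (mat (phi ε m s (opEl ε k g hg))).entry i j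
      = aeval (algebraMap ℂ (Rm m) s + uu m - (j : Rm m)) g * entryFactor m s i j :=
  entry_phiAux_tD g i j h

theorem phi_opEl_mem (hk : k ≠ 0) (g : ℂ[X]) (hg) :
    phi ε m s (opEl ε k g hg) ∈ grading ε m s k := by
  refine mem_grading.2 ⟨fun i j h => ?_, fun _ => ?_⟩
  · change (phiAux _ _ (DiffOp.tD k (g * X))).entry i j = 0
    rw [entry_phiAux, DiffOp.coeff_tD, if_neg (Ne.symm h), map_zero, zero_mul]
  · change algebraMap ℂ (Rm m) 0 + centralTerm _ (DiffOp.coeff 0 (DiffOp.tD k (g * X))) = 0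
    rw [DiffOp.coeff_tD, if_neg hk, map_zero, map_zero, add_zero]

/-- The operator `t ^ k D` is symmetric for the sign `1`, for every `k`. Hence the entries of its image, the
numbers `entryFactor`, have the symmetry of that sign. -/
theorem tD_X_mem (k : ℤ) : DiffOp.tD k (1 * X) ∈ Dx 1 :=
  (opEl 1 k 1 (by simp)).2

theorem entryFactor_half (i j : ℤ) : entryFactor m (1 / 2) i j
    = -(sgn m 1 (i + j) * conj m (entryFactor m (1 / 2) (1 - j) (1 - i))) := by
  have := phiAux_mem_glHalf 1 m (tD_X_mem (j - i)) i j
  rwa [entry_phiAux_tD _ _ _ rfl, entry_phiAux_tD _ _ _ (by ring), map_one, map_one, one_mul,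
    one_mul] at this

theorem entryFactor_zero {i j : ℤ} (hi : i ≠ 0) (hj : j ≠ 0) : entryFactor m 0 i j
    = -(sg m 1 i * sg m 1 j * conj m (entryFactor m 0 (-j) (-i))) := by
  have := (mem_glZero.1 (phiAux_mem_glZero 1 m (tD_X_mem (j - i)))).1 i j hi hj
  rwa [entry_phiAux_tD _ _ _ rfl, entry_phiAux_tD _ _ _ (by ring), map_one, map_one, one_mul,
    one_mul] at this

theorem isUnit_entryFactor {i j : ℤ} (h : s - j ≠ 0) : IsUnit (entryFactor m s i j) := by
  refine IsUnit.mul ?_ (Units.isUnit _)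
  have := isUnit_uSub m (c := j - s) (by rwa [← neg_sub, neg_ne_zero])
  convert this using 1
  rw [map_sub, map_intCast]; ring

theorem sgn_mul_sgn_one (n : ℤ) : sgn m ε n * sgn m 1 n = (((ε ^ n : ℤˣ) : ℤ) : Rm m) := by
  rw [sgn, sgn, ← Int.cast_mul, ← Units.val_mul, ← mul_zpow]; simp

theorem zpow_two_mul_sub (ε : ℤˣ) (j k : ℤ) : ε ^ (2 * j - k) = ε ^ k := by
  rw [zpow_sub, zpow_mul, zpow_ofNat, Int.units_sq, one_zpow, one_mul, Int.units_inv_eq_self]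

theorem sg_mul_sg_one (i : ℤ) : sg m ε i * sg m 1 i = (((ε ^ i : ℤˣ) : ℤ) : Rm m) := by
  rw [← sgn_mul_sgn_one, sg, sg]; split_ifs <;> ring

/-- The values of `ρ` at the points `s - j` may be prescribed by a sequence; elsewhere `ρ` is taken to
vanish. -/
theorem exists_values_of_seq {a v : ℤ → Rm m}
    (h : ∀ j : ℤ, s - j ≠ 0 → (1 / 2 : ℂ) • (v j + (((ε ^ k : ℤˣ) : ℤ) : Rm m) *
      conj m (Function.extend (fun j : ℤ => s - j) v 0 (-(s - j) - k))) * entryFactor m s (j - k) j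
        = a j) :
    ∃ ρ : ℂ → Rm m, ∀ j : ℤ, s - j ≠ 0 → (1 / 2 : ℂ) • (ρ (s - j) + (((ε ^ k : ℤˣ) : ℤ) : Rm m) *
      conj m (ρ (-(s - j) - k))) * entryFactor m s (j - k) j = a j := by
  refine ⟨Function.extend (fun j : ℤ => s - j) v 0, fun j hj => ?_⟩
  have hinj : Function.Injective fun j : ℤ => s - j := fun a b h => by simpa using h
  have := hinj.extend_apply v 0 j
  rw [this]
  exact h j hj

theorem half_smul_add_self_mul (x y : Rm m) (z a : Rm m) (h1 : x * z = a) (h2 : y * z = a) :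
    (1 / 2 : ℂ) • (x + y) * z = a := by
  rw [smul_mul_assoc, add_mul, h1, h2, ← two_smul ℂ, smul_smul, one_div_mul_cancel two_ne_zero,
    one_smul]

/-- The entries of a symmetric matrix on the `k`-th diagonal, as values of a function which is to be
interpolated by a polynomial and then made symmetric under `x ↦ -x - k`. -/
theorem exists_values {A : Glm m} (hA : IsSym ε m s A) (hk : k ≠ 0)
    (hint : ∀ n : ℤ, 2 * s = n → s = 0 ∨ s = 1 / 2) :
    ∃ ρ : ℂ → Rm m, ∀ j : ℤ, s - j ≠ 0 → (1 / 2 : ℂ) • (ρ (s - j) + (((ε ^ k : ℤˣ) : ℤ) : Rm m) *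
      conj m (ρ (-(s - j) - k))) * entryFactor m s (j - k) j = A.entry (j - k) j := by
  set β : ℤ → Rm m := fun j => Ring.inverse (entryFactor m s (j - k) j) * A.entry (j - k) j with hβ
  have hβ1 : ∀ j : ℤ, s - j ≠ 0 → β j * entryFactor m s (j - k) j = A.entry (j - k) j := by
    intro j hj
    have := Ring.inverse_mul_cancel _ (isUnit_entryFactor (m := m) (i := j - k) hj)
    rw [hβ]
    linear_combination (A.entry (j - k) j) * this
  have hinj : Function.Injective fun j : ℤ => s - j := fun a b h => by simpa using h
  by_cases h0 : s = 0
  · subst h0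
    -- The mirror image of `j = k` is the excluded point `0`, whence the factor `2`.
    refine exists_values_of_seq (v := fun j => if j = 0 then 0 else if j = k then 2 * β k else β j)
      fun j hj => ?_
    have hj0 : j ≠ 0 := by rintro rfl; simp at hj
    have hp : (-((0 : ℂ) - j) - k) = 0 - ((k - j : ℤ) : ℂ) := by push_cast; ring
    rw [hp, hinj.extend_apply _ 0 (k - j)]
    by_cases hjk : j = k
    · subst hjk
      rw [if_neg hj0, if_pos rfl, if_pos (sub_self j), map_zero, mul_zero, add_zero, ← hβ1 j hj,
        two_mul]
      exact half_smul_add_self_mul _ _ _ _ rfl rfl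
    · rw [if_neg hj0, if_neg hjk, if_neg (by omega), if_neg (by omega)]
      refine half_smul_add_self_mul _ _ _ _ (hβ1 j hj) ?_
      have hj' : (0 : ℂ) - ((k - j : ℤ) : ℂ) ≠ 0 := by
        rw [zero_sub, neg_ne_zero, Int.cast_ne_zero]; omega
      have e1 := (mem_glZero.1 (hA.1 rfl)).1 (j - k) j (by omega) hj0
      have e2 := entryFactor_zero (m := m) (i := j - k) (j := j) (by omega) hj0
      have e3 := congrArg (conj m) (hβ1 (k - j) hj')
      rw [show k - j - k = -j by ring, show k - j = -(j - k) by ring, map_mul] at e3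
      have e4 : sg m ε (j - k) * sg m ε j * (sg m 1 (j - k) * sg m 1 j)
          = (((ε ^ k : ℤˣ) : ℤ) : Rm m) := by
        rw [mul_mul_mul_comm, sg_mul_sg_one, sg_mul_sg_one, ← Int.cast_mul, ← Units.val_mul,
          ← zpow_add, show j - k + j = 2 * j - k by ring, zpow_two_mul_sub]
      have e5 := sg_sq m 1 (j - k)
      have e6 := sg_sq m 1 j
      rw [e1, ← e3, ← e4, show k - j = -(j - k) by ring]
      generalize conj m (β _) = b at *
      rw [e2]
      generalize conj m (entryFactor m 0 _ _) = w at *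
      linear_combination (-b * w * sg m ε (j - k) * sg m ε j) * (sg m 1 j * sg m 1 j * e5 + e6)
  by_cases h1 : s = 1 / 2
  · subst h1
    have hne : ∀ j : ℤ, (1 / 2 : ℂ) - j ≠ 0 := by
      intro j hj
      refine half_ne (-j) ?_
      push_cast
      linear_combination hj
    refine exists_values_of_seq (v := β) fun j hj => ?_
    have hp : (-((1 / 2 : ℂ) - j) - k) = 1 / 2 - ((k + 1 - j : ℤ) : ℂ) := by push_cast; ring
    rw [hp, hinj.extend_apply _ 0 (k + 1 - j)]
    refine half_smul_add_self_mul _ _ _ _ (hβ1 j hj) ?_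
    have e1 := hA.2 rfl (j - k) j
    have e2 := entryFactor_half (m := m) (j - k) j
    have e3 := congrArg (conj m) (hβ1 (k + 1 - j) (hne _))
    rw [show k + 1 - j - k = 1 - j by ring, show k + 1 - j = 1 - (j - k) by ring, map_mul] at e3
    have e4 := sgn_mul_sgn_one (m := m) (ε := ε) (j - k + j)
    rw [show j - k + j = 2 * j - k by ring, zpow_two_mul_sub] at e4
    rw [show j - k + j = 2 * j - k by ring] at e1 e2
    have e5 := sgn_sq m 1 (2 * j - k)
    rw [e1, ← e3, ← e4, show k + 1 - j = 1 - (j - k) by ring]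
    generalize conj m (β _) = b at *
    rw [e2]
    generalize conj m (entryFactor m (1 / 2) _ _) = w at *
    linear_combination (-b * w * sgn m ε (2 * j - k)) * e5
  · -- The mirror images are not of the form `s - j`, so only one of the two summands contributes.
    refine exists_values_of_seq (v := fun j => 2 * β j) fun j hj => ?_
    rw [Function.extend_apply' _ _ _ ?_, Pi.zero_apply, map_zero, mul_zero, add_zero, two_mul]
    · exact half_smul_add_self_mul _ _ _ _ (hβ1 j hj) (hβ1 j hj)
    · rintro ⟨j', hj'⟩
      rcases hint (j' + j - k) (by push_cast; linear_combination hj') with h | h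
      · exact h0 h
      · exact h1 h

end Operators

section Interpolation

/-- Chinese remainder theorem for powers of the polynomials `X - p`. -/
theorem exists_forall_dvd_sub (P : Finset ℂ) (M : ℕ) (r : ℂ → ℂ[X]) :
    ∃ q : ℂ[X], ∀ p ∈ P, (X - C p) ^ M ∣ q - r p := by
  obtain ⟨q, hq⟩ := Ideal.exists_forall_sub_mem_ideal
    (I := fun p : P => Ideal.span {(X - C (p : ℂ)) ^ M}) (fun p p' h => by
      rw [Function.onFun, Ideal.isCoprime_span_singleton_iff]
      exact (Polynomial.isCoprime_X_sub_C_of_isUnit_sub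
        (sub_ne_zero.2 (Subtype.coe_injective.ne h)).isUnit).pow) (fun p => r p)
  exact ⟨q, fun p hp => Ideal.mem_span_singleton.1 (hq ⟨p, hp⟩)⟩

/-- Every element of `R_m` is the value at `p + u` of a polynomial, that is, a jet at `p`. -/
theorem exists_aeval_eq (m : ℕ) (p : ℂ) (c : Rm m) :
    ∃ f : ℂ[X], aeval (algebraMap ℂ (Rm m) p + uu m) f = c := by
  obtain ⟨f, rfl⟩ := aeval_uu_surjective m c
  refine ⟨f.comp (X - C p), ?_⟩
  rw [aeval_comp]; simp

theorem aeval_eq_of_dvd {m M : ℕ} (hM : m + 1 ≤ M) {p : ℂ} {q r : ℂ[X]}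
    (h : (X - C p) ^ M ∣ q - r) :
    aeval (algebraMap ℂ (Rm m) p + uu m) q = aeval (algebraMap ℂ (Rm m) p + uu m) r := by
  obtain ⟨t, ht⟩ := h
  have := congrArg (aeval (algebraMap ℂ (Rm m) p + uu m)) ht
  rw [map_sub, map_mul, map_pow, map_sub, aeval_X, aeval_C, add_sub_cancel_left,
    pow_eq_zero_of_le hM (uu_pow m), zero_mul] at this
  exact sub_eq_zero.1 this

variable {N : ℕ} {ε : ℤˣ} {m : Fin N → ℕ} {s : Fin N → ℂ}

theorem Admissible.eq_zero_or_half (hs : Admissible s) (i : Fin N) (n : ℤ) (h : 2 * s i = n) :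
    s i = 0 ∨ s i = 1 / 2 := by
  rcases Int.even_or_odd n with ⟨a, rfl⟩ | ⟨a, rfl⟩
  · refine Or.inl (hs.int i ⟨a, ?_⟩)
    push_cast at h
    linear_combination h / 2
  · refine Or.inr (hs.half i ⟨a, ?_⟩)
    push_cast at h
    linear_combination h / 2

theorem Admissible.eq_of_mem (hs : Admissible s) {p : ℂ} {i i' : Fin N}
    (h : ∃ n : ℤ, p = s i + n ∨ p = -s i + n) (h' : ∃ n : ℤ, p = s i' + n ∨ p = -s i' + n) :
    i = i' := by
  by_contra hne
  obtain ⟨a, ha⟩ := h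
  obtain ⟨b, hb⟩ := h'
  rcases ha with ha | ha <;> rcases hb with hb | hb
  · exact (hs.ne i i' hne (b - a)).1 (by push_cast; linear_combination hb - ha)
  · exact (hs.ne i i' hne (b - a)).2 (by push_cast; linear_combination hb - ha)
  · exact (hs.ne i i' hne (a - b)).2 (by push_cast; linear_combination ha - hb)
  · exact (hs.ne i i' hne (a - b)).1 (by push_cast; linear_combination ha - hb)

/-- Finitely many entries on the `k`-th diagonals of the components of an element of `𝔤_±^{[m̄]}` are
the entries of the image of a single operator `t ^ k g(D) D`. -/
theorem exists_opEl (hs : Admissible s) {k : ℤ} (hk : k ≠ 0) (x : ∀ i, gPM ε (m i) (s i))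
    (J : Finset ℤ) :
    ∃ (g : ℂ[X]) (hg : (((ε ^ k : ℤˣ) : ℤ) : ℂ[X]) * g.comp (-X - C (k : ℂ)) = g),
      ∀ i, ∀ j ∈ J, (mat (phi ε (m i) (s i) (opEl ε k g hg))).entry (j - k) j
        = (mat (x i)).entry (j - k) j := by
  choose ρ hρ using fun i => exists_values (isSym_mat (x i)) hk (hs.eq_zero_or_half i)
  have hr : ∀ p : ℂ, ∃ f : ℂ[X], ∀ i, (∃ n : ℤ, p = s i + n ∨ p = -s i + n) →
      aeval (algebraMap ℂ (Rm (m i)) p + uu (m i)) f = ρ i p := by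
    intro p
    by_cases h : ∃ i, ∃ n : ℤ, p = s i + n ∨ p = -s i + n
    · obtain ⟨i, hi⟩ := h
      obtain ⟨f, hf⟩ := exists_aeval_eq (m i) p (ρ i p)
      refine ⟨f, fun i' hi' => ?_⟩
      obtain rfl := hs.eq_of_mem hi hi'
      exact hf
    · exact ⟨0, fun i hi => absurd ⟨i, hi⟩ h⟩
  choose r hr using hr
  set P : Finset ℂ := Finset.univ.biUnion fun i : Fin N =>
    (insert k J).image (fun j : ℤ => s i - j) ∪ (insert k J).image (fun j : ℤ => -(s i - j) - k)
    with hP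
  obtain ⟨q, hq⟩ := exists_forall_dvd_sub P (∑ i, m i + 1) r
  have hM : ∀ i, m i + 1 ≤ ∑ i, m i + 1 := fun i =>
    Nat.add_le_add_right (Finset.single_le_sum (fun _ _ => Nat.zero_le _) (Finset.mem_univ i)) 1
  have hεε : ((((ε ^ k : ℤˣ) : ℤ) : ℂ[X])) * (((ε ^ k : ℤˣ) : ℤ) : ℂ[X]) = 1 := by
    rw [← Int.cast_mul, ← Units.val_mul, ← sq, Int.units_sq]; simp
  have hg : (((ε ^ k : ℤˣ) : ℤ) : ℂ[X]) * ((1 / 2 : ℂ) • (q + (((ε ^ k : ℤˣ) : ℤ) : ℂ[X])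
      * q.comp (-X - C (k : ℂ)))).comp (-X - C (k : ℂ))
      = (1 / 2 : ℂ) • (q + (((ε ^ k : ℤˣ) : ℤ) : ℂ[X]) * q.comp (-X - C (k : ℂ))) := by
    rw [smul_comp, add_comp, mul_comp, comp_assoc, intCast_comp, sub_comp, neg_comp, X_comp, C_comp,
      show -(-X - C (k : ℂ)) - C (k : ℂ) = X by ring, comp_X, mul_smul_comm, mul_add, ← mul_assoc,
      hεε, one_mul, add_comm]
  have key : ∀ i, ∀ j ∈ insert k J, s i - j ≠ 0 →
      (mat (phi ε (m i) (s i) (opEl ε k _ hg))).entry (j - k) j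
        = (mat (x i)).entry (j - k) j := by
    intro i j hj hne
    have hp1 : s i - j ∈ P := by
      refine Finset.mem_biUnion.2 ⟨i, Finset.mem_univ _, Finset.mem_union_left _ ?_⟩
      exact Finset.mem_image_of_mem _ hj
    have hp2 : -(s i - j) - k ∈ P := by
      refine Finset.mem_biUnion.2 ⟨i, Finset.mem_univ _, Finset.mem_union_right _ ?_⟩
      exact Finset.mem_image_of_mem (fun j : ℤ => -(s i - j) - (k : ℂ)) hj
    have e1 := aeval_eq_of_dvd (hM i) (hq _ hp1)
    have e2 := aeval_eq_of_dvd (hM i) (hq _ hp2)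
    rw [hr _ i ⟨-j, Or.inl (by push_cast; ring)⟩] at e1
    rw [hr _ i ⟨j - k, Or.inr (by push_cast; ring)⟩] at e2
    rw [entry_phi_opEl _ _ _ _ (sub_sub_cancel j k), ← hρ i j hne, ← e1, ← e2, ← aeval_algHom_apply]
    congr 1
    rw [map_smul, map_add, map_mul, map_intCast, aeval_comp]
    congr 4
    · rw [map_sub, map_intCast]; ring
    · simp only [map_sub, map_neg, aeval_X, map_add, conj_uu, conj_algebraMap,
        map_intCast]
      ring_nf
  refine ⟨_, hg, fun i j hj => ?_⟩
  -- For `s_i = j = 0` the value of `g` is multiplied by the non-unit `u`, but the symmetry expresses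
  -- the entry in column `0` by the one in row `0`, which lies in column `k ≠ 0`.
  by_cases hne : s i - j = 0
  · have hsi : s i = 0 := hs.int i ⟨j, by linear_combination hne⟩
    obtain rfl : j = 0 := by
      rw [hsi, zero_sub, neg_eq_zero, Int.cast_eq_zero] at hne; exact hne
    have h1 := (mem_glZero.1 ((isSym_mat (x i)).1 hsi)).2.1 (0 - k) (by omega)
    have h2 := (mem_glZero.1 ((isSym_mat (phi ε (m i) (s i) (opEl ε k _ hg))).1 hsi)).2.1
      (0 - k) (by omega)
    have h3 := key i k (Finset.mem_insert_self _ _) (by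
      rw [hsi, zero_sub, neg_ne_zero, Int.cast_ne_zero]; exact hk)
    rw [sub_self] at h3
    rw [h1, h2, show -(0 - k) = k by ring, h3]
  · exact key i j (Finset.mem_insert_of_mem hj) hne

end Interpolation

/-! ### Submodules over `𝒟̂_x^±` of filtered modules -/

section Filtered

/-- An exhaustive filtration of `V` by finite-dimensional subspaces such that elements of degree `k` of
`L` raise the filtration degree by at most `|k|`. -/
structure IsFiltered {L : Type*} [LieRing L] [LieAlgebra ℂ L] (𝔤 : ℤ → Submodule ℂ L)
    {V : Type*} [AddCommGroup V] [Module ℂ V] [LieRingModule L V] [LieModule ℂ L V]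
    (F : ℕ → Submodule ℂ V) : Prop where
  finite : ∀ n, Module.Finite ℂ (F n)
  exhaustive : ∀ v, ∃ n, v ∈ F n
  lie_mem : ∀ k, ∀ x ∈ 𝔤 k, ∀ n, ∀ v ∈ F n, ⁅x, v⁆ ∈ F (n + k.natAbs)

variable {N : ℕ} {ε : ℤˣ} {m : Fin N → ℕ} {s : Fin N → ℂ}

/-- The element of `𝔤_±^{[m̄]}` with given components. -/
def ofComponents (f : ∀ i, gPM ε (m i) (s i)) : gSum ε m s := DFinsupp.equivFunOnFintype.symm f

@[simp] theorem ofComponents_apply (f : ∀ i, gPM ε (m i) (s i)) (i : Fin N) :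
    ofComponents f i = f i := rfl

theorem odd_three : Odd 3 := ⟨1, rfl⟩

/-- The sum over the components of the diagonal matrices with entries `(s_i - j) ^ 3`. -/
def cubeEl (ε : ℤˣ) (m : Fin N → ℕ) (s : Fin N → ℂ) : gSum ε m s :=
  ofComponents fun i => powEl ε (m i) (s i) 3 odd_three

theorem cubeEl_mem : cubeEl ε m s ∈ gradingSum ε m s 0 :=
  (mem_gradingSum ε m s 0 _).2 fun _ => powEl_mem 3 odd_three

/-- The operator `ad` of `cubeEl` on the elements of degree `k`. -/
def adCube (ε : ℤˣ) (m : Fin N → ℕ) (s : Fin N → ℂ) (k : ℤ) :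
    Module.End ℂ (gradingSum ε m s k) where
  toFun x := ⟨⁅cubeEl ε m s, (x : gSum ε m s)⁆, (mem_gradingSum ε m s k _).2 fun i => by
    have := lie_mem_grading ((mem_gradingSum ε m s 0 _).1 cubeEl_mem i)
      ((mem_gradingSum ε m s k _).1 x.2 i)
    rw [zero_add] at this
    rw [DirectSum.bracket_apply]; exact this⟩
  map_add' x y := Subtype.ext (lie_add _ _ _)
  map_smul' c x := Subtype.ext (lie_smul _ _ _)

theorem coe_adCube {k : ℤ} (x : gradingSum ε m s k) :
    (adCube ε m s k x : gSum ε m s) = ⁅cubeEl ε m s, (x : gSum ε m s)⁆ := rfl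

/-- The `(a, b)` entry of the `i`-th component of an element of degree `k`. -/
def entryHom (ε : ℤˣ) (m : Fin N → ℕ) (s : Fin N → ℂ) (k : ℤ) (i : Fin N) (a b : ℤ) :
    gradingSum ε m s k →ₗ[ℂ] Rm (m i) where
  toFun x := (mat ((x : gSum ε m s) i)).entry a b
  map_add' _ _ := rfl
  map_smul' _ _ := rfl

theorem entryHom_apply {k : ℤ} (i : Fin N) (a b : ℤ) (x : gradingSum ε m s k) :
    entryHom ε m s k i a b x = (mat ((x : gSum ε m s) i)).entry a b := rfl

theorem entryHom_adCube {k : ℤ} (i : Fin N) (a b : ℤ) (x : gradingSum ε m s k) :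
    entryHom ε m s k i a b (adCube ε m s k x)
      = ((s i - a) ^ 3 - (s i - b) ^ 3) • entryHom ε m s k i a b x := by
  rw [entryHom_apply, coe_adCube, DirectSum.bracket_apply]
  change (mat ⁅powEl ε (m i) (s i) 3 odd_three, (x : gSum ε m s) i⁆).entry a b = _
  rw [mat_powEl_lie, gl.entry_scale]; rfl

theorem apply_aeval_of_comm {E W : Type*} [AddCommGroup E] [Module ℂ E] [AddCommGroup W]
    [Module ℂ W] {M : Module.End ℂ E} {T : Module.End ℂ W} {ψ : E →ₗ[ℂ] W}
    (h : ∀ x, ψ (M x) = T (ψ x)) (q : ℂ[X]) (x : E) :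
    ψ (aeval M q x) = aeval T q (ψ x) := by
  induction q using Polynomial.induction_on generalizing x with
  | C c => rw [aeval_C, aeval_C, Module.algebraMap_end_apply, Module.algebraMap_end_apply, map_smul]
  | add p q hp hq => rw [map_add, map_add, LinearMap.add_apply, LinearMap.add_apply, map_add, hp, hq]
  | monomial n c ih =>
    rw [pow_succ, ← mul_assoc, map_mul (aeval M) (C c * X ^ n), map_mul (aeval T) (C c * X ^ n),
      aeval_X, aeval_X, Module.End.mul_apply, Module.End.mul_apply, ih, h]

theorem entryHom_aeval_adCube {k : ℤ} (q : ℂ[X]) (x : gradingSum ε m s k) (i : Fin N) (a b : ℤ) :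
    entryHom ε m s k i a b (aeval (adCube ε m s k) q x)
      = q.eval ((s i - a) ^ 3 - (s i - b) ^ 3) • entryHom ε m s k i a b x := by
  rw [apply_aeval_of_comm (T := algebraMap ℂ _ ((s i - a) ^ 3 - (s i - b) ^ 3))
    (fun x => by rw [entryHom_adCube, Module.algebraMap_end_apply]),
    aeval_algebraMap_apply_eq_algebraMap_eval, Module.algebraMap_end_apply]

/-- If `ψ` intertwines `M` with an endomorphism of a finite-dimensional space, then some nonzero
polynomial in `M` takes values in the kernel of `ψ`. -/
theorem exists_apply_aeval_eq_zero {E W : Type*} [AddCommGroup E] [Module ℂ E] [AddCommGroup W]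
    [Module ℂ W] [Module.Finite ℂ W] {M : Module.End ℂ E} {T : Module.End ℂ W} {ψ : E →ₗ[ℂ] W}
    (h : ∀ x, ψ (M x) = T (ψ x)) : ∃ p : ℂ[X], p ≠ 0 ∧ ∀ x, ψ (aeval M p x) = 0 :=
  ⟨T.charpoly, T.charpoly_monic.ne_zero, fun x => by
    rw [apply_aeval_of_comm h, LinearMap.aeval_self_charpoly, LinearMap.zero_apply]⟩

/-- The difference of the cubes is a nonconstant polynomial in `j`: its values at `s` and `s - k` are
`k ^ 3` and `7 k ^ 3`. -/
theorem finite_roots_cube (p : ℂ[X]) (hp : p ≠ 0) (s : ℂ) {k : ℤ} (hk : k ≠ 0) :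
    {j : ℤ | p.eval ((s - (j - k : ℤ)) ^ 3 - (s - j) ^ 3) = 0}.Finite := by
  set Q : ℂ[X] := (C (s + k) - X) ^ 3 - (C s - X) ^ 3 with hQ
  have hk' : (k : ℂ) ≠ 0 := Int.cast_ne_zero.2 hk
  have h0 : p.comp Q ≠ 0 := by
    intro h
    rcases comp_eq_zero_iff.1 h with h | ⟨-, h⟩
    · exact hp h
    · have h1 := congrArg (eval s) h
      have h2 := congrArg (eval (s - k)) h
      have h3 := h2.trans ((eval_C).trans (h1.trans eval_C).symm)
      simp only [hQ, eval_sub, eval_pow, eval_C, eval_X] at h3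
      have h4 : 6 * (k : ℂ) ^ 3 = 0 := by linear_combination h3
      simp [hk'] at h4
  refine Set.Finite.of_injOn (f := fun j : ℤ => (j : ℂ)) (t := {z | z ∈ (p.comp Q).roots}) ?_ ?_
    (Multiset.finite_toSet _)
  · intro j hj
    refine (mem_roots h0).2 ?_
    rw [IsRoot, eval_comp, hQ]
    simp only [eval_sub, eval_pow, eval_C, eval_X]
    rw [← Set.mem_ofPred.1 hj]
    congr 1; push_cast; ring
  · exact fun a _ b _ h => Int.cast_injective h

/-- An element of degree `k ≠ 0` lies in the image of `p(ad)` if its entries vanish where the scalar by which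
`p(ad)` acts is zero: divide the other entries by these scalars. -/
theorem exists_aeval_adCube_eq {k : ℤ} (hk : k ≠ 0) {p : ℂ[X]} {y : gSum ε m s}
    (hy : y ∈ gradingSum ε m s k)
    (h0 : ∀ i, ∀ j : ℤ, p.eval ((s i - (j - k : ℤ)) ^ 3 - (s i - j) ^ 3) = 0 →
      (mat (y i)).entry (j - k) j = 0) :
    ∃ z : gradingSum ε m s k, (aeval (adCube ε m s k) p z : gSum ε m s) = y := by
  have hy' := (mem_gradingSum ε m s k y).1 hy
  have hsym : ∀ i, IsSym ε (m i) (s i) (gl.scale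
      (fun a b => (p.eval ((s i - a) ^ 3 - (s i - b) ^ 3))⁻¹) (mat (y i))) := by
    intro i
    refine (isSym_mat (y i)).scale (fun h a b => ?_) (fun h a b => ?_)
    · rw [h]; congr 2; push_cast; ring
    · rw [h]; congr 2; push_cast; ring
  have hz : ofComponents (fun i => ofMatrix _ (hsym i) 0) ∈ gradingSum ε m s k :=
    (mem_gradingSum ε m s k _).2 fun i => mem_grading.2 ⟨fun a b h => by
      rw [ofComponents_apply, mat_ofMatrix, gl.entry_scale, (mem_grading.1 (hy' i)).1 a b h,
        smul_zero], fun _ => rfl⟩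
  refine ⟨⟨_, hz⟩, DFinsupp.ext fun i => gPM_ext ?_ ?_⟩
  · ext a b
    have e := entryHom_aeval_adCube p ⟨_, hz⟩ i a b
    rw [entryHom_apply, entryHom_apply] at e
    rw [e]
    simp only [ofComponents_apply, mat_ofMatrix]
    rw [gl.entry_scale, smul_smul]
    by_cases hab : b - a = k
    · obtain rfl : a = b - k := by omega
      by_cases hp : p.eval ((s i - (b - k : ℤ)) ^ 3 - (s i - b) ^ 3) = 0
      · rw [h0 i b hp, smul_zero]
      · rw [mul_inv_cancel₀ hp, one_smul]
    · rw [(mem_grading.1 (hy' i)).1 a b hab, smul_zero]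
  · have h1 := (mem_gradingSum ε m s k _).1 (aeval (adCube ε m s k) p ⟨_, hz⟩).2 i
    exact ((mem_grading.1 h1).2 hk).trans ((mem_grading.1 (hy' i)).2 hk).symm

variable {V : Type*} [AddCommGroup V] [Module ℂ V] [LieRingModule (gSum ε m s) V]
  [LieModule ℂ (gSum ε m s) V] {F : ℕ → Submodule ℂ V}

/-- On each step of the filtration, an element of degree `k ≠ 0` acts as zero as soon as finitely many
of its entries vanish. Indeed a polynomial in `ad` of `cubeEl` maps all elements of degree `k` to
elements acting as zero, and it acts on all but finitely many entries by nonzero scalars. -/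
theorem IsFiltered.exists_finset (hF : IsFiltered (gradingSum ε m s) F) {k : ℤ} (hk : k ≠ 0)
    (n : ℕ) : ∃ J : Finset ℤ, ∀ y ∈ gradingSum ε m s k,
      (∀ i, ∀ j ∈ J, (mat (y i)).entry (j - k) j = 0) → ∀ v ∈ F n, ⁅y, v⁆ = 0 := by
  have := hF.finite
  have hst : ∀ n, ∀ v ∈ F n, LieModule.toEnd ℂ _ V (cubeEl ε m s) v ∈ F n := fun n v hv =>
    hF.lie_mem 0 _ cubeEl_mem n v hv
  let H (n : ℕ) : Module.End ℂ (F n) := (LieModule.toEnd ℂ _ V (cubeEl ε m s)).restrict (hst n)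
  let T : Module.End ℂ (F n →ₗ[ℂ] F (n + k.natAbs)) :=
    LinearMap.llcomp ℂ _ _ _ (H (n + k.natAbs)) - LinearMap.lcomp ℂ _ (H n)
  let ψ : gradingSum ε m s k →ₗ[ℂ] (F n →ₗ[ℂ] F (n + k.natAbs)) :=
    { toFun := fun x => (LieModule.toEnd ℂ _ V (x : gSum ε m s)).restrict
        (hF.lie_mem k x x.2 n)
      map_add' := fun x y => LinearMap.ext fun v => Subtype.ext (add_lie _ _ _)
      map_smul' := fun c x => LinearMap.ext fun v => Subtype.ext (smul_lie _ _ _) }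
  have hψ : ∀ x, ψ (adCube ε m s k x) = T (ψ x) := fun x => LinearMap.ext fun v =>
    Subtype.ext (lie_lie (cubeEl ε m s) (x : gSum ε m s) (v : V))
  obtain ⟨p, hp0, hp⟩ := exists_apply_aeval_eq_zero hψ
  refine ⟨Finset.univ.biUnion fun i => (finite_roots_cube p hp0 (s i) hk).toFinset,
    fun y hy hyJ v hv => ?_⟩
  obtain ⟨z, hz⟩ := exists_aeval_adCube_eq hk (p := p) hy fun i j h =>
    hyJ i j (Finset.mem_biUnion.2 ⟨i, Finset.mem_univ _, (Set.Finite.mem_toFinset _).2 h⟩)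
  have h3 := congrArg Subtype.val (LinearMap.congr_fun (hp z) ⟨v, hv⟩)
  change ⁅(aeval (adCube ε m s k) p z : gSum ε m s), v⁆ = 0 at h3
  rwa [hz] at h3

variable (U : LieSubmodule ℂ (DxHat ε) (Restrict (phiSum ε m s) V))

/-- Submodules over `𝒟̂_x^±` are invariant under all elements of nonzero degree: on a given vector,
such an element acts as the image of a differential operator. -/
theorem IsFiltered.lie_mem_of_mem_gradingSum (hF : IsFiltered (gradingSum ε m s) F)
    (hs : Admissible s) {k : ℤ} (hk : k ≠ 0) {x : gSum ε m s} (hx : x ∈ gradingSum ε m s k) {v : V}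
    (hv : Restrict.of (phiSum ε m s) V v ∈ U) : Restrict.of (phiSum ε m s) V ⁅x, v⁆ ∈ U := by
  obtain ⟨n, hn⟩ := hF.exhaustive v
  obtain ⟨J, hJ⟩ := hF.exists_finset hk n
  obtain ⟨g, hg, h⟩ := exists_opEl hs hk (fun i => x i) J
  have h0 := hJ (phiSum ε m s (opEl ε k g hg) - x) (sub_mem
    ((mem_gradingSum ε m s k _).2 fun i => phi_opEl_mem hk g hg) hx) (fun i j hj => by
      rw [DirectSum.sub_apply, mat_sub, gl.entry_sub, phiSum_apply, h i j hj, sub_self]) v hn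
  rw [sub_lie, sub_eq_zero] at h0
  rw [← h0, ← Restrict.lie_of]
  exact U.lie_mem hv

/-- The elements of the `i`-th summand which map `U` to itself. -/
def stabilizer (i : Fin N) : LieSubalgebra ℂ (gPM ε (m i) (s i)) where
  carrier := {x | ∀ v : V, Restrict.of (phiSum ε m s) V v ∈ U → Restrict.of (phiSum ε m s) V
    ⁅DirectSum.lieAlgebraOf ℂ (Fin N) (fun i => gPM ε (m i) (s i)) i x, v⁆ ∈ U}
  zero_mem' v _ := by rw [map_zero, zero_lie, map_zero]; exact U.zero_mem
  add_mem' {x y} hx hy v hv := by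
    rw [map_add, add_lie, map_add]; exact U.add_mem (hx v hv) (hy v hv)
  smul_mem' c x hx v hv := by
    rw [map_smul, smul_lie, map_smul]; exact U.smul_mem c (hx v hv)
  lie_mem' {x y} hx hy v hv := by
    rw [LieHom.map_lie, lie_lie, map_sub]; exact U.sub_mem (hx _ (hy v hv)) (hy _ (hx v hv))

theorem mem_stabilizer {i : Fin N} {x : gPM ε (m i) (s i)} : x ∈ stabilizer U i ↔
    ∀ v : V, Restrict.of (phiSum ε m s) V v ∈ U → Restrict.of (phiSum ε m s) V
      ⁅DirectSum.lieAlgebraOf ℂ (Fin N) (fun i => gPM ε (m i) (s i)) i x, v⁆ ∈ U := Iff.rfl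

theorem lieAlgebraOf_apply (i j : Fin N) (x : gPM ε (m i) (s i)) :
    DirectSum.lieAlgebraOf ℂ (Fin N) (fun i => gPM ε (m i) (s i)) i x j
      = (DirectSum.of (fun i => gPM ε (m i) (s i)) i x) j := rfl

theorem lieAlgebraOf_mem {k : ℤ} {i : Fin N} {x : gPM ε (m i) (s i)}
    (hx : x ∈ grading ε (m i) (s i) k) :
    DirectSum.lieAlgebraOf ℂ (Fin N) (fun i => gPM ε (m i) (s i)) i x ∈ gradingSum ε m s k := by
  refine (mem_gradingSum ε m s k _).2 fun j => ?_
  rw [lieAlgebraOf_apply]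
  by_cases h : i = j
  · subst h; rw [DirectSum.of_eq_same]; exact hx
  · rw [DirectSum.of_eq_of_ne _ _ _ (Ne.symm h)]; exact Submodule.zero_mem _

theorem sum_lieAlgebraOf (x : gSum ε m s) :
    ∑ i, DirectSum.lieAlgebraOf ℂ (Fin N) (fun i => gPM ε (m i) (s i)) i (x i) = x :=
  DirectSum.sum_univ_of x

theorem lie_mem_of_forall_mem_stabilizer {x : gSum ε m s} (hx : ∀ i, x i ∈ stabilizer U i) {v : V}
    (hv : Restrict.of (phiSum ε m s) V v ∈ U) : Restrict.of (phiSum ε m s) V ⁅x, v⁆ ∈ U := by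
  rw [← sum_lieAlgebraOf x, sum_lie, map_sum]
  exact sum_mem fun i _ => hx i v hv

theorem IsFiltered.mem_stabilizer_of_ne (hF : IsFiltered (gradingSum ε m s) F) (hs : Admissible s)
    (i : Fin N) (k : ℤ) (hk : k ≠ 0) (x : gPM ε (m i) (s i)) (hx : x ∈ grading ε (m i) (s i) k) :
    x ∈ stabilizer U i := fun _ hv =>
  hF.lie_mem_of_mem_gradingSum U hs hk (lieAlgebraOf_mem hx) hv

theorem IsFiltered.lie_mem_of_mem_derivedSeries (hF : IsFiltered (gradingSum ε m s) F)
    (hs : Admissible s) {x : gSum ε m s}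
    (hx : x ∈ LieAlgebra.derivedSeries ℂ (gSum ε m s) 1) {v : V}
    (hv : Restrict.of (phiSum ε m s) V v ∈ U) : Restrict.of (phiSum ε m s) V ⁅x, v⁆ ∈ U := by
  refine lie_mem_of_forall_mem_stabilizer U (fun i => ?_) hv
  rw [LieAlgebra.derivedSeries_def, LieAlgebra.derivedSeriesOfIdeal_succ,
    LieAlgebra.derivedSeriesOfIdeal_zero, ← LieSubmodule.mem_toSubmodule,
    LieSubmodule.lieIdeal_oper_eq_linear_span'] at hx
  induction hx using Submodule.span_induction with
  | mem x hx =>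
    obtain ⟨a, -, b, -, rfl⟩ := hx
    rw [DirectSum.bracket_apply]
    exact lie_mem_of_grading_le _ (hF.mem_stabilizer_of_ne U hs i) _ _
  | zero => exact (stabilizer U i).zero_mem
  | add x y _ _ hx hy => exact (stabilizer U i).add_mem hx hy
  | smul c x _ hx => exact (stabilizer U i).smul_mem c hx

theorem IsFiltered.mem_stabilizer (hF : IsFiltered (gradingSum ε m s) F)
    (hs : Admissible s) (hodd : ∀ z ∈ oddCentral ε m s, ∀ v : V,
      Restrict.of (phiSum ε m s) V v ∈ U → Restrict.of (phiSum ε m s) V ⁅z, v⁆ ∈ U)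
    (i : Fin N) (x : gPM ε (m i) (s i)) : x ∈ stabilizer U i :=
  mem_of_grading_le _ (hF.mem_stabilizer_of_ne U hs i)
    (fun hsi j hj hjm v hv => hodd _ ⟨i, j, hsi, hj, hjm, rfl⟩ v hv) x

end Filtered

section Graded

variable {L : Type*} [LieRing L] [LieAlgebra ℂ L] {𝔤 : ℤ → Submodule ℂ L}
  {V : Type*} [AddCommGroup V] [Module ℂ V] [LieRingModule L V] [LieModule ℂ L V]
  {𝒱 : ℤ → Submodule ℂ V}

/-- The sum of the graded pieces of degrees `-n, …, n`. -/
def bounded (𝒱 : ℤ → Submodule ℂ V) (n : ℕ) : Submodule ℂ V :=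
  ⨆ j ∈ Finset.Icc (-n : ℤ) n, 𝒱 j

theorem le_bounded {j : ℤ} {n : ℕ} (h : j.natAbs ≤ n) : 𝒱 j ≤ bounded 𝒱 n :=
  le_iSup₂_of_le (f := fun j (_ : j ∈ Finset.Icc (-n : ℤ) n) => 𝒱 j) j
    (Finset.mem_Icc.2 (by omega)) le_rfl

theorem bounded_mono {n n' : ℕ} (h : n ≤ n') : bounded 𝒱 n ≤ bounded 𝒱 n' :=
  iSup₂_le fun j hj => le_bounded (by rw [Finset.mem_Icc] at hj; omega)

theorem IsQuasifinite.isFiltered (h : IsQuasifinite 𝔤 𝒱) : IsFiltered 𝔤 (bounded 𝒱) where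
  finite n := by
    have := h.finite
    rw [bounded, ← Finset.sup_eq_iSup]
    exact Submodule.finite_finset_sup _ _
  exhaustive v := by
    have hv : v ∈ ⨆ j, 𝒱 j := by rw [h.isInternal.submodule_iSup_eq_top]; trivial
    induction hv using Submodule.iSup_induction' with
    | mem j x hx => exact ⟨j.natAbs, le_bounded le_rfl hx⟩
    | zero => exact ⟨0, Submodule.zero_mem _⟩
    | add x y _ _ hx hy =>
      obtain ⟨a, ha⟩ := hx
      obtain ⟨b, hb⟩ := hy
      exact ⟨max a b, Submodule.add_mem _ (bounded_mono (le_max_left a b) ha)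
        (bounded_mono (le_max_right a b) hb)⟩
  lie_mem k x hx n := by
    have : bounded 𝒱 n ≤ (bounded 𝒱 (n + k.natAbs)).comap (LieModule.toEnd ℂ L V x) := by
      refine iSup₂_le fun j hj v hv => le_bounded ?_ (h.lie_mem k j x v hx hv)
      rw [Finset.mem_Icc] at hj
      omega
    exact fun v hv => this hv

end Graded

/-! ### Irreducible highest weight modules -/

section HighestWeight

set_option linter.unusedSectionVars false

theorem eq_of_le_of_iSup_eq_top {V : Type*} [AddCommGroup V] [Module ℂ V]
    {A B : ℤ → Submodule ℂ V} (hAB : ∀ j, A j ≤ B j) (hB : iSupIndep B) (hA : ⨆ j, A j = ⊤)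
    (l : ℤ) : A l = B l := by
  refine le_antisymm (hAB l) fun x hx => ?_
  have hx' : x ∈ A l ⊔ ⨆ (j) (_ : j ≠ l), A j := by
    have : ⨆ j, A j ≤ A l ⊔ ⨆ (j) (_ : j ≠ l), A j := by
      refine iSup_le fun j => ?_
      by_cases h : j = l
      · subst h; exact le_sup_left
      · exact le_sup_of_le_right (le_iSup₂_of_le (f := fun j (_ : j ≠ l) => A j) j h le_rfl)
    exact this (by rw [hA]; trivial)
  obtain ⟨a, ha, b, hb, rfl⟩ := Submodule.mem_sup.1 hx'
  have hb1 : b ∈ B l := by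
    have := (B l).sub_mem hx (hAB l ha)
    rwa [add_sub_cancel_left] at this
  have hb2 : b ∈ ⨆ (j) (_ : j ≠ l), B j := iSup₂_mono (fun j _ => hAB j) hb
  have : b = 0 := (Submodule.disjoint_def.1 (hB l)) b hb1 hb2
  rw [this, add_zero]; exact ha

variable {L : Type*} [LieRing L] [LieAlgebra ℂ L] {𝔤 : ℤ → Submodule ℂ L}
  {V : Type*} [AddCommGroup V] [Module ℂ V] [LieRingModule L V] [LieModule ℂ L V]
  {𝒱 : ℤ → Submodule ℂ V}

/-- A subspace which contains a generator and is invariant under homogeneous elements is everything. -/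
theorem eq_top_of_lie_mem (h𝔤 : ⨆ k, 𝔤 k = ⊤) {v : V} (hv : LieSubmodule.lieSpan ℂ L {v} = ⊤)
    (M : Submodule ℂ V) (hvM : v ∈ M) (hM : ∀ k, ∀ x ∈ 𝔤 k, ∀ y ∈ M, ⁅x, y⁆ ∈ M) : M = ⊤ := by
  let W : LieSubmodule ℂ L V :=
    { M with
      lie_mem := fun {x y} hy => by
        have hx : x ∈ ⨆ k, 𝔤 k := by rw [h𝔤]; trivial
        induction hx using Submodule.iSup_induction' with
        | mem k x hx => exact hM k x hx y hy
        | zero => rw [zero_lie]; exact M.zero_mem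
        | add x x' _ _ h h' => rw [add_lie]; exact M.add_mem h h' }
  have hW : W = ⊤ := by
    rw [eq_top_iff, ← hv, LieSubmodule.lieSpan_le]
    exact Set.singleton_subset_iff.2 hvM
  refine eq_top_iff.2 fun x _ => ?_
  have : x ∈ W := by rw [hW]; trivial
  exact this

/-- The piece of degree `0` is spanned by the highest weight vector: the elements obtained from it by
elements of negative degree already form a submodule. -/
theorem degree_zero_le_span (h𝔤 : ⨆ k, 𝔤 k = ⊤) (hV : IsGradedModule 𝔤 𝒱) {v : V} (hv0 : v ∈ 𝒱 0)
    (hv : LieSubmodule.lieSpan ℂ L {v} = ⊤) (h0 : ∀ h ∈ 𝔤 0, ∃ c : ℂ, ⁅h, v⁆ = c • v)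
    (hpos : ∀ k > 0, ∀ x ∈ 𝔤 k, ⁅x, v⁆ = 0) : 𝒱 0 ≤ ℂ ∙ v := by
  -- The span of the vectors obtained from `v` by applying elements of negative degree repeatedly.
  let M : Submodule ℂ V :=
    sInf {P | v ∈ P ∧ ∀ k < 0, ∀ x ∈ 𝔤 k, ∀ y ∈ P, ⁅x, y⁆ ∈ P}
  have hvM : v ∈ M := Submodule.mem_sInf.2 fun P hP => hP.1
  have hneg : ∀ k < 0, ∀ x ∈ 𝔤 k, ∀ y ∈ M, ⁅x, y⁆ ∈ M := fun k hk x hx y hy =>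
    Submodule.mem_sInf.2 fun P hP => hP.2 k hk x hx y (Submodule.mem_sInf.1 hy P hP)
  have hind : ∀ P : Submodule ℂ V, v ∈ P → (∀ k < 0, ∀ x ∈ 𝔤 k, ∀ y ∈ P, ⁅x, y⁆ ∈ P) → M ≤ P :=
    fun P h1 h2 => sInf_le ⟨h1, h2⟩
  have hall : ∀ x : L, ⁅x, v⁆ ∈ M := by
    intro x
    have hx : x ∈ ⨆ k, 𝔤 k := by rw [h𝔤]; trivial
    induction hx using Submodule.iSup_induction' with
    | mem k x hx =>
      rcases lt_trichotomy k 0 with h | h | h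
      · exact hneg k h x hx v hvM
      · subst h
        obtain ⟨c, hc⟩ := h0 x hx
        rw [hc]; exact M.smul_mem c hvM
      · rw [hpos k h x hx]; exact M.zero_mem
    | zero => rw [zero_lie]; exact M.zero_mem
    | add x x' _ _ h h' => rw [add_lie]; exact M.add_mem h h'
  have hMlie : M ≤ M ⊓ ⨅ x : L, M.comap (LieModule.toEnd ℂ L V x) := by
    refine hind _ ⟨hvM, Submodule.mem_iInf _ |>.2 hall⟩ fun k hk z hz y hy => ?_
    have hy2 : ∀ x : L, ⁅x, y⁆ ∈ M := fun x => (Submodule.mem_iInf _).1 hy.2 x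
    refine ⟨hneg k hk z hz y hy.1, (Submodule.mem_iInf _).2 fun x => ?_⟩
    change ⁅x, ⁅z, y⁆⁆ ∈ M
    rw [leibniz_lie]
    exact M.add_mem (hy2 _) (hneg k hk z hz _ (hy2 x))
  have hMtop : M = ⊤ := eq_top_of_lie_mem h𝔤 hv M hvM fun k x _ y hy =>
    (Submodule.mem_iInf _).1 (hMlie hy).2 x
  let A : ℤ → Submodule ℂ V := fun j => if j = 0 then ℂ ∙ v else if j < 0 then 𝒱 j else ⊥
  have hA0 : A 0 = ℂ ∙ v := if_pos rfl
  have hAneg : ∀ j < 0, A j = 𝒱 j := fun j hj => by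
    change (if j = 0 then ℂ ∙ v else if j < 0 then 𝒱 j else ⊥) = _
    rw [if_neg (by omega), if_pos hj]
  have hAle : ∀ j, A j ≤ 𝒱 j := by
    intro j
    change (if j = 0 then ℂ ∙ v else if j < 0 then 𝒱 j else ⊥) ≤ _
    split_ifs with h h'
    · subst h; rw [Submodule.span_singleton_le_iff_mem]; exact hv0
    · exact le_rfl
    · exact bot_le
  have hAtop : ⨆ j, A j = ⊤ := by
    rw [eq_top_iff, ← hMtop]
    refine hind _ (Submodule.mem_iSup_of_mem 0 (hA0 ▸ Submodule.mem_span_singleton_self v))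
      fun k hk x hx y hy => ?_
    induction hy using Submodule.iSup_induction' with
    | mem j y hy =>
      by_cases hj : j ≤ 0
      · refine Submodule.mem_iSup_of_mem (k + j) ?_
        rw [hAneg _ (by omega)]
        exact hV.lie_mem k j x y hx (hAle j hy)
      · have : A j = ⊥ := by
          change (if j = 0 then ℂ ∙ v else if j < 0 then 𝒱 j else ⊥) = _
          rw [if_neg (by omega), if_neg (by omega)]
        rw [this, Submodule.mem_bot] at hy
        rw [hy, lie_zero]; exact Submodule.zero_mem _
    | zero => rw [lie_zero]; exact Submodule.zero_mem _
    | add y y' _ _ h h' => rw [lie_add]; exact Submodule.add_mem _ h h'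
  rw [← hA0, eq_of_le_of_iSup_eq_top hAle hV.isInternal.submodule_iSupIndep hAtop]

/-- An element `h` with `[h, x] = k x` for `x` of degree `k` acts on the piece of degree `j` of a
highest weight module by the scalar `μ + j`. -/
theorem degree_lie (h𝔤 : ⨆ k, 𝔤 k = ⊤) (hV : IsGradedModule 𝔤 𝒱) {v : V} (hv0 : v ∈ 𝒱 0)
    (hv : LieSubmodule.lieSpan ℂ L {v} = ⊤) {h : L}
    (hh : ∀ k, ∀ x ∈ 𝔤 k, ⁅h, x⁆ = (k : ℂ) • x) {μ : ℂ} (hμ : ⁅h, v⁆ = μ • v)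
    {j : ℤ} {x : V} (hx : x ∈ 𝒱 j) : ⁅h, x⁆ = (μ + j) • x := by
  let E : ℤ → Submodule ℂ V := fun j =>
    𝒱 j ⊓ LinearMap.ker (LieModule.toEnd ℂ L V h - algebraMap ℂ (Module.End ℂ V) (μ + j))
  have hE : ∀ {j x}, x ∈ E j ↔ x ∈ 𝒱 j ∧ ⁅h, x⁆ = (μ + j) • x := by
    intro j x
    refine and_congr Iff.rfl ?_
    rw [SetLike.mem_coe, LinearMap.mem_ker, LinearMap.sub_apply, Module.algebraMap_end_apply, sub_eq_zero]
    rfl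
  have htop : ⨆ j, E j = ⊤ := by
    refine eq_top_of_lie_mem h𝔤 hv _ (Submodule.mem_iSup_of_mem 0 (hE.2 ⟨hv0, by
      rw [hμ, Int.cast_zero, add_zero]⟩)) fun k x hx y hy => ?_
    induction hy using Submodule.iSup_induction' with
    | mem j y hy =>
      refine Submodule.mem_iSup_of_mem (k + j) (hE.2 ⟨hV.lie_mem k j x y hx (hE.1 hy).1, ?_⟩)
      rw [leibniz_lie, hh k x hx, (hE.1 hy).2, smul_lie, lie_smul, ← add_smul]
      congr 1; push_cast; ring
    | zero => rw [lie_zero]; exact Submodule.zero_mem _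
    | add y y' _ _ h h' => rw [lie_add]; exact Submodule.add_mem _ h h'
  rw [← eq_of_le_of_iSup_eq_top (fun j => inf_le_left) hV.isInternal.submodule_iSupIndep htop j]
    at hx
  exact (hE.1 hx).2

/-- The polynomial in an operator `H` which projects to the piece of degree `l` within the sum of the
pieces of degrees `-n, …, n`, if `H` is the scalar `μ + j` in degree `j`. -/
def projPoly (μ : ℂ) (n : ℕ) (l : ℤ) : ℂ[X] :=
  Lagrange.basis (Finset.Icc (-n : ℤ) n) (fun j : ℤ => μ + j) l

theorem aeval_projPoly {H : Module.End ℂ V} {μ : ℂ}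
    (hH : ∀ j, ∀ x ∈ 𝒱 j, H x = (μ + j) • x) {n : ℕ} {j l : ℤ}
    (hj : j ∈ Finset.Icc (-n : ℤ) n) (hl : l ∈ Finset.Icc (-n : ℤ) n) {x : V} (hx : x ∈ 𝒱 j) :
    aeval H (projPoly μ n l) x = if l = j then x else 0 := by
  rw [Module.End.aeval_apply_of_mem_apply_eq_smul (hH j x hx), projPoly]
  split_ifs with h
  · subst h
    rw [Lagrange.eval_basis_self (v := fun j : ℤ => μ + j) (fun a _ b _ hab => by simpa using hab) hl,
      one_smul]
  · rw [Lagrange.eval_basis_of_ne (v := fun j : ℤ => μ + j) h hj, zero_smul]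

theorem aeval_projPoly_mem {H : Module.End ℂ V} {μ : ℂ}
    (hH : ∀ j, ∀ x ∈ 𝒱 j, H x = (μ + j) • x) {n : ℕ} {l : ℤ} (hl : l ∈ Finset.Icc (-n : ℤ) n)
    {x : V} (hx : x ∈ bounded 𝒱 n) : aeval H (projPoly μ n l) x ∈ 𝒱 l := by
  have : bounded 𝒱 n ≤ (𝒱 l).comap (aeval H (projPoly μ n l)) := by
    refine iSup₂_le fun j hj y hy => ?_
    rw [Submodule.mem_comap, aeval_projPoly hH hj hl hy]
    split_ifs with h
    · exact h ▸ hy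
    · exact Submodule.zero_mem _
  exact this hx

theorem sum_aeval_projPoly {H : Module.End ℂ V} {μ : ℂ}
    (hH : ∀ j, ∀ x ∈ 𝒱 j, H x = (μ + j) • x) {n : ℕ}
    {x : V} (hx : x ∈ bounded 𝒱 n) :
    ∑ l ∈ Finset.Icc (-n : ℤ) n, aeval H (projPoly μ n l) x = x := by
  have : bounded 𝒱 n ≤ LinearMap.eqLocus
      (∑ l ∈ Finset.Icc (-n : ℤ) n, aeval H (projPoly μ n l)) LinearMap.id := by
    refine iSup₂_le fun j hj y hy => ?_
    rw [LinearMap.mem_eqLocus, LinearMap.sum_apply, LinearMap.id_apply]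
    rw [Finset.sum_congr rfl fun l hl => aeval_projPoly hH hj hl hy, Finset.sum_ite_eq' _ j,
      if_pos hj]
  have h := LinearMap.mem_eqLocus.1 (this hx)
  rwa [LinearMap.sum_apply, LinearMap.id_apply] at h

/-- In an irreducible highest weight module over a Lie algebra whose degree operator is inner, any
algebra of operators containing the Lie algebra maps any nonzero vector to the highest weight vector
`v`, and contains an operator agreeing with the projection `x ↦ π(x) v` on any given piece
`bounded 𝒱 n` of the filtration. -/
theorem IsIrreducibleHighestWeight.exists_projection (h𝔤 : ⨆ k, 𝔤 k = ⊤) {h : L} (h0 : h ∈ 𝔤 0)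
    (hh : ∀ k, ∀ x ∈ 𝔤 k, ⁅h, x⁆ = (k : ℂ) • x) {lam : Module.Dual ℂ (𝔤 0)}
    (hV : IsIrreducibleHighestWeight 𝔤 lam 𝒱) (hex : ∀ v, ∃ n, v ∈ bounded 𝒱 n) :
    ∃ (v : V) (π : V →ₗ[ℂ] ℂ), π v = 1 ∧ LieSubmodule.lieSpan ℂ L {v} = ⊤ ∧
      (∀ h : 𝔤 0, ⁅(h : L), v⁆ = lam h • v) ∧
      ∀ A : Subalgebra ℂ (Module.End ℂ V), (∀ x, LieModule.toEnd ℂ L V x ∈ A) →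
        (∀ w ≠ 0, ∃ a ∈ A, a w = v) ∧ ∀ n, ∃ a ∈ A, ∀ x ∈ bounded 𝒱 n, a x = π x • v := by
  obtain ⟨v, hv0, hvne, hlam, hpos, hv⟩ := hV.exists_vector
  have hV' := hV.toIsGradedModule
  have hind := hV'.isInternal.submodule_iSupIndep
  have hspan : 𝒱 0 ≤ ℂ ∙ v :=
    degree_zero_le_span h𝔤 hV' hv0 hv (fun x hx => ⟨_, hlam ⟨x, hx⟩⟩) hpos
  set H : Module.End ℂ V := LieModule.toEnd ℂ L V h with hH'
  set μ : ℂ := lam ⟨h, h0⟩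
  have hH : ∀ j, ∀ x ∈ 𝒱 j, H x = (μ + j) • x := fun j x hx =>
    degree_lie h𝔤 hV' hv0 hv hh (hlam ⟨h, h0⟩) hx
  have hvn : v ∉ ⨆ (j) (_ : j ≠ 0), 𝒱 j := fun h =>
    hvne ((Submodule.disjoint_def.1 (hind 0)) v hv0 h)
  obtain ⟨f, hf, hfk⟩ := Submodule.exists_le_ker_of_notMem hvn
  refine ⟨v, (f v)⁻¹ • f, inv_mul_cancel₀ hf, hv, hlam, fun A hA => ⟨fun w hw => ?_, fun n => ?_⟩⟩
  · let M : LieSubmodule ℂ L V :=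
      { (Subalgebra.toSubmodule A).map (LinearMap.applyₗ w) with
        lie_mem := by
          rintro x _ ⟨a, ha, rfl⟩
          exact ⟨LieModule.toEnd ℂ L V x * a, A.mul_mem (hA x) ha, rfl⟩ }
    have hM : ∀ y, y ∈ M ↔ ∃ a ∈ A, a w = y := fun y => Iff.rfl
    have hpoly : ∀ p, aeval H p ∈ A := fun p => by
      have := Polynomial.aeval_mem_adjoin_singleton ℂ (p := p) H
      exact (Algebra.adjoin_le (Set.singleton_subset_iff.2 (hA h))) this
    have hgr : (M : Submodule ℂ V) = ⨆ j, (M : Submodule ℂ V) ⊓ 𝒱 j := by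
      refine le_antisymm (fun y hy => ?_) (iSup_le fun j => inf_le_left)
      obtain ⟨n, hn⟩ := hex y
      rw [← sum_aeval_projPoly hH hn]
      obtain ⟨a, ha, rfl⟩ := (hM y).1 hy
      exact Submodule.sum_mem _ fun l hl => Submodule.mem_iSup_of_mem l
        ⟨(hM _).2 ⟨aeval H (projPoly μ n l) * a, A.mul_mem (hpoly _) ha, rfl⟩,
          aeval_projPoly_mem hH hl hn⟩
    rcases hV.irreducible M hgr with h | h
    · refine absurd ?_ hw
      have : w ∈ M := (hM w).2 ⟨1, A.one_mem, rfl⟩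
      rwa [h, LieSubmodule.mem_bot] at this
    · exact (hM v).1 (by rw [h]; trivial)
  · have hpoly : aeval H (projPoly μ n 0) ∈ A := by
      have := Polynomial.aeval_mem_adjoin_singleton ℂ (p := projPoly μ n 0) H
      exact (Algebra.adjoin_le (Set.singleton_subset_iff.2 (hA h))) this
    refine ⟨_, hpoly, fun x hx => ?_⟩
    have : bounded 𝒱 n ≤ LinearMap.eqLocus (aeval H (projPoly μ n 0))
        (((f v)⁻¹ • f).smulRight v) := by
      refine iSup₂_le fun j hj y hy => ?_
      rw [LinearMap.mem_eqLocus, aeval_projPoly hH hj (Finset.mem_Icc.2 (by omega)) hy,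
        LinearMap.smulRight_apply]
      split_ifs with h
      · subst h
        obtain ⟨c, rfl⟩ := Submodule.mem_span_singleton.1 (hspan hy)
        rw [LinearMap.smul_apply, map_smul, smul_eq_mul, smul_eq_mul, mul_left_comm,
          inv_mul_cancel₀ hf, mul_one]
      · have : f y = 0 := hfk (le_iSup₂_of_le (f := fun j (_ : j ≠ 0) => 𝒱 j) j (Ne.symm h) le_rfl hy)
        rw [LinearMap.smul_apply, this, smul_zero, zero_smul]
    exact LinearMap.mem_eqLocus.1 (this hx)

end HighestWeight

/-! ### Tensor products -/

section TensorProducts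

variable {N : ℕ} {A : Fin N → Type*} [∀ i, LieRing (A i)] [∀ i, LieAlgebra ℂ (A i)]
  {V : Fin N → Type*} [∀ i, AddCommGroup (V i)] [∀ i, Module ℂ (V i)]

theorem tensorOp_one (i : Fin N) : tensorOp V i 1 = 1 :=
  TensorModule.hom_ext V fun v => by simp [tensorOp_tprod]

/-- The span of the pure tensors with factors in given subspaces. -/
def tensorSpan (F : ∀ i, Submodule ℂ (V i)) : Submodule ℂ (TensorModule V) :=
  Submodule.span ℂ (TensorModule.tprod V '' {v | ∀ i, v i ∈ F i})

theorem tprod_mem_tensorSpan {F : ∀ i, Submodule ℂ (V i)} {v : ∀ i, V i} (h : ∀ i, v i ∈ F i) :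
    TensorModule.tprod V v ∈ tensorSpan F := Submodule.subset_span ⟨v, h, rfl⟩

theorem tensorSpan_mono {F F' : ∀ i, Submodule ℂ (V i)} (h : ∀ i, F i ≤ F' i) :
    tensorSpan F ≤ tensorSpan F' :=
  Submodule.span_mono (Set.image_mono fun _ hv i => h i (hv i))

theorem tensorSpan_top : tensorSpan (fun i => (⊤ : Submodule ℂ (V i))) = ⊤ := by
  rw [eq_top_iff]
  refine le_trans (PiTensorProduct.span_tprod_eq_top (R := ℂ) (s := V)).ge ?_
  refine Submodule.span_mono ?_
  rintro _ ⟨v, rfl⟩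
  exact ⟨v, fun i => trivial, rfl⟩

theorem finite_tensorSpan (F : ∀ i, Submodule ℂ (V i)) [∀ i, Module.Finite ℂ (F i)] :
    Module.Finite ℂ (tensorSpan F) := by
  have hfin : Module.Finite ℂ (⨂[ℂ] i, F i) :=
    Module.Finite.of_basis (Basis.piTensorProduct fun i => Module.finBasis ℂ (F i))
  let g : (⨂[ℂ] i, F i) →ₗ[ℂ] TensorModule V := PiTensorProduct.map fun i => (F i).subtype
  have hle : tensorSpan F ≤ LinearMap.range g := by
    refine Submodule.span_le.2 ?_
    rintro _ ⟨v, hv, rfl⟩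
    exact ⟨PiTensorProduct.tprod ℂ fun i => (⟨v i, hv i⟩ : F i), PiTensorProduct.map_tprod _ _⟩
  exact Submodule.finiteDimensional_of_le hle

theorem exists_mem_tensorSpan {F : ∀ i, ℕ → Submodule ℂ (V i)} (hF : ∀ i, Monotone (F i))
    (hex : ∀ i v, ∃ n, v ∈ F i n) (t : TensorModule V) : ∃ n, t ∈ tensorSpan fun i => F i n := by
  have ht : t ∈ tensorSpan (fun i => (⊤ : Submodule ℂ (V i))) := by rw [tensorSpan_top]; trivial
  induction ht using Submodule.span_induction with
  | mem t ht =>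
    obtain ⟨v, -, rfl⟩ := ht
    choose n hn using fun i => hex i (v i)
    exact ⟨Finset.univ.sup n, tprod_mem_tensorSpan fun i =>
      hF i (Finset.le_sup (Finset.mem_univ i)) (hn i)⟩
  | zero => exact ⟨0, Submodule.zero_mem _⟩
  | add x y _ _ hx hy =>
    obtain ⟨a, ha⟩ := hx
    obtain ⟨b, hb⟩ := hy
    exact ⟨max a b, Submodule.add_mem _ (tensorSpan_mono (fun i => hF i (le_max_left a b)) ha)
      (tensorSpan_mono (fun i => hF i (le_max_right a b)) hb)⟩
  | smul c x _ hx =>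
    obtain ⟨a, ha⟩ := hx
    exact ⟨a, Submodule.smul_mem _ c ha⟩

theorem tensorOp_congr {i : Fin N} {F : ∀ i, Submodule ℂ (V i)} {f g : Module.End ℂ (V i)}
    (h : ∀ x ∈ F i, f x = g x) {t : TensorModule V} (ht : t ∈ tensorSpan F) :
    tensorOp V i f t = tensorOp V i g t := by
  induction ht using Submodule.span_induction with
  | mem t ht =>
    obtain ⟨v, hv, rfl⟩ := ht
    rw [tensorOp_tprod, tensorOp_tprod, h _ (hv i)]
  | zero => rw [map_zero, map_zero]
  | add x y _ _ hx hy => rw [map_add, map_add, hx, hy]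
  | smul c x _ hx => rw [map_smul, map_smul, hx]

theorem tprod_update_smul (v : ∀ i, V i) (i : Fin N) (c : ℂ) (x : V i) :
    TensorModule.tprod V (Function.update v i (c • x))
      = c • TensorModule.tprod V (Function.update v i x) :=
  (PiTensorProduct.tprod ℂ).map_update_smul v i c x

theorem tprod_update_add (v : ∀ i, V i) (i : Fin N) (x y : V i) :
    TensorModule.tprod V (Function.update v i (x + y))
      = TensorModule.tprod V (Function.update v i x)
        + TensorModule.tprod V (Function.update v i y) :=
  (PiTensorProduct.tprod ℂ).map_update_add v i x y

theorem tprod_ne_zero {v : ∀ i, V i} (π : ∀ i, V i →ₗ[ℂ] ℂ) (h : ∀ i, π i (v i) = 1) :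
    TensorModule.tprod V v ≠ 0 := by
  intro h0
  have h1 : PiTensorProduct.lift ((MultilinearMap.mkPiAlgebra ℂ (Fin N) ℂ).compLinearMap π)
      (PiTensorProduct.tprod ℂ v) = 0 := (congrArg _ h0).trans (map_zero _)
  rw [PiTensorProduct.lift.tprod] at h1
  simp [h] at h1

/-- Contraction of all factors but one by suitable linear forms detects nonzero tensors. -/
theorem exists_contraction (i : Fin N) {t : TensorModule V} (ht : t ≠ 0) :
    ∃ c : TensorModule V →ₗ[ℂ] V i, c t ≠ 0 ∧ ∀ (f : Module.End ℂ (V i)) t',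
      c (tensorOp V i f t') = f (c t') := by
  let b := fun i => Module.Basis.ofVectorSpace ℂ (V i)
  let B : Module.Basis _ ℂ (TensorModule V) := Basis.piTensorProduct b
  obtain ⟨p, hp⟩ : ∃ p, B.repr t p ≠ 0 := by
    by_contra! h
    exact ht (B.repr.map_eq_zero_iff.1 (Finsupp.ext h))
  let c : TensorModule V →ₗ[ℂ] V i := (b i).repr.symm.toLinearMap ∘ₗ
    Finsupp.lcomapDomain (Function.update p i) (Function.update_injective p i) ∘ₗ
    B.repr.toLinearMap
  have hc : ∀ t q, (b i).repr (c t) q = B.repr t (Function.update p i q) := by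
    intro t q
    change (b i).repr ((b i).repr.symm _) q = _
    rw [LinearEquiv.apply_symm_apply]
    rfl
  have hct : ∀ v, c (TensorModule.tprod V v)
      = (∏ j ∈ Finset.univ.erase i, (b j).repr (v j) (p j)) • v i := by
    intro v
    refine (b i).ext_elem fun q => ?_
    rw [hc, map_smul, Finsupp.smul_apply, smul_eq_mul]
    refine (Basis.piTensorProduct_repr_tprod_apply b v _).trans ?_
    rw [← Finset.mul_prod_erase _ _ (Finset.mem_univ i), Function.update_self, mul_comm]
    congr 1
    refine Finset.prod_congr rfl fun j hj => ?_
    rw [Function.update_of_ne (Finset.ne_of_mem_erase hj)]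
  refine ⟨c, fun h => hp ?_, fun f t' => ?_⟩
  · rw [← Function.update_eq_self i p, ← hc, h, map_zero, Finsupp.zero_apply]
  · have : c ∘ₗ tensorOp V i f = f ∘ₗ c := by
      refine PiTensorProduct.ext (MultilinearMap.ext fun v => ?_)
      change c (tensorOp V i f (TensorModule.tprod V v)) = f (c (TensorModule.tprod V v))
      rw [tensorOp_tprod, hct, hct, map_smul, Function.update_self]
      congr 1
      refine Finset.prod_congr rfl fun j hj => ?_
      rw [Function.update_of_ne (Finset.ne_of_mem_erase hj)]
    exact LinearMap.congr_fun this t'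

/-- The operators on the `i`-th factor which map `U` to itself. -/
def opStabilizer (U : Submodule ℂ (TensorModule V)) (i : Fin N) :
    Subalgebra ℂ (Module.End ℂ (V i)) where
  carrier := {a | ∀ t ∈ U, tensorOp V i a t ∈ U}
  mul_mem' {a b} ha hb t ht := by
    rw [tensorOp_mul]; exact ha _ (hb t ht)
  one_mem' t ht := by rw [tensorOp_one]; exact ht
  add_mem' {a b} ha hb t ht := by
    rw [map_add]; exact U.add_mem (ha t ht) (hb t ht)
  zero_mem' t _ := by rw [map_zero]; exact U.zero_mem
  algebraMap_mem' c t ht := by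
    rw [Algebra.algebraMap_eq_smul_one, map_smul, tensorOp_one]; exact U.smul_mem c ht

/-- A nonzero subspace of a tensor product contains the pure tensor of the vectors `v_i`, if for every
`i` it is invariant under sufficiently many operators on the `i`-th factor: enough to map every
nonzero vector to `v_i`, and to approximate the projection `x ↦ π_i(x) v_i`. -/
theorem tprod_mem_of_projection {U : Submodule ℂ (TensorModule V)} (hU : U ≠ ⊥)
    {F : ∀ i, ℕ → Submodule ℂ (V i)} (hF : ∀ i, Monotone (F i)) (hex : ∀ i v, ∃ n, v ∈ F i n)
    (v : ∀ i, V i) (π : ∀ i, V i →ₗ[ℂ] ℂ) (hπ : ∀ i, π i (v i) = 1)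
    (h1 : ∀ i, ∀ w ≠ 0, ∃ a ∈ opStabilizer U i, a w = v i)
    (h2 : ∀ i n, ∃ a ∈ opStabilizer U i, ∀ x ∈ F i n, a x = π i x • v i) :
    TensorModule.tprod V v ∈ U := by
  let e : ∀ i, Module.End ℂ (V i) := fun i => (π i).smulRight (v i)
  have hev : ∀ i, e i (v i) = v i := fun i => by
    change π i (v i) • v i = v i
    rw [hπ, one_smul]
  have hee : ∀ i, e i * e i = e i := fun i => LinearMap.ext fun x => by
    change e i (π i x • v i) = π i x • v i
    rw [map_smul, hev]
  -- The projections in different factors commute, so they can be made to fix `w` one after another.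
  have key : ∀ S : Finset (Fin N), ∃ w ∈ U, w ≠ 0 ∧ ∀ i ∈ S, tensorOp V i (e i) w = w := by
    intro S
    induction S using Finset.induction_on with
    | empty =>
      obtain ⟨w, hw, hw0⟩ := (Submodule.ne_bot_iff U).1 hU
      exact ⟨w, hw, hw0, fun i hi => absurd hi (Finset.notMem_empty i)⟩
    | insert i S hi ih =>
      obtain ⟨w, hw, hw0, hwS⟩ := ih
      obtain ⟨c, hcw, hc⟩ := exists_contraction i hw0
      obtain ⟨a, ha, haw⟩ := h1 i _ hcw
      obtain ⟨n, hn⟩ := exists_mem_tensorSpan hF hex (tensorOp V i a w)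
      obtain ⟨a', ha', haw'⟩ := h2 i n
      have hEq : tensorOp V i a' (tensorOp V i a w) = tensorOp V i (e i) (tensorOp V i a w) :=
        tensorOp_congr (fun x hx => haw' x hx) hn
      refine ⟨tensorOp V i (e i) (tensorOp V i a w), hEq ▸ ha' _ (ha _ hw), fun h0 => ?_,
        fun j hj => ?_⟩
      · have h3 := hc (e i) (tensorOp V i a w)
        rw [h0, map_zero, hc, haw, hev] at h3
        have h4 := hπ i
        rw [← h3, map_zero] at h4
        exact zero_ne_one h4
      · rcases Finset.mem_insert.1 hj with rfl | hj
        · rw [← Module.End.mul_apply, ← tensorOp_mul, hee]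
        · have hij : j ≠ i := fun h => hi (h ▸ hj)
          rw [← Module.End.mul_apply, tensorOp_commute V hij, Module.End.mul_apply,
            ← Module.End.mul_apply (tensorOp V j (e j)), tensorOp_commute V hij,
            Module.End.mul_apply, hwS j hj]
  obtain ⟨w, hw, hw0, hwe⟩ := key Finset.univ
  have hspan : ∀ S : Finset (Fin N),
      w ∈ Submodule.span ℂ (TensorModule.tprod V '' {x | ∀ i ∈ S, x i = v i}) := by
    intro S
    induction S using Finset.induction_on with
    | empty =>
      have : w ∈ tensorSpan (fun i => (⊤ : Submodule ℂ (V i))) := by rw [tensorSpan_top]; trivial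
      exact Submodule.span_mono (Set.image_mono fun x _ i hi => absurd hi (Finset.notMem_empty i))
        this
    | insert i S hi ih =>
      rw [← hwe i (Finset.mem_univ i)]
      have hle : Submodule.span ℂ (TensorModule.tprod V '' {x | ∀ i ∈ S, x i = v i}) ≤
          (Submodule.span ℂ (TensorModule.tprod V '' {x | ∀ j ∈ insert i S, x j = v j})).comap
            (tensorOp V i (e i)) := by
        refine Submodule.span_le.2 ?_
        rintro _ ⟨x, hx, rfl⟩
        rw [SetLike.mem_coe, Submodule.mem_comap, tensorOp_tprod]
        change TensorModule.tprod V (Function.update x i (π i (x i) • v i)) ∈ _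
        rw [tprod_update_smul]
        refine Submodule.smul_mem _ _ (Submodule.subset_span ⟨_, fun j hj => ?_, rfl⟩)
        by_cases hji : j = i
        · subst hji; rw [Function.update_self]
        · rw [Function.update_of_ne hji]
          exact hx j ((Finset.mem_insert.1 hj).resolve_left hji)
      exact hle ih
  have hw2 : w ∈ ℂ ∙ TensorModule.tprod V v := by
    refine Submodule.span_mono ?_ (hspan Finset.univ)
    rintro _ ⟨x, hx, rfl⟩
    rw [Set.mem_singleton_iff]
    congr 1
    exact funext fun i => hx i (Finset.mem_univ i)
  obtain ⟨c, rfl⟩ := Submodule.mem_span_singleton.1 hw2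
  have hc : c ≠ 0 := fun h => hw0 (by rw [h, zero_smul])
  have := U.smul_mem c⁻¹ hw
  rwa [smul_smul, inv_mul_cancel₀ hc, one_smul] at this

variable [∀ i, LieRingModule (A i) (V i)] [∀ i, LieModule ℂ (A i) (V i)]

/-- The tensor product is generated by the pure tensor of generators. -/
theorem eq_top_of_tprod_mem {U : Submodule ℂ (TensorModule V)}
    (hU : ∀ i (x : A i), LieModule.toEnd ℂ (A i) (V i) x ∈ opStabilizer U i) {v : ∀ i, V i}
    (hv : ∀ i, LieSubmodule.lieSpan ℂ (A i) {v i} = ⊤) (h : TensorModule.tprod V v ∈ U) :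
    U = ⊤ := by
  have key : ∀ S : Finset (Fin N), ∀ x : ∀ i, V i, (∀ i ∉ S, x i = v i) →
      TensorModule.tprod V x ∈ U := by
    intro S
    induction S using Finset.induction_on with
    | empty =>
      intro x hx
      rwa [show x = v from funext fun i => hx i (Finset.notMem_empty i)]
    | insert i S hi ih =>
      intro x hx
      let W : LieSubmodule ℂ (A i) (V i) :=
        { carrier := {y | TensorModule.tprod V (Function.update x i y) ∈ U}
          zero_mem' := by
            have := tprod_update_smul x i 0 0
            rw [zero_smul, zero_smul] at this
            rw [Set.mem_ofPred_eq, this]; exact U.zero_mem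
          add_mem' := fun {y z} hy hz => by
            rw [Set.mem_ofPred_eq, tprod_update_add]; exact U.add_mem hy hz
          smul_mem' := fun c y hy => by
            rw [Set.mem_ofPred_eq, tprod_update_smul]; exact U.smul_mem c hy
          lie_mem := fun {a y} hy => by
            have := hU i a _ hy
            rw [tensorOp_tprod, Function.update_self, Function.update_idem] at this
            exact this }
      have hW : W = ⊤ := by
        rw [eq_top_iff, ← hv i, LieSubmodule.lieSpan_le]
        refine Set.singleton_subset_iff.2 (ih _ fun j hj => ?_)
        by_cases hji : j = i
        · subst hji; rw [Function.update_self]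
        · rw [Function.update_of_ne hji]
          exact hx j fun h => hj ((Finset.mem_insert.1 h).resolve_left hji)
      have : x i ∈ W := by rw [hW]; trivial
      have h2 : TensorModule.tprod V (Function.update x i (x i)) ∈ U := this
      rwa [Function.update_eq_self] at h2
  rw [eq_top_iff, ← tensorSpan_top]
  refine Submodule.span_le.2 ?_
  rintro _ ⟨x, -, rfl⟩
  exact key Finset.univ x fun i hi => absurd (Finset.mem_univ i) hi

/-- A nonzero invariant subspace of the tensor product is everything: it contains the pure tensor of the
generators `v_i`, and this tensor generates. -/
theorem eq_top_of_projection {U : Submodule ℂ (TensorModule V)} (hU : U ≠ ⊥)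
    (hst : ∀ i (x : A i), LieModule.toEnd ℂ (A i) (V i) x ∈ opStabilizer U i)
    {F : ∀ i, ℕ → Submodule ℂ (V i)} (hF : ∀ i, Monotone (F i)) (hex : ∀ i v, ∃ n, v ∈ F i n)
    {v : ∀ i, V i} {π : ∀ i, V i →ₗ[ℂ] ℂ} (hπ : ∀ i, π i (v i) = 1)
    (hv : ∀ i, LieSubmodule.lieSpan ℂ (A i) {v i} = ⊤)
    (hproj : ∀ i, ∀ S : Subalgebra ℂ (Module.End ℂ (V i)),
      (∀ x, LieModule.toEnd ℂ (A i) (V i) x ∈ S) →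
        (∀ w ≠ 0, ∃ a ∈ S, a w = v i) ∧ ∀ n, ∃ a ∈ S, ∀ x ∈ F i n, a x = π i x • v i) :
    U = ⊤ :=
  eq_top_of_tprod_mem hst hv (tprod_mem_of_projection hU hF hex v π hπ
    (fun i => (hproj i _ (hst i)).1) fun i => (hproj i _ (hst i)).2)

theorem lie_mem_tensorSpan {F F' : ∀ i, Submodule ℂ (V i)} (hF : ∀ i, F i ≤ F' i)
    {x : ⨁ i, A i} (hx : ∀ i, ∀ v ∈ F i, ⁅x i, v⁆ ∈ F' i) {t : TensorModule V}
    (ht : t ∈ tensorSpan F) : ⁅x, t⁆ ∈ tensorSpan F' := by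
  induction ht using Submodule.span_induction with
  | mem t ht =>
    obtain ⟨v, hv, rfl⟩ := ht
    change (∑ i, tensorOp V i (LieModule.toEnd ℂ _ (V i) (x i))) (TensorModule.tprod V v) ∈ _
    rw [LinearMap.sum_apply]
    refine Submodule.sum_mem _ fun i _ => ?_
    rw [tensorOp_tprod]
    refine tprod_mem_tensorSpan fun j => ?_
    by_cases hji : j = i
    · subst hji
      rw [Function.update_self]
      exact hx j _ (hv j)
    · rw [Function.update_of_ne hji]
      exact hF j (hv j)
  | zero => rw [lie_zero]; exact Submodule.zero_mem _
  | add x y _ _ hx hy => rw [lie_add]; exact Submodule.add_mem _ hx hy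
  | smul c x _ hx => rw [lie_smul]; exact Submodule.smul_mem _ c hx

theorem lieAlgebraOf_lie_tensor (i : Fin N) (x : A i) (t : TensorModule V) :
    ⁅DirectSum.lieAlgebraOf ℂ (Fin N) A i x, t⁆
      = tensorOp V i (LieModule.toEnd ℂ _ (V i) x) t := by
  change (∑ j, tensorOp V j (LieModule.toEnd ℂ _ (V j) (DirectSum.of A i x j))) t = _
  rw [LinearMap.sum_apply, Finset.sum_eq_single i]
  · rw [DirectSum.of_eq_same]
  · intro j _ hj
    rw [DirectSum.of_eq_of_ne _ _ _ hj, map_zero, map_zero]; rfl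
  · exact fun h => absurd (Finset.mem_univ i) h

theorem lof_lie_tensor_of_scalar {i : Fin N} {x : A i} {c : ℂ}
    (h : ∀ v : V i, ⁅x, v⁆ = c • v) (t : TensorModule V) :
    ⁅DirectSum.lof ℂ (Fin N) A i x, t⁆ = c • t := by
  have : LieModule.toEnd ℂ (A i) (V i) x = c • 1 := LinearMap.ext h
  refine (lieAlgebraOf_lie_tensor i x t).trans ?_
  rw [this, map_smul, tensorOp_one]
  rfl

/-- The tensor products of the steps of filtrations of the factors form a filtration. -/
theorem IsFiltered.tensorSpan {𝔤 : ∀ i, ℤ → Submodule ℂ (A i)} {𝔥 : ℤ → Submodule ℂ (⨁ i, A i)}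
    (h𝔥 : ∀ k, ∀ x ∈ 𝔥 k, ∀ i, x i ∈ 𝔤 i k) {F : ∀ i, ℕ → Submodule ℂ (V i)}
    (hF : ∀ i, Monotone (F i)) (h : ∀ i, IsFiltered (𝔤 i) (F i)) :
    IsFiltered 𝔥 (V := TensorModule V) fun n => WInf.tensorSpan fun i => F i n where
  finite n := by
    have := fun i => (h i).finite n
    exact finite_tensorSpan _
  exhaustive := exists_mem_tensorSpan hF fun i => (h i).exhaustive
  lie_mem k x hx n _ ht := lie_mem_tensorSpan (fun i => hF i (Nat.le_add_right _ _))
    (fun i v hv => (h i).lie_mem k _ (h𝔥 k x hx i) n v hv) ht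

end TensorProducts

/-! ### Irreducibility of the tensor product -/

section Final

variable {N : ℕ} {ε : ℤˣ} {m : Fin N → ℕ} {s : Fin N → ℂ}
  {L : Fin N → Type*} [∀ i, AddCommGroup (L i)] [∀ i, Module ℂ (L i)]
  [∀ i, LieRingModule (gPM ε (m i) (s i)) (L i)]
  [∀ i, LieModule ℂ (gPM ε (m i) (s i)) (L i)]
  {𝓛 : ∀ i, ℤ → Submodule ℂ (L i)}

/-- A central element which acts on a generator by a scalar acts by this scalar. -/
theorem central_lie_eq_smul {m : ℕ} {s : ℂ} {V : Type*} [AddCommGroup V] [Module ℂ V]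
    [LieRingModule (gPM ε m s) V] [LieModule ℂ (gPM ε m s) V] {v : V}
    (hv : LieSubmodule.lieSpan ℂ (gPM ε m s) {v} = ⊤) {a : Rm m} {c : ℂ}
    (h : ⁅central ε m s a, v⁆ = c • v) (x : V) : ⁅central ε m s a, x⁆ = c • x := by
  let W : LieSubmodule ℂ (gPM ε m s) V :=
    { carrier := {y | ⁅central ε m s a, y⁆ = c • y}
      zero_mem' := by rw [Set.mem_ofPred_eq, lie_zero, smul_zero]
      add_mem' := fun {y z} hy hz => by
        rw [Set.mem_ofPred_eq] at *
        rw [lie_add, hy, hz, smul_add]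
      smul_mem' := fun t y hy => by
        rw [Set.mem_ofPred_eq] at *
        rw [lie_smul, hy, smul_comm]
      lie_mem := fun {b y} hy => by
        change ⁅central ε m s a, ⁅b, y⁆⁆ = c • ⁅b, y⁆
        rw [leibniz_lie, central_lie, zero_lie, zero_add, ← lie_smul]
        exact congrArg _ hy }
  have hW : W = ⊤ := by
    rw [eq_top_iff, ← hv, LieSubmodule.lieSpan_le]
    exact Set.singleton_subset_iff.2 h
  have : x ∈ W := by rw [hW]; trivial
  exact this

/-- The odd central elements act on the tensor product by scalars. -/
theorem oddCentral_lie_tensor {lam : ∀ i, Module.Dual ℂ (grading ε (m i) (s i) 0)} {v : ∀ i, L i}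
    (hv : ∀ i, LieSubmodule.lieSpan ℂ (gPM ε (m i) (s i)) {v i} = ⊤)
    (hlam : ∀ i, ∀ h : grading ε (m i) (s i) 0, ⁅(h : gPM ε (m i) (s i)), v i⁆ = lam i h • v i)
    {z : gSum ε m s} (hz : z ∈ oddCentral ε m s) :
    ∃ c : ℂ, ∀ t : TensorModule L, ⁅z, t⁆ = c • t := by
  obtain ⟨i, j, -, -, -, rfl⟩ := hz
  have h := central_lie_eq_smul (hv i) (hlam i ⟨_, central_mem (uu (m i) ^ j)⟩)
  exact ⟨_, lof_lie_tensor_of_scalar h⟩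

/-- A submodule over `𝒟̂_x^±`, as a subspace of the tensor product. -/
def unrestrict (U : LieSubmodule ℂ (DxHat ε) (Restrict (phiSum ε m s) (TensorModule L))) :
    Submodule ℂ (TensorModule L) :=
  (U : Submodule ℂ (Restrict (phiSum ε m s) (TensorModule L))).comap
    (Restrict.of (phiSum ε m s) (TensorModule L)).toLinearMap

theorem toEnd_mem_opStabilizer {F : ℕ → Submodule ℂ (TensorModule L)}
    (hF : IsFiltered (gradingSum ε m s) F) (hs : Admissible s)
    {lam : ∀ i, Module.Dual ℂ (grading ε (m i) (s i) 0)} {v : ∀ i, L i}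
    (hv : ∀ i, LieSubmodule.lieSpan ℂ (gPM ε (m i) (s i)) {v i} = ⊤)
    (hlam : ∀ i, ∀ h : grading ε (m i) (s i) 0, ⁅(h : gPM ε (m i) (s i)), v i⁆ = lam i h • v i)
    (U : LieSubmodule ℂ (DxHat ε) (Restrict (phiSum ε m s) (TensorModule L)))
    (i : Fin N) (x : gPM ε (m i) (s i)) :
    LieModule.toEnd ℂ _ (L i) x ∈ opStabilizer (unrestrict U) i := by
  have hodd : ∀ z ∈ oddCentral ε m s, ∀ t : TensorModule L,
      Restrict.of (phiSum ε m s) _ t ∈ U → Restrict.of (phiSum ε m s) _ ⁅z, t⁆ ∈ U := by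
    intro z hz t ht
    obtain ⟨c, hc⟩ := oddCentral_lie_tensor hv hlam hz
    rw [hc t, map_smul]
    exact U.smul_mem c ht
  intro t ht
  have := hF.mem_stabilizer U hs hodd i x t ht
  rw [lieAlgebraOf_lie_tensor] at this
  exact this

/-- The tensor product of irreducible quasifinite highest weight modules is irreducible over
`𝒟̂_x^±`. -/
theorem isIrreducible_tensorModule (hs : Admissible s)
    {lam : ∀ i, Module.Dual ℂ (grading ε (m i) (s i) 0)}
    (hL : ∀ i, IsIrreducibleHighestWeight (grading ε (m i) (s i)) (lam i) (𝓛 i))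
    (hq : ∀ i, IsQuasifinite (grading ε (m i) (s i)) (𝓛 i)) :
    LieModule.IsIrreducible ℂ (DxHat ε) (Restrict (phiSum ε m s) (TensorModule L)) := by
  have hfil := fun i => (hq i).isFiltered
  choose v π hπ hv hlam hproj using fun i => (hL i).exists_projection iSup_grading
    (powEl_mem 1 odd_one) (fun k x hx => powEl_one_lie hx) (hfil i).exhaustive
  have hmono : ∀ i, Monotone (bounded (𝓛 i)) := fun i _ _ h => bounded_mono h
  have hF := IsFiltered.tensorSpan (𝔥 := gradingSum ε m s)
    (fun k x hx => (mem_gradingSum ε m s k x).1 hx) hmono hfil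
  have hne : TensorModule.tprod L v ≠ 0 := tprod_ne_zero π hπ
  have hnt : Nontrivial (Restrict (phiSum ε m s) (TensorModule L)) :=
    ⟨⟨TensorModule.tprod L v, 0, hne⟩⟩
  refine LieModule.IsIrreducible.mk fun U hU => ?_
  have hU' : unrestrict U ≠ ⊥ := by
    intro h
    refine hU ((LieSubmodule.eq_bot_iff U).2 fun t ht => ?_)
    have : t ∈ unrestrict U := ht
    rw [h] at this
    exact this
  have htop := eq_top_of_projection hU' (toEnd_mem_opStabilizer hF hs hv hlam U)
    hmono (fun i => (hfil i).exhaustive) hπ hv hproj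
  refine eq_top_iff.2 fun t _ => ?_
  have : t ∈ unrestrict U := by rw [htop]; trivial
  exact this

end Final

end WInf

end

theorem mainTheorem4 {N : ℕ} (ε : ℤˣ) (m : Fin N → ℕ) (s : Fin N → ℂ) (hs : WInf.Admissible s) :
    (∀ (V : Type*) [AddCommGroup V] [Module ℂ V] [LieRingModule (WInf.gSum ε m s) V]
        [LieModule ℂ (WInf.gSum ε m s) V] (𝒱 : ℤ → Submodule ℂ V),
      WInf.IsQuasifinite (WInf.gradingSum ε m s) 𝒱 →
      ∀ U : LieSubmodule ℂ (WInf.DxHat ε) (WInf.Restrict (WInf.phiSum ε m s) V),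
        (∀ x ∈ LieAlgebra.derivedSeries ℂ (WInf.gSum ε m s) 1, ∀ v : V,
          WInf.Restrict.of (WInf.phiSum ε m s) V v ∈ U →
            WInf.Restrict.of (WInf.phiSum ε m s) V ⁅x, v⁆ ∈ U) ∧
        ((∀ z ∈ WInf.oddCentral ε m s, ∀ v : V,
            WInf.Restrict.of (WInf.phiSum ε m s) V v ∈ U →
              WInf.Restrict.of (WInf.phiSum ε m s) V ⁅z, v⁆ ∈ U) →
          ∃ W : LieSubmodule ℂ (WInf.gSum ε m s) V, ∀ v : V,
            v ∈ W ↔ WInf.Restrict.of (WInf.phiSum ε m s) V v ∈ U)) ∧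
    (∀ (L : Fin N → Type*) [∀ i, AddCommGroup (L i)] [∀ i, Module ℂ (L i)]
        [∀ i, LieRingModule (WInf.gPM ε (m i) (s i)) (L i)]
        [∀ i, LieModule ℂ (WInf.gPM ε (m i) (s i)) (L i)]
        (𝓛 : ∀ i, ℤ → Submodule ℂ (L i))
        (lam : ∀ i, Module.Dual ℂ (WInf.grading ε (m i) (s i) 0)),
      (∀ i, WInf.IsIrreducibleHighestWeight (WInf.grading ε (m i) (s i)) (lam i) (𝓛 i)) →
      (∀ i, WInf.IsQuasifinite (WInf.grading ε (m i) (s i)) (𝓛 i)) →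
      LieModule.IsIrreducible ℂ (WInf.DxHat ε)
        (WInf.Restrict (WInf.phiSum ε m s) (WInf.TensorModule L))) := by
  refine ⟨fun V _ _ _ _ 𝒱 hV U => ⟨fun x hx v hv =>
    hV.isFiltered.lie_mem_of_mem_derivedSeries U hs hx hv, fun hodd => ?_⟩,
    fun L _ _ _ _ 𝓛 lam hL hq => WInf.isIrreducible_tensorModule hs hL hq⟩
  refine ⟨{ (U : Submodule ℂ (WInf.Restrict (WInf.phiSum ε m s) V)).comap
    (WInf.Restrict.of (WInf.phiSum ε m s) V).toLinearMap with
    lie_mem := fun {x v} hv => ?_ }, fun v => Iff.rfl⟩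
  exact WInf.lie_mem_of_forall_mem_stabilizer U
    (fun i => hV.isFiltered.mem_stabilizer U hs hodd i (x i)) hv
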